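/- Let $\mathcal L=\{(n,i,j)\in\mathbb Z^3: n\equiv i+j \bmod 2\}$. Let $h:\mathbb Z^2\to\mathbb Z$ be a height function: $|h(i_1,j_1)-h(i_2,j_2)|=1$ whenever $|i_1-i_2|+|j_1-j_2|=1$; $(h(i,j),i,j)\in\mathcal L$ for all $(i,j)$; and $h(i,j)+|i|+|j|\to\infty$ as $|i|+|j|\to\infty$. Put $\mathcal I=\{(n,i,j)\in\mathcal L: n=h(i,j)\}$ and $\mathcal U=\{(n,i,j)\in\mathcal L: n>h(i,j)\}$. Let $x(i,j)$ ($i,j\in\mathbb Z$) be face variables and $a(i,j),b(i,j),c(i,j),d(i,j)$ ($i+j$ odd) be edge variables, and define $f$ on $\mathcal I\cup\mathcal U$, with values in the field of rational functions in all these variables, by $f(n,i,j)=x(i,j)$ on $\mathcal I$ and, on $\mathcal U$, $$f(n,i,j)=\frac{a(i+n-1,j)\,c(i-n+1,j)\,f(n-1,i,j+1)f(n-1,i,j-1)+b(i,j+n-1)\,d(i,j-n+1)\,f(n-1,i+1,j)f(n-1,i-1,j)}{f(n-2,i,j)} .$$ *The crosses-and-wrenches graph.* Let $\mathcal G$ be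 the infinite plane graph whose faces are indexed by $(i,j)\in\mathbb Z^2$, the face $(i,j)$ corresponding to the point $(h(i,j),i,j)$ of $\mathcal I$. Two faces border, along exactly one edge, if they are at $\ell^1$-distance $1$ (a weighted edge), or if they are of the form $(i_1,j_1),(i_2,j_2)$ with $|i_1-i_2|=|j_1-j_2|=1$ and $h(i_1,j_2)\ne h(i_2,j_1)$ (an unweighted edge). The vertices of $\mathcal G$ are dual to the regions into which the unit squares with corners in $\mathbb Z^2$ are cut by the diagonals joining bordering opposite corners. The weighted edge between $(i+1,j)$ and $(i,j)$ is labelled $a(i+1+h(i,j),j)$ if $h(i,j)<h(i+1,j)$ and $c(i+1-h(i,j),j)$ otherwise; the one between $(i,j+1)$ and $(i,j)$ is labelled $b(i,j+1+h(i,j))$ if $h(i,j)<h(i,j+1)$ and $d(i,j+1-h(i,j))$ otherwise. For $p=(n_0,i_1,j_1)\in\mathcal U$, the graph with open faces $G_p$ has as closed faces the $(i,j)$ with $h(i,j)<n_0-|i-i_1|-|j-j_1|$, as edges the edges of $\mathcal G$ bordering some closed face (its vertices are their endpoints), and as open faces those faces of $\mathcal G$ some but not all of whose edges are edges of $G_p$.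 A matching of $G_p$ is a set $M$ of its edges such that every vertex lies on exactly one edge of $M$. For an edge $e$ put $\delta(e)=1$ if $e\in M$ and $\delta(e)=0$ otherwise. If a face $F$ of $G_p$ is bordered by $\alpha$ edges of $G_p$ in $M$ and $\beta$ edges of $G_p$ not in $M$, put $\varepsilon(F)=\lceil(\beta-\alpha)/2\rceil-1$ if $F$ is closed and $\varepsilon(F)=\lceil(\beta-\alpha)/2\rceil$ if $F$ is open; put $\varepsilon(F)=0$ if $F$ is not a face of $G_p$. **Proposition.** 1. For every $(n,i,j)\in\mathcal I\cup\mathcal U$, $f(n,i,j)$ is a polynomial in the edge variables and a Laurent polynomial in the face variables, with integer coefficients, in which every term has coefficient $1$; after all edge variables are replaced by $1$, every term of the resulting Laurent polynomial in the face variables still has coefficient $1$. 2. For every $p\in\mathcal U$, a matching $M$ of $G_p$ is determined by its face exponents $\varepsilon(F)$. 3. Let $p\in\mathcal U$, let $M$ be a matching of $G_p$, and let $e$ be an edge of $G_p$ labelled $a(i_0,j_0)$. Only finitely many $\varepsilon(F)$ are nonzero, and $$\delta(e)=-\sum_{\substack{(n,i,j)\in\mathcal I\\ n+i+j<i_0+j_0+1\\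 n+i-j<i_0-j_0+1}}\varepsilon(i,j).$$ -/

import Mathlib

/-! ### The lattice, cones and height functions -/

/-- The faces `(i, j)`. -/
abbrev Face : Type := ℤ × ℤ

/-- The lattice `{(n, i, j) : n ≡ i + j mod 2}`. -/
def octLattice : Set (ℤ × ℤ × ℤ) := {q | q.1 ≡ q.2.1 + q.2.2 [ZMOD 2]}

/-- `p_{(n₀,i₀,j₀)}(i, j) = n₀ - |i - i₀| - |j - j₀|`. -/
def coneHeight (p : ℤ × ℤ × ℤ) (f : Face) : ℤ := p.1 - |f.1 - p.2.1| - |f.2 - p.2.2|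

/-- The cone of `p`. -/
def cone (p : ℤ × ℤ × ℤ) : Set (ℤ × ℤ × ℤ) := {q | q ∈ octLattice ∧ q.1 ≤ coneHeight p q.2}

/-- The inner cone of `p`. -/
def innerCone (p : ℤ × ℤ × ℤ) : Set (ℤ × ℤ × ℤ) :=
  {q | q ∈ octLattice ∧ q.1 < coneHeight p q.2}

/-- Faces at `ℓ¹`-distance one. -/
def LatticeAdjacent (f g : Face) : Prop := |f.1 - g.1| + |f.2 - g.2| = 1

/-- Height functions; the last field says `h (i, j) + |i| + |j| → ∞` as `|i| + |j| → ∞`. -/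
structure IsHeightFunction (h : Face → ℤ) : Prop where
  adj : ∀ f g : Face, LatticeAdjacent f g → |h f - h g| = 1
  mem_lattice : ∀ f : Face, (h f, f) ∈ octLattice
  lim : Filter.Tendsto (fun f : Face => h f + |f.1| + |f.2|)
    (Filter.comap (fun f : Face => |f.1| + |f.2|) Filter.atTop) Filter.atTop

/-- The initial surface `𝓘`. -/
def initialSet (h : Face → ℤ) : Set (ℤ × ℤ × ℤ) := {q | q ∈ octLattice ∧ q.1 = h q.2}

/-- The part `𝓤` of the lattice strictly above the initial surface. -/
def upperSet (h : Face → ℤ) : Set (ℤ × ℤ × ℤ) := {q | q ∈ octLattice ∧ h q.2 < q.1}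

/-! ### The octahedron recurrence -/

/-- The four families of edge variables. -/
inductive EdgeKind : Type
  | a | b | c | d

/-- Edge variables `q(i, j)`, with `q ∈ {a, b, c, d}` and `i + j` odd. -/
abbrev EdgeVar : Type := EdgeKind × {v : ℤ × ℤ // v.1 + v.2 ≡ 1 [ZMOD 2]}

/-- The ring `ℤ[x(i,j), 1/x(i,j), a(i,j), b(i,j), c(i,j), d(i,j)]`: integer combinations of
monomials having integer exponents in the face variables and natural number exponents in the
edge variables. -/
abbrev LaurentRing : Type := AddMonoidAlgebra ℤ ((Face →₀ ℤ) × (EdgeVar →₀ ℕ))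

/-- Laurent polynomials over `ℤ` in the face variables only. -/
abbrev FaceLaurentRing : Type := AddMonoidAlgebra ℤ (Face →₀ ℤ)

/-- The field of formal rational functions in the face and edge variables. -/
abbrev RatFunField : Type := FractionRing LaurentRing

/-- The face variable `x(i, j)`. -/
noncomputable def xVar (f : Face) : RatFunField :=
  algebraMap LaurentRing RatFunField (AddMonoidAlgebra.single (Finsupp.single f 1, 0) 1)

/-- The edge variable `q(i, j)`. -/
noncomputable def eVar (q : EdgeKind) (i j : ℤ) (hij : i + j ≡ 1 [ZMOD 2]) : RatFunField :=
  algebraMap LaurentRing RatFunField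
    (AddMonoidAlgebra.single (0, Finsupp.single (q, ⟨(i, j), hij⟩) 1) 1)

/-- The substitution of `1` for every edge variable. -/
noncomputable def edgesToOne : LaurentRing →+* FaceLaurentRing :=
  AddMonoidAlgebra.mapDomainRingHom ℤ (AddMonoidHom.fst (Face →₀ ℤ) (EdgeVar →₀ ℕ))

theorem IsHeightFunction.side {h : Face → ℤ} (hh : IsHeightFunction h) {n i j i' j' : ℤ}
    (hp : (n, i, j) ∈ upperSet h) (hij : |i - i'| + |j - j'| = 1) :
    (n - 1, i', j') ∈ initialSet h ∪ upperSet h := by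
  have h1 := abs_le.1 (hh.adj (i, j) (i', j') hij).le
  have h0 := hh.mem_lattice (i, j)
  obtain ⟨h2, h3⟩ := hp
  have h4 : (n - 1, i', j') ∈ octLattice := by
    simp only [octLattice, Set.mem_ofPred_eq, Int.ModEq] at h2 ⊢
    rcases abs_cases (i - i') with h | h <;> rcases abs_cases (j - j') with h' | h' <;> omega
  have h5 : h (i', j') ≤ n - 1 := by
    simp only [octLattice, Set.mem_ofPred_eq, Int.ModEq] at h0 h2 h3
    have := h1.1
    omega
  rcases h5.eq_or_lt with h6 | h6
  · exact Or.inl ⟨h4, h6.symm⟩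
  · exact Or.inr ⟨h4, h6⟩

theorem IsHeightFunction.below {h : Face → ℤ} (hh : IsHeightFunction h) {n i j : ℤ}
    (hp : (n, i, j) ∈ upperSet h) : (n - 2, i, j) ∈ initialSet h ∪ upperSet h := by
  have h1 := hh.mem_lattice (i, j)
  obtain ⟨h2, h3⟩ := hp
  simp only [octLattice, Set.mem_ofPred_eq, Int.ModEq] at h1 h2 h3
  have h4 : (n - 2, i, j) ∈ octLattice := by
    simp only [octLattice, Set.mem_ofPred_eq, Int.ModEq]
    omega
  have h5 : h (i, j) ≤ n - 2 := by omega
  rcases h5.eq_or_lt with h6 | h6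
  · exact Or.inl ⟨h4, h6.symm⟩
  · exact Or.inr ⟨h4, h6⟩

theorem odd_add_of_mem {n i j : ℤ} (hp : (n, i, j) ∈ octLattice) :
    i + n - 1 + j ≡ 1 [ZMOD 2] ∧ i - n + 1 + j ≡ 1 [ZMOD 2] ∧
      i + (j + n - 1) ≡ 1 [ZMOD 2] ∧ i + (j - n + 1) ≡ 1 [ZMOD 2] := by
  simp only [octLattice, Set.mem_ofPred_eq, Int.ModEq] at *
  omega

theorem IsHeightFunction.finite {h : Face → ℤ} (hh : IsHeightFunction h) (p : ℤ × ℤ × ℤ) :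
    (upperSet h ∩ cone p).Finite := by
  obtain ⟨n, i, j⟩ := p
  have h1 := hh.lim.eventually_gt_atTop (n + |i| + |j|)
  rw [Filter.eventually_comap] at h1
  obtain ⟨N, hN⟩ := Filter.eventually_atTop.1 h1
  have hfin : (Set.Icc (-N) N ×ˢ Set.Icc (-N) N : Set Face).Finite :=
    (Set.finite_Icc _ _).prod (Set.finite_Icc _ _)
  refine (hfin.biUnion (t := fun f => (fun m => (m, f)) '' Set.Icc (h f) n)
    fun f _ => (Set.finite_Icc _ _).image _).subset ?_
  rintro ⟨m, k, l⟩ ⟨⟨-, h2⟩, ⟨-, h3⟩⟩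
  simp only [coneHeight] at h2 h3
  have h4 : |k| ≤ |k - i| + |i| := by simpa using abs_add_le (k - i) i
  have h5 : |l| ≤ |l - j| + |j| := by simpa using abs_add_le (l - j) j
  have h6 : |k| + |l| < N := by
    by_contra! h7
    have := hN _ h7 (k, l) rfl
    simp only at this
    omega
  have h7 := abs_nonneg k
  have h8 := abs_nonneg l
  have h9 := abs_nonneg (k - i)
  have h10 := abs_nonneg (l - j)
  have h11 : |k| ≤ N := by omega
  have h12 : |l| ≤ N := by omega
  simp only [Set.mem_iUnion, Set.mem_image]
  refine ⟨(k, l), ⟨abs_le.1 h11, abs_le.1 h12⟩, m, ⟨h2.le, by omega⟩, rfl⟩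

theorem IsHeightFunction.ncard_lt {h : Face → ℤ} (hh : IsHeightFunction h) {n i j n' i' j' : ℤ}
    (hp : (n, i, j) ∈ upperSet h) (hn : n' < n) (hd : |i - i'| + |j - j'| ≤ n - n') :
    (upperSet h ∩ cone (n', i', j')).ncard < (upperSet h ∩ cone (n, i, j)).ncard := by
  refine Set.ncard_lt_ncard ?_ (hh.finite _)
  refine ⟨?_, fun hs => ?_⟩
  · rintro ⟨m, k, l⟩ ⟨h1, h2, h3⟩
    refine ⟨h1, h2, ?_⟩
    simp only [coneHeight] at h3 ⊢
    have h4 := abs_sub_le k i' i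
    have h5 := abs_sub_le l j' j
    rw [abs_sub_comm i' i] at h4
    rw [abs_sub_comm j' j] at h5
    omega
  · have := (hs ⟨hp, hp.1, by simp [coneHeight]⟩).2.2
    simp only [coneHeight] at this
    have h4 := abs_nonneg (i - i')
    have h5 := abs_nonneg (j - j')
    omega

open Classical in
/-- The function `f` on `𝓘 ∪ 𝓤` defined by the octahedron recurrence. -/
noncomputable def octF {h : Face → ℤ} (hh : IsHeightFunction h) (n i j : ℤ)
    (_hp : (n, i, j) ∈ initialSet h ∪ upperSet h) : RatFunField :=
  if hU : (n, i, j) ∈ upperSet h then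
    (eVar .a (i + n - 1) j (odd_add_of_mem hU.1).1
        * eVar .c (i - n + 1) j (odd_add_of_mem hU.1).2.1
        * octF hh (n - 1) i (j + 1) (hh.side hU (by simp))
        * octF hh (n - 1) i (j - 1) (hh.side hU (by simp))
      + eVar .b i (j + n - 1) (odd_add_of_mem hU.1).2.2.1
        * eVar .d i (j - n + 1) (odd_add_of_mem hU.1).2.2.2
        * octF hh (n - 1) (i + 1) j (hh.side hU (by simp))
        * octF hh (n - 1) (i - 1) j (hh.side hU (by simp)))
      / octF hh (n - 2) i j (hh.below hU)
  else xVar (i, j)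
termination_by (upperSet h ∩ cone (n, i, j)).ncard
decreasing_by
  all_goals exact hh.ncard_lt hU (by omega) (by simp)

/-! ### The crosses and wrenches graph, described through its dual -/

/-- Two faces of the infinite graph border: they are lattice-adjacent, or they are diagonally
opposite in a unit square whose other two corners have different heights. -/
def FacesBorder (h : Face → ℤ) (f g : Face) : Prop :=
  LatticeAdjacent f g ∨
    (|f.1 - g.1| = 1 ∧ |f.2 - g.2| = 1 ∧ h (f.1, g.2) ≠ h (g.1, f.2))

/-- The edges of the infinite graph. Bordering faces share exactly one edge, so an edge is
the unordered pair of the two faces it separates; the edge `e` borders the face `f` iff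
`f ∈ e`. -/
def infEdges (h : Face → ℤ) : Set (Sym2 Face) := {e | ∃ f g, FacesBorder h f g ∧ e = s(f, g)}

/-- The vertices of the infinite graph, each given as the set of faces around it. In the unit
square with lower left corner `(i, j)` there is a single vertex, with four faces around it, if
neither pair of opposite corners borders (a cross); otherwise there are two vertices, the two
triangles into which the bordering pair of corners cuts the square (a wrench). -/
def infVertices (h : Face → ℤ) : Set (Finset Face) :=
  {v | ∃ i j : ℤ,
    (¬ FacesBorder h (i, j) (i + 1, j + 1) ∧ ¬ FacesBorder h (i + 1, j) (i, j + 1) ∧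
      v = {(i, j), (i + 1, j), (i, j + 1), (i + 1, j + 1)}) ∨
    (FacesBorder h (i, j) (i + 1, j + 1) ∧
      (v = {(i, j), (i + 1, j + 1), (i + 1, j)} ∨ v = {(i, j), (i + 1, j + 1), (i, j + 1)})) ∨
    (FacesBorder h (i + 1, j) (i, j + 1) ∧
      (v = {(i + 1, j), (i, j + 1), (i, j)} ∨ v = {(i + 1, j), (i, j + 1), (i + 1, j + 1)}))}

/-- `v` is an endpoint of the edge `e`: both faces separated by `e` are among the faces
around `v`. -/
def IsEndpoint (v : Finset Face) (e : Sym2 Face) : Prop := ∀ f ∈ e, f ∈ v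

/-- `EdgeLabel h e q i j` says that `e` is a weighted edge carrying the label `q(i, j)`; unweighted
(diagonal) edges carry no label. -/
inductive EdgeLabel (h : Face → ℤ) : Sym2 Face → EdgeKind → ℤ → ℤ → Prop
  | a (i j : ℤ) (hlt : h (i, j) < h (i + 1, j)) :
      EdgeLabel h s((i + 1, j), (i, j)) .a (i + 1 + h (i, j)) j
  | c (i j : ℤ) (hlt : h (i + 1, j) < h (i, j)) :
      EdgeLabel h s((i + 1, j), (i, j)) .c (i + 1 - h (i, j)) j
  | b (i j : ℤ) (hlt : h (i, j) < h (i, j + 1)) :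
      EdgeLabel h s((i, j + 1), (i, j)) .b i (j + 1 + h (i, j))
  | d (i j : ℤ) (hlt : h (i, j + 1) < h (i, j)) :
      EdgeLabel h s((i, j + 1), (i, j)) .d i (j + 1 - h (i, j))

/-! ### The finite graphs with open faces, matchings and exponents -/

/-- The closed faces of `G_p`. -/
def closedFaces (h : Face → ℤ) (p : ℤ × ℤ × ℤ) : Set Face := {f | (h f, f) ∈ innerCone p}

/-- The edges of `G_p`. -/
def edges (h : Face → ℤ) (p : ℤ × ℤ × ℤ) : Set (Sym2 Face) :=
  {e | e ∈ infEdges h ∧ ∃ f ∈ e, f ∈ closedFaces h p}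

/-- The vertices of `G_p`. -/
def vertices (h : Face → ℤ) (p : ℤ × ℤ × ℤ) : Set (Finset Face) :=
  {v | v ∈ infVertices h ∧ ∃ e ∈ edges h p, IsEndpoint v e}

/-- The open faces of `G_p`: some but not all of their edges are edges of `G_p`. -/
def openFaces (h : Face → ℤ) (p : ℤ × ℤ × ℤ) : Set Face :=
  {f | (∃ e ∈ infEdges h, f ∈ e ∧ e ∈ edges h p) ∧ ∃ e ∈ infEdges h, f ∈ e ∧ e ∉ edges h p}

/-- Perfect matchings of `G_p`. -/
def IsMatching (h : Face → ℤ) (p : ℤ × ℤ × ℤ) (M : Set (Sym2 Face)) : Prop :=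
  M ⊆ edges h p ∧ ∀ v ∈ vertices h p, ∃! e, e ∈ M ∧ IsEndpoint v e

open Classical in
/-- The exponent `δ(e)` of an edge in the matching monomial. -/
noncomputable def edgeExponent (M : Set (Sym2 Face)) (e : Sym2 Face) : ℤ := if e ∈ M then 1 else 0

/-- `⌈(b - a) / 2⌉`, where `a` and `b` count the edges of `G_p` bordering `f` that lie in `M` and
that do not lie in `M`. -/
noncomputable def halfExcess (h : Face → ℤ) (p : ℤ × ℤ × ℤ) (M : Set (Sym2 Face)) (f : Face) : ℤ :=
  ⌈((({e | e ∈ edges h p ∧ f ∈ e ∧ e ∉ M}.ncard : ℚ) -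
      ({e | e ∈ edges h p ∧ f ∈ e ∧ e ∈ M}.ncard : ℚ)) / 2)⌉

open Classical in
/-- The exponent `ε(f)` of the face variable `x(f)` in the matching monomial; it is `0` if `f` is
not a face of `G_p`. -/
noncomputable def faceExponent (h : Face → ℤ) (p : ℤ × ℤ × ℤ) (M : Set (Sym2 Face)) (f : Face) :
    ℤ :=
  if f ∈ closedFaces h p then halfExcess h p M f - 1
  else if f ∈ openFaces h p then halfExcess h p M f
  else 0

/-- The faces `(i, j)` whose point `(n, i, j)` of `𝓘` satisfies `n + i + j < i₀ + j₀ + 1` and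
`n + i - j < i₀ - j₀ + 1`. -/
def quadrant (h : Face → ℤ) (i₀ j₀ : ℤ) : Set Face :=
  {f | h f + f.1 + f.2 < i₀ + j₀ + 1 ∧ h f + f.1 - f.2 < i₀ - j₀ + 1}

/-! Fix `p` and replace `h` by `truncate h p`, the minimum of `h` and the cone of `p`. On this
surface a configuration is recorded by its finite set of weighted edges; the diagonals are then
forced.

Raising a local minimum by two (`IsFlip`) is urban renewal. The four neighbours of the raised face
have equal heights, so at each of its corners a cross turns into a wrench or conversely, and balance
is kept when the occupations of the two sides at each corner, before and after, add up to one. A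
single occupied side then moves to the opposite side with the same weight. The empty pattern
corresponds to the two patterns of opposite sides, and the ratios of weights are the two terms of
the octahedron recurrence divided by its left-hand side. Hence the sum of all weights is invariant
(`sum_weight_flip`). Finitely many flips lead to the cone, whose only configuration is empty and has
weight `F p`; thus `F p` is the sum of the weights (`IsSurface.sum_weight`). For the function `f` of
the theorem, every weight is a monomial.

That the monomials differ comes from gradings. If both terms of the recurrence have the degree of
its left-hand side, the same induction shows that every configuration has the degree of `p`
(`IsSurface.degree_eq`). For an edge label `l`, give degree one to `l`, degree zero to the other
labels, and to lattice points the indicator of the quadrant `region l`. The resulting identity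
`IsHeightFunction.occ_add_finsum` expresses each occupation number through the face exponents. So
face exponents alone determine a configuration, and coefficients stay `1` even without the edge
variables. The formula for `a` edges is the same identity with `p` outside the region.

For matchings, the weighted edges of a matching of `G_p` form a configuration of the truncated
surface (`isConfig_of_isMatching`) with the same face exponents (`faceExponent_eq_surfExp`), and
they determine the matching (`matching_ext`). The converse passage from configurations to matchings
is not needed. -/

/-! ### Surfaces, configurations and flips. -/

/-- The surfaces lying below the cone of `p` and differing from it at finitely many faces. -/
structure IsSurface (p : ℤ × ℤ × ℤ) (g : Face → ℤ) : Prop where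
  horiz : ∀ i j, g (i + 1, j) = g (i, j) + 1 ∨ g (i + 1, j) = g (i, j) - 1
  vert : ∀ i j, g (i, j + 1) = g (i, j) + 1 ∨ g (i, j + 1) = g (i, j) - 1
  parity : ∀ i j, (g (i, j) - i - j) % 2 = 0
  le : ∀ f, g f ≤ coneHeight p f
  finite : {f | g f ≠ coneHeight p f}.Finite

/-- Pairs of lattice-adjacent faces: `(false, i, j)` stands for the edge between `(i, j)` and
`(i + 1, j)`, and `(true, i, j)` for the edge between `(i, j)` and `(i, j + 1)`. -/
abbrev LatticeEdge : Type := Bool × Face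

/-- The indicator function of a set of lattice edges. -/
def occ (W : Finset LatticeEdge) (e : LatticeEdge) : ℤ := if e ∈ W then 1 else 0

theorem occ_nonneg (W : Finset LatticeEdge) (e : LatticeEdge) : 0 ≤ occ W e := by
  unfold occ; split_ifs <;> norm_num

theorem occ_eq_one_iff {W : Finset LatticeEdge} {e : LatticeEdge} : occ W e = 1 ↔ e ∈ W := by
  unfold occ; split_ifs <;> simp_all

/-- The matching condition at the vertices inside the unit square with lower left corner `(i, j)`,
expressed through the weighted edges only. -/
def SquareBalanced (g : Face → ℤ) (W : Finset LatticeEdge) (i j : ℤ) : Prop :=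
  (g (i + 1, j) ≠ g (i, j + 1) →
    occ W (false, i, j) + occ W (true, i + 1, j) = occ W (false, i, j + 1) + occ W (true, i, j) ∧
    occ W (false, i, j) + occ W (true, i + 1, j) ≤ 1) ∧
  (g (i, j) ≠ g (i + 1, j + 1) →
    occ W (false, i, j) + occ W (true, i, j) = occ W (false, i, j + 1) + occ W (true, i + 1, j) ∧
    occ W (false, i, j) + occ W (true, i, j) ≤ 1) ∧
  (g (i + 1, j) = g (i, j + 1) → g (i, j) = g (i + 1, j + 1) →
    occ W (false, i, j) + occ W (true, i, j) + occ W (false, i, j + 1) + occ W (true, i + 1, j) = 1)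

/-- The finite sets of weighted edges of matchings of the infinite graph of `g` which consist of
unweighted edges far away. -/
def IsConfig (g : Face → ℤ) (W : Finset LatticeEdge) : Prop := ∀ i j, SquareBalanced g W i j

/-- The contribution to the excess of the diagonal from `(i, j)` to `(i + 1, j + 1)`. -/
def mainDiag (g : Face → ℤ) (W : Finset LatticeEdge) (i j : ℤ) : ℤ :=
  if g (i + 1, j) = g (i, j + 1) then 0
  else 2 * (occ W (false, i, j) + occ W (true, i + 1, j)) - 1

/-- The contribution to the excess of the diagonal from `(i + 1, j)` to `(i, j + 1)`. -/
def antiDiag (g : Face → ℤ) (W : Finset LatticeEdge) (i j : ℤ) : ℤ :=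
  if g (i, j) = g (i + 1, j + 1) then 0
  else 2 * (occ W (false, i, j) + occ W (true, i, j)) - 1

/-- The number of edges around `f` outside the matching minus the number of edges around `f` in the
matching, minus two. -/
def excess (g : Face → ℤ) (W : Finset LatticeEdge) (f : Face) : ℤ :=
  2 - 2 * (occ W (false, f.1, f.2) + occ W (false, f.1 - 1, f.2) + occ W (true, f.1, f.2)
      + occ W (true, f.1, f.2 - 1))
    + mainDiag g W f.1 f.2 + mainDiag g W (f.1 - 1) (f.2 - 1)
    + antiDiag g W (f.1 - 1) f.2 + antiDiag g W f.1 (f.2 - 1)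

/-- The exponent of the face variable of `f`. -/
def surfExp (g : Face → ℤ) (W : Finset LatticeEdge) (f : Face) : ℤ := (excess g W f + 1) / 2

/-- `g'` arises from `g` by raising the local minimum `(i, j)` by two. -/
structure IsFlip (i j : ℤ) (g g' : Face → ℤ) : Prop where
  center : g' (i, j) = g (i, j) + 2
  off : ∀ f ≠ (i, j), g' f = g f
  east : g (i + 1, j) = g (i, j) + 1
  north : g (i, j + 1) = g (i, j) + 1
  west : g (i - 1, j) = g (i, j) + 1
  south : g (i, j - 1) = g (i, j) + 1

/-- `W` and `W'` agree off the four sides of the face `(i, j)`, and are complementary at each of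
its four corners. -/
structure IsCompl4 (i j : ℤ) (W W' : Finset LatticeEdge) : Prop where
  off : ∀ e, e ≠ (false, i, j) → e ≠ (true, i, j) → e ≠ (false, i - 1, j) → e ≠ (true, i, j - 1) →
    (e ∈ W' ↔ e ∈ W)
  ne : occ W (false, i, j) + occ W (true, i, j)
    + (occ W' (false, i, j) + occ W' (true, i, j)) = 1
  nw : occ W (false, i - 1, j) + occ W (true, i, j)
    + (occ W' (false, i - 1, j) + occ W' (true, i, j)) = 1
  sw : occ W (false, i - 1, j) + occ W (true, i, j - 1)
    + (occ W' (false, i - 1, j) + occ W' (true, i, j - 1)) = 1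
  se : occ W (false, i, j) + occ W (true, i, j - 1)
    + (occ W' (false, i, j) + occ W' (true, i, j - 1)) = 1

/-! ### Balance and face exponents under a flip. -/

section Flip

variable {i j : ℤ} {g g' : Face → ℤ} {W W' : Finset LatticeEdge}

theorem IsFlip.off' (hf : IsFlip i j g g') {k l : ℤ} (h : ¬(k = i ∧ l = j)) :
    g' (k, l) = g (k, l) :=
  hf.off _ (by simpa using h)

theorem IsCompl4.off_horiz (hc : IsCompl4 i j W W') {k l : ℤ} (h : ¬(k = i ∧ l = j))
    (h' : ¬(k = i - 1 ∧ l = j)) : occ W' (false, k, l) = occ W (false, k, l) := by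
  have := hc.off (false, k, l) (by simpa using h) (by simp) (by simpa using h') (by simp)
  simp only [occ, this]

theorem IsCompl4.off_vert (hc : IsCompl4 i j W W') {k l : ℤ} (h : ¬(k = i ∧ l = j))
    (h' : ¬(k = i ∧ l = j - 1)) : occ W' (true, k, l) = occ W (true, k, l) := by
  have := hc.off (true, k, l) (by simp) (by simpa using h) (by simp) (by simpa using h')
  simp only [occ, this]

theorem squareBalanced_iff_of_main_eq (h : g (i + 1, j) = g (i, j + 1)) :
    SquareBalanced g W i j ↔
      (g (i, j) ≠ g (i + 1, j + 1) →
        occ W (false, i, j) + occ W (true, i, j)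
          = occ W (false, i, j + 1) + occ W (true, i + 1, j) ∧
        occ W (false, i, j) + occ W (true, i, j) ≤ 1) ∧
      (g (i, j) = g (i + 1, j + 1) → occ W (false, i, j) + occ W (true, i, j)
        + (occ W (false, i, j + 1) + occ W (true, i + 1, j)) = 1) := by
  simp only [SquareBalanced, h, ne_eq, not_true_eq_false, false_imp_iff, true_and, true_imp_iff,
    add_assoc]

theorem squareBalanced_iff_of_anti_eq (h : g (i, j) = g (i + 1, j + 1)) :
    SquareBalanced g W i j ↔
      (g (i + 1, j) ≠ g (i, j + 1) →
        occ W (false, i, j) + occ W (true, i + 1, j)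
          = occ W (false, i, j + 1) + occ W (true, i, j) ∧
        occ W (false, i, j) + occ W (true, i + 1, j) ≤ 1) ∧
      (g (i + 1, j) = g (i, j + 1) → occ W (false, i, j) + occ W (true, i + 1, j)
        + (occ W (false, i, j + 1) + occ W (true, i, j)) = 1) := by
  simp only [SquareBalanced, h, ne_eq, not_true_eq_false, false_imp_iff, true_and, true_imp_iff]
  refine and_congr_right fun _ => imp_congr_right fun _ => ?_
  omega

/-- Here `x` and `x'` are the heights of the flipped face before and after, `y` that of the opposite
corner of the square, `s` and `s'` the occupations of the two sides of the face at this corner, `o`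
that of the other two edges. Exactly one of `x`, `x'` equals `y`, so wrench and cross are exchanged,
and `s = o` means the same as `s' + o = 1`. -/
theorem balanced_compl_left {x y x' s o s' : ℤ} (hx : x' = x + 2) (hy : y = x ∨ y = x + 2)
    (hs : s + s' = 1) (h0 : 0 ≤ s) (h0' : 0 ≤ s') :
    ((x ≠ y → s = o ∧ s ≤ 1) ∧ (x = y → s + o = 1)) ↔
      ((x' ≠ y → s' = o ∧ s' ≤ 1) ∧ (x' = y → s' + o = 1)) := by
  subst hx
  rcases hy with rfl | rfl
  · simp only [ne_eq, not_true_eq_false, false_imp_iff, true_and, true_imp_iff,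
      show ¬(y + 2 = y) by omega, not_false_eq_true, and_true]
    omega
  · simp only [ne_eq, not_true_eq_false, false_imp_iff, true_and, true_imp_iff,
      show ¬(x = x + 2) by omega, not_false_eq_true, and_true]
    omega

theorem balanced_compl_right {x y x' s o s' : ℤ} (hx : x' = x + 2) (hy : y = x ∨ y = x + 2)
    (hs : s + s' = 1) (h0 : 0 ≤ s) (h0' : 0 ≤ s') :
    ((y ≠ x → o = s ∧ o ≤ 1) ∧ (y = x → o + s = 1)) ↔
      ((y ≠ x' → o = s' ∧ o ≤ 1) ∧ (y = x' → o + s' = 1)) := by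
  have := balanced_compl_left (o := o) hx hy hs h0 h0'
  rw [ne_comm, eq_comm (a := y), ne_comm (a := y), eq_comm (a := y), eq_comm (a := o),
    eq_comm (a := o), add_comm o, add_comm o]
  omega

/-- Only the four squares around the flipped face change. In each of them the two neighbours of the
face have equal heights, which leaves one diagonal to consider and reduces the claim to the two
complement lemmas. -/
theorem squareBalanced_flip {p : ℤ × ℤ × ℤ} (hg : IsSurface p g) (hf : IsFlip i j g g')
    (hc : IsCompl4 i j W W') (k l : ℤ) : SquareBalanced g W k l ↔ SquareBalanced g' W' k l := by
  have h1 := hf.center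
  have h2 := hf.east
  have h3 := hf.north
  have h4 := hf.west
  have h5 := hf.south
  obtain ⟨-, n1, n2, n3, n4⟩ := id hc
  have nn := occ_nonneg W
  have nn' := occ_nonneg W'
  by_cases hne : k = i ∧ l = j
  · obtain ⟨rfl, rfl⟩ := hne
    have d := hg.horiz k (l + 1)
    rw [squareBalanced_iff_of_main_eq (by omega), squareBalanced_iff_of_main_eq
      (by rw [hf.off' (by omega), hf.off' (by omega)]; omega), hf.off' (k := k + 1) (by omega),
      hc.off_horiz (l := l + 1) (by omega) (by omega),
      hc.off_vert (k := k + 1) (by omega) (by omega)]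
    exact balanced_compl_left h1 (by omega) n1 (add_nonneg (nn _) (nn _))
      (add_nonneg (nn' _) (nn' _))
  by_cases hnw : k = i - 1 ∧ l = j
  · obtain ⟨rfl, rfl⟩ := hnw
    have d := hg.horiz (i - 1) (l + 1)
    simp only [sub_add_cancel] at d
    rw [squareBalanced_iff_of_anti_eq (by rw [sub_add_cancel]; omega),
      squareBalanced_iff_of_anti_eq
        (by rw [sub_add_cancel, hf.off' (by omega), hf.off' (by omega)]; omega), sub_add_cancel,
      hf.off' (k := i - 1) (l := l + 1) (by omega),
      hc.off_horiz (l := l + 1) (by omega) (by omega),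
      hc.off_vert (k := i - 1) (by omega) (by omega)]
    exact balanced_compl_left h1 (by omega) n2 (add_nonneg (nn _) (nn _))
      (add_nonneg (nn' _) (nn' _))
  by_cases hse : k = i ∧ l = j - 1
  · obtain ⟨rfl, rfl⟩ := hse
    have d := hg.horiz k (j - 1)
    rw [squareBalanced_iff_of_anti_eq (by rw [sub_add_cancel]; omega),
      squareBalanced_iff_of_anti_eq
        (by rw [sub_add_cancel, hf.off' (by omega), hf.off' (by omega)]; omega), sub_add_cancel,
      hf.off' (k := k + 1) (by omega),
      hc.off_horiz (l := j - 1) (by omega) (by omega),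
      hc.off_vert (k := k + 1) (by omega) (by omega)]
    exact balanced_compl_right h1 (by omega) n4 (add_nonneg (nn _) (nn _))
      (add_nonneg (nn' _) (nn' _))
  by_cases hsw : k = i - 1 ∧ l = j - 1
  · obtain ⟨rfl, rfl⟩ := hsw
    have d := hg.horiz (i - 1) (j - 1)
    simp only [sub_add_cancel] at d
    rw [squareBalanced_iff_of_main_eq (by rw [sub_add_cancel, sub_add_cancel]; omega),
      squareBalanced_iff_of_main_eq
        (by rw [sub_add_cancel, sub_add_cancel, hf.off' (by omega), hf.off' (by omega)]; omega),
      sub_add_cancel, sub_add_cancel, hf.off' (k := i - 1) (by omega),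
      hc.off_horiz (l := j - 1) (by omega) (by omega),
      hc.off_vert (k := i - 1) (by omega) (by omega)]
    exact balanced_compl_right h1 (by omega) n3 (add_nonneg (nn _) (nn _))
      (add_nonneg (nn' _) (nn' _))
  rw [SquareBalanced, SquareBalanced, hf.off' hne, hf.off' (k := k + 1) (l := l) (by omega),
    hf.off' (k := k) (l := l + 1) (by omega), hf.off' (k := k + 1) (l := l + 1) (by omega),
    hc.off_horiz (k := k) (l := l) (by omega) (by omega),
    hc.off_horiz (k := k) (l := l + 1) (by omega) (by omega),
    hc.off_vert (k := k) (l := l) (by omega) (by omega),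
    hc.off_vert (k := k + 1) (l := l) (by omega) (by omega)]

theorem isConfig_flip {p : ℤ × ℤ × ℤ} (hg : IsSurface p g) (hf : IsFlip i j g g')
    (hc : IsCompl4 i j W W') : IsConfig g W ↔ IsConfig g' W' :=
  forall₂_congr fun _ _ => squareBalanced_flip hg hf hc _ _

/-- In the north-east and south-west squares this diagonal would end at the flipped face; it is
absent before and after, since the two neighbours beside it have equal heights. Elsewhere its data
do not change. -/
theorem mainDiag_flip (hf : IsFlip i j g g') (hc : IsCompl4 i j W W') {k l : ℤ}
    (h1 : ¬(k = i - 1 ∧ l = j)) (h2 : ¬(k = i ∧ l = j - 1)) :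
    mainDiag g' W' k l = mainDiag g W k l := by
  have := hf.east
  have := hf.north
  have := hf.west
  have := hf.south
  have e1 := hf.off' (k := k + 1) (l := l) (by omega)
  have e2 := hf.off' (k := k) (l := l + 1) (by omega)
  unfold mainDiag
  rw [e1, e2]
  by_cases hne : k = i ∧ l = j
  · obtain ⟨rfl, rfl⟩ := hne
    rw [if_pos (by omega), if_pos (by omega)]
  by_cases hsw : k = i - 1 ∧ l = j - 1
  · obtain ⟨rfl, rfl⟩ := hsw
    rw [sub_add_cancel, sub_add_cancel, if_pos (by omega), if_pos (by omega)]
  rw [hc.off_horiz (k := k) (l := l) (by omega) (by omega),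
    hc.off_vert (k := k + 1) (l := l) (by omega) (by omega)]

theorem antiDiag_flip (hf : IsFlip i j g g') (hc : IsCompl4 i j W W') {k l : ℤ}
    (h1 : ¬(k = i ∧ l = j)) (h2 : ¬(k = i - 1 ∧ l = j - 1)) :
    antiDiag g' W' k l = antiDiag g W k l := by
  have := hf.east
  have := hf.north
  have := hf.west
  have := hf.south
  have e1 := hf.off' (k := k) (l := l) (by omega)
  have e2 := hf.off' (k := k + 1) (l := l + 1) (by omega)
  unfold antiDiag
  rw [e1, e2]
  by_cases hne : k = i - 1 ∧ l = j
  · obtain ⟨rfl, rfl⟩ := hne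
    rw [sub_add_cancel, if_pos (by omega), if_pos (by omega)]
  by_cases hsw : k = i ∧ l = j - 1
  · obtain ⟨rfl, rfl⟩ := hsw
    rw [sub_add_cancel, if_pos (by omega), if_pos (by omega)]
  rw [hc.off_horiz (k := k) (l := l) (by omega) (by omega),
    hc.off_vert (k := k) (l := l) (by omega) (by omega)]

/-- The diagonal is present either before or after the flip, not both. With `s` the occupation of
the two sides, it contributes `2s - 1` before or `2(1 - s) - 1 = 1 - 2s` after, so the change is `1
- 2s` either way. -/
theorem antiDiag_flip_ne {p : ℤ × ℤ × ℤ} (hg : IsSurface p g) (hf : IsFlip i j g g')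
    (hc : IsCompl4 i j W W') : antiDiag g' W' i j
      = antiDiag g W i j + 1 - 2 * (occ W (false, i, j) + occ W (true, i, j)) := by
  have := hg.horiz i (j + 1)
  have := hf.center
  have := hf.north
  have := hc.ne
  have := hf.off' (k := i + 1) (l := j + 1) (by omega)
  unfold antiDiag
  split_ifs <;> omega

/-- `antiDiag` is read off the triangle at `(i - 1, j - 1)`, on the far side from the flipped face.
Balance carries the value over to the triangle containing the sides of the face. -/
theorem antiDiag_flip_sw {p : ℤ × ℤ × ℤ} (hg : IsSurface p g) (hf : IsFlip i j g g')
    (hc : IsCompl4 i j W W') (hW : IsConfig g W) : antiDiag g' W' (i - 1) (j - 1)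
      = antiDiag g W (i - 1) (j - 1) + 1
        - 2 * (occ W (false, i - 1, j) + occ W (true, i, j - 1)) := by
  have h0 := hg.horiz (i - 1) (j - 1)
  have := hf.center
  have := hf.south
  have := hc.sw
  have := hf.off' (k := i - 1) (l := j - 1) (by omega)
  have h1 := hW (i - 1) (j - 1)
  have h2 := (isConfig_flip hg hf hc).1 hW (i - 1) (j - 1)
  unfold SquareBalanced at h1 h2
  unfold antiDiag
  simp only [sub_add_cancel] at *
  split_ifs <;> omega

theorem mainDiag_flip_nw {p : ℤ × ℤ × ℤ} (hg : IsSurface p g) (hf : IsFlip i j g g')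
    (hc : IsCompl4 i j W W') (hW : IsConfig g W) : mainDiag g' W' (i - 1) j
      = mainDiag g W (i - 1) j + 1 - 2 * (occ W (false, i - 1, j) + occ W (true, i, j)) := by
  have h0 := hg.horiz (i - 1) (j + 1)
  have := hf.center
  have := hf.north
  have := hc.nw
  have := hf.off' (k := i - 1) (l := j + 1) (by omega)
  have h1 := hW (i - 1) j
  have h2 := (isConfig_flip hg hf hc).1 hW (i - 1) j
  unfold SquareBalanced at h1 h2
  unfold mainDiag
  simp only [sub_add_cancel] at *
  split_ifs <;> omega

theorem mainDiag_flip_se {p : ℤ × ℤ × ℤ} (hg : IsSurface p g) (hf : IsFlip i j g g')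
    (hc : IsCompl4 i j W W') (hW : IsConfig g W) : mainDiag g' W' i (j - 1)
      = mainDiag g W i (j - 1) + 1 - 2 * (occ W (false, i, j) + occ W (true, i, j - 1)) := by
  have h0 := hg.horiz i (j - 1)
  have := hf.center
  have := hf.south
  have := hc.se
  have := hf.off' (k := i + 1) (l := j - 1) (by omega)
  have h1 := hW i (j - 1)
  have h2 := (isConfig_flip hg hf hc).1 hW i (j - 1)
  unfold SquareBalanced at h1 h2
  unfold mainDiag
  simp only [sub_add_cancel] at *
  split_ifs <;> omega

theorem surfExp_flip_off (hf : IsFlip i j g g') (hc : IsCompl4 i j W W') {k l : ℤ}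
    (h0 : ¬(k = i ∧ l = j)) (h1 : ¬(k = i + 1 ∧ l = j)) (h2 : ¬(k = i ∧ l = j + 1))
    (h3 : ¬(k = i - 1 ∧ l = j)) (h4 : ¬(k = i ∧ l = j - 1)) :
    surfExp g' W' (k, l) = surfExp g W (k, l) := by
  simp only [surfExp, excess]
  rw [mainDiag_flip hf hc (k := k) (l := l) (by omega) (by omega),
    mainDiag_flip hf hc (k := k - 1) (l := l - 1) (by omega) (by omega),
    antiDiag_flip hf hc (k := k - 1) (l := l) (by omega) (by omega),
    antiDiag_flip hf hc (k := k) (l := l - 1) (by omega) (by omega),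
    hc.off_horiz (k := k) (l := l) (by omega) (by omega),
    hc.off_horiz (k := k - 1) (l := l) (by omega) (by omega),
    hc.off_vert (k := k) (l := l) (by omega) (by omega),
    hc.off_vert (k := k) (l := l - 1) (by omega) (by omega)]

/-- All neighbours of a local extremum have the same height, so no diagonal ends there and only the
four sides count. -/
theorem surfExp_center (hf : IsFlip i j g g') (W W' : Finset LatticeEdge) :
    surfExp g W (i, j) = 1 - (occ W (false, i, j) + occ W (true, i, j) + occ W (false, i - 1, j)
      + occ W (true, i, j - 1)) ∧
    surfExp g' W' (i, j) = 1 - (occ W' (false, i, j) + occ W' (true, i, j)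
      + occ W' (false, i - 1, j) + occ W' (true, i, j - 1)) := by
  have := hf.east
  have := hf.north
  have := hf.west
  have := hf.south
  have := hf.off' (k := i + 1) (l := j) (by omega)
  have := hf.off' (k := i) (l := j + 1) (by omega)
  have := hf.off' (k := i - 1) (l := j) (by omega)
  have := hf.off' (k := i) (l := j - 1) (by omega)
  simp only [surfExp, excess, mainDiag, antiDiag, sub_add_cancel]
  constructor
  · rw [if_pos (by omega), if_pos (by omega), if_pos (by omega), if_pos (by omega)]
    omega
  · rw [if_pos (by omega), if_pos (by omega), if_pos (by omega), if_pos (by omega)]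
    omega

/-- The neighbour sees three changes: the common side and the two diagonals at its ends. Together
they alter the excess by an even number, so the rounding in `surfExp` does no harm. -/
theorem surfExp_flip_east {p : ℤ × ℤ × ℤ} (hg : IsSurface p g) (hf : IsFlip i j g g')
    (hc : IsCompl4 i j W W') (hW : IsConfig g W) :
    surfExp g' W' (i + 1, j) = surfExp g W (i + 1, j) + 1 - occ W' (false, i, j)
      - occ W (false, i, j) - occ W (true, i, j) - occ W (true, i, j - 1) := by
  have h1 := antiDiag_flip_ne hg hf hc
  have h2 := mainDiag_flip_se hg hf hc hW
  simp only [surfExp, excess, add_sub_cancel_right]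
  rw [mainDiag_flip hf hc (k := i + 1) (l := j) (by omega) (by omega), h1, h2,
    antiDiag_flip hf hc (k := i + 1) (l := j - 1) (by omega) (by omega),
    hc.off_horiz (k := i + 1) (l := j) (by omega) (by omega),
    hc.off_vert (k := i + 1) (l := j) (by omega) (by omega),
    hc.off_vert (k := i + 1) (l := j - 1) (by omega) (by omega)]
  omega

theorem surfExp_flip_north {p : ℤ × ℤ × ℤ} (hg : IsSurface p g) (hf : IsFlip i j g g')
    (hc : IsCompl4 i j W W') (hW : IsConfig g W) :
    surfExp g' W' (i, j + 1) = surfExp g W (i, j + 1) + 1 - occ W' (true, i, j)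
      - occ W (true, i, j) - occ W (false, i, j) - occ W (false, i - 1, j) := by
  have h1 := antiDiag_flip_ne hg hf hc
  have h2 := mainDiag_flip_nw hg hf hc hW
  simp only [surfExp, excess, add_sub_cancel_right]
  rw [mainDiag_flip hf hc (k := i) (l := j + 1) (by omega) (by omega), h1, h2,
    antiDiag_flip hf hc (k := i - 1) (l := j + 1) (by omega) (by omega),
    hc.off_horiz (k := i) (l := j + 1) (by omega) (by omega),
    hc.off_horiz (k := i - 1) (l := j + 1) (by omega) (by omega),
    hc.off_vert (k := i) (l := j + 1) (by omega) (by omega)]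
  omega

theorem surfExp_flip_west {p : ℤ × ℤ × ℤ} (hg : IsSurface p g) (hf : IsFlip i j g g')
    (hc : IsCompl4 i j W W') (hW : IsConfig g W) :
    surfExp g' W' (i - 1, j) = surfExp g W (i - 1, j) + 1 - occ W' (false, i - 1, j)
      - occ W (false, i - 1, j) - occ W (true, i, j) - occ W (true, i, j - 1) := by
  have h1 := antiDiag_flip_sw hg hf hc hW
  have h2 := mainDiag_flip_nw hg hf hc hW
  simp only [surfExp, excess]
  rw [mainDiag_flip hf hc (k := i - 1 - 1) (l := j - 1) (by omega) (by omega), h1, h2,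
    antiDiag_flip hf hc (k := i - 1 - 1) (l := j) (by omega) (by omega),
    hc.off_horiz (k := i - 1 - 1) (l := j) (by omega) (by omega),
    hc.off_vert (k := i - 1) (l := j) (by omega) (by omega),
    hc.off_vert (k := i - 1) (l := j - 1) (by omega) (by omega)]
  omega

theorem surfExp_flip_south {p : ℤ × ℤ × ℤ} (hg : IsSurface p g) (hf : IsFlip i j g g')
    (hc : IsCompl4 i j W W') (hW : IsConfig g W) :
    surfExp g' W' (i, j - 1) = surfExp g W (i, j - 1) + 1 - occ W' (true, i, j - 1)
      - occ W (true, i, j - 1) - occ W (false, i, j) - occ W (false, i - 1, j) := by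
  have h1 := antiDiag_flip_sw hg hf hc hW
  have h2 := mainDiag_flip_se hg hf hc hW
  simp only [surfExp, excess]
  rw [mainDiag_flip hf hc (k := i - 1) (l := j - 1 - 1) (by omega) (by omega), h1, h2,
    antiDiag_flip hf hc (k := i) (l := j - 1 - 1) (by omega) (by omega),
    hc.off_horiz (k := i) (l := j - 1) (by omega) (by omega),
    hc.off_horiz (k := i - 1) (l := j - 1) (by omega) (by omega),
    hc.off_vert (k := i) (l := j - 1 - 1) (by omega) (by omega)]
  omega

end Flip

/-! ### Weights and their change under a flip. -/

/-- The label of the weighted edge corresponding to a lattice edge. -/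
def edgeLab (g : Face → ℤ) : LatticeEdge → EdgeKind × ℤ × ℤ
  | (false, i, j) =>
    if g (i, j) < g (i + 1, j) then (.a, i + 1 + g (i, j), j) else (.c, i + 1 - g (i, j), j)
  | (true, i, j) =>
    if g (i, j) < g (i, j + 1) then (.b, i, j + 1 + g (i, j)) else (.d, i, j + 1 - g (i, j))

/-- The weight of a configuration, for given values of edge and face variables. -/
noncomputable def weight {K : Type*} [Field K] (y : EdgeKind × ℤ × ℤ → K) (F : ℤ × ℤ × ℤ → K)
    (g : Face → ℤ) (W : Finset LatticeEdge) : K :=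
  (∏ e ∈ W, y (edgeLab g e)) * ∏ᶠ f, F (g f, f) ^ surfExp g W f

/-- Isolates the factors changed by a flip: `P` is the common product of all the others. -/
theorem finprod_eq_prod_mul_finprod_compl {α M : Type*} [CommMonoid M] {u v : α → M}
    (S : Finset α) (hu : u.mulSupport.Finite) (huv : ∀ a ∉ S, v a = u a) :
    ∃ P : M, ∏ᶠ a, u a = P * ∏ a ∈ S, u a ∧ ∏ᶠ a, v a = P * ∏ a ∈ S, v a := by
  classical
  refine ⟨∏ a ∈ hu.toFinset \ S, u a, ?_, ?_⟩
  · rw [finprod_eq_prod_of_mulSupport_subset (s := hu.toFinset ∪ S) u (by simp),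
      ← Finset.prod_sdiff (Finset.subset_union_right (s₁ := hu.toFinset)),
      Finset.union_sdiff_right]
  · rw [finprod_eq_prod_of_mulSupport_subset (s := hu.toFinset ∪ S) v,
      ← Finset.prod_sdiff (Finset.subset_union_right (s₁ := hu.toFinset)),
      Finset.union_sdiff_right]
    · congr 1
      exact Finset.prod_congr rfl fun a ha => huv a (Finset.mem_sdiff.1 ha).2
    · intro a ha
      by_cases h : a ∈ S
      · simp [h]
      · have h' : a ∈ u.mulSupport := by
          rwa [Function.mem_mulSupport, ← huv a h]
        simpa [h] using h'

/-- The four sides of a face. -/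
def sides (i j : ℤ) : Finset LatticeEdge :=
  {(false, i, j), (true, i, j), (false, i - 1, j), (true, i, j - 1)}

/-- A face together with its four neighbours. -/
def nbhd (i j : ℤ) : Finset Face := {(i, j), (i + 1, j), (i, j + 1), (i - 1, j), (i, j - 1)}

theorem prod_sides {M : Type*} [CommMonoid M] (i j : ℤ) (u : LatticeEdge → M) :
    ∏ e ∈ sides i j, u e
      = u (false, i, j) * u (true, i, j) * u (false, i - 1, j) * u (true, i, j - 1) := by
  unfold sides
  rw [Finset.prod_insert (by simp; omega), Finset.prod_insert (by simp; omega),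
    Finset.prod_insert (by simp), Finset.prod_singleton]
  simp only [mul_assoc]

theorem prod_nbhd {M : Type*} [CommMonoid M] (i j : ℤ) (u : Face → M) :
    ∏ f ∈ nbhd i j, u f
      = u (i, j) * u (i + 1, j) * u (i, j + 1) * u (i - 1, j) * u (i, j - 1) := by
  unfold nbhd
  rw [Finset.prod_insert (by simp; omega), Finset.prod_insert (by simp; omega),
    Finset.prod_insert (by simp; omega), Finset.prod_insert (by simp),
    Finset.prod_singleton]
  simp only [mul_assoc]

theorem prod_eq_sdiff_mul_zpow {K : Type*} [Field K] (W S : Finset LatticeEdge)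
    (u : LatticeEdge → K) :
    ∏ e ∈ W, u e = (∏ e ∈ W \ S, u e) * ∏ e ∈ S, u e ^ occ W e := by
  rw [← Finset.prod_inter_mul_prod_sdiff W S, mul_comm, Finset.inter_comm,
    ← Finset.prod_ite_mem]
  congr 1
  refine Finset.prod_congr rfl fun e _ => ?_
  unfold occ
  split_ifs <;> simp

section Flip

variable {p : ℤ × ℤ × ℤ} {i j : ℤ} {g g' : Face → ℤ} {W W' : Finset LatticeEdge}

theorem IsCompl4.sdiff_eq (hc : IsCompl4 i j W W') : W' \ sides i j = W \ sides i j := by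
  ext e
  simp only [Finset.mem_sdiff, sides, Finset.mem_insert, Finset.mem_singleton, not_or]
  exact and_congr_left fun h => hc.off e h.1 h.2.1 h.2.2.1 h.2.2.2

theorem edgeLab_flip_off (hf : IsFlip i j g g') {e : LatticeEdge} (he : e ∉ sides i j) :
    edgeLab g' e = edgeLab g e := by
  obtain ⟨⟨⟩ | ⟨⟩, k, l⟩ := e
  · simp [sides] at he
    simp only [edgeLab]
    rw [hf.off' (k := k) (l := l) (by omega), hf.off' (k := k + 1) (l := l) (by omega)]
  · simp [sides] at he
    simp only [edgeLab]
    rw [hf.off' (k := k) (l := l) (by omega), hf.off' (k := k) (l := l + 1) (by omega)]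

/-- A flip moves each label to the opposite side of the face. This is why moving a single occupied
side across the face preserves the edge part of the weight. -/
theorem edgeLab_flip_sides (hf : IsFlip i j g g') :
    (edgeLab g (false, i, j) = (.a, i + 1 + g (i, j), j) ∧
      edgeLab g (true, i, j) = (.b, i, j + 1 + g (i, j)) ∧
      edgeLab g (false, i - 1, j) = (.c, i - 1 - g (i, j), j) ∧
      edgeLab g (true, i, j - 1) = (.d, i, j - 1 - g (i, j))) ∧
    edgeLab g' (false, i, j) = (.c, i - 1 - g (i, j), j) ∧
      edgeLab g' (true, i, j) = (.d, i, j - 1 - g (i, j)) ∧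
      edgeLab g' (false, i - 1, j) = (.a, i + 1 + g (i, j), j) ∧
      edgeLab g' (true, i, j - 1) = (.b, i, j + 1 + g (i, j)) := by
  have h0 := hf.center
  have h1 := hf.east
  have h2 := hf.north
  have h3 := hf.west
  have h4 := hf.south
  have e1 := hf.off' (k := i + 1) (l := j) (by omega)
  have e2 := hf.off' (k := i) (l := j + 1) (by omega)
  have e3 := hf.off' (k := i - 1) (l := j) (by omega)
  have e4 := hf.off' (k := i) (l := j - 1) (by omega)
  simp only [edgeLab, sub_add_cancel, e1, e2, e3, e4, h0, h1, h2, h3, h4]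
  refine ⟨⟨?_, ?_, ?_, ?_⟩, ?_, ?_, ?_, ?_⟩ <;> split_ifs <;>
    first | omega | (simp; try omega)

theorem support_surfExp_flip (hf : IsFlip i j g g') (hc : IsCompl4 i j W W')
    (h : (Function.support (surfExp g' W')).Finite) :
    (Function.support (surfExp g W)).Finite := by
  refine (h.union (nbhd i j).finite_toSet).subset ?_
  rintro ⟨k, l⟩ hkl
  by_contra! h'
  simp only [Set.mem_union, Function.mem_support, not_or, nbhd, Finset.coe_insert,
    Finset.coe_singleton, Set.mem_insert_iff, Set.mem_singleton_iff, Prod.mk.injEq, not_not] at h'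
  obtain ⟨h1, h2, h3, h4, h5, h6⟩ := h'
  exact hkl (by rw [← surfExp_flip_off hf hc h2 h3 h4 h5 h6, h1])

variable {K : Type*} [Field K] (y : EdgeKind × ℤ × ℤ → K) {F : ℤ × ℤ × ℤ → K}

theorem prod_edgeLab_flip (hf : IsFlip i j g g') (hc : IsCompl4 i j W W') :
    ∃ P : K, ∏ e ∈ W, y (edgeLab g e) = P * (y (.a, i + 1 + g (i, j), j) ^ occ W (false, i, j)
        * y (.b, i, j + 1 + g (i, j)) ^ occ W (true, i, j)
        * y (.c, i - 1 - g (i, j), j) ^ occ W (false, i - 1, j)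
        * y (.d, i, j - 1 - g (i, j)) ^ occ W (true, i, j - 1)) ∧
      ∏ e ∈ W', y (edgeLab g' e) = P * (y (.c, i - 1 - g (i, j), j) ^ occ W' (false, i, j)
        * y (.d, i, j - 1 - g (i, j)) ^ occ W' (true, i, j)
        * y (.a, i + 1 + g (i, j), j) ^ occ W' (false, i - 1, j)
        * y (.b, i, j + 1 + g (i, j)) ^ occ W' (true, i, j - 1)) := by
  obtain ⟨⟨h1, h2, h3, h4⟩, h5, h6, h7, h8⟩ := edgeLab_flip_sides hf
  refine ⟨∏ e ∈ W \ sides i j, y (edgeLab g e), ?_, ?_⟩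
  · rw [prod_eq_sdiff_mul_zpow W (sides i j), prod_sides, h1, h2, h3, h4]
  · rw [prod_eq_sdiff_mul_zpow W' (sides i j), prod_sides, h5, h6, h7, h8, hc.sdiff_eq]
    congr 1
    exact Finset.prod_congr rfl fun e he => by
      rw [edgeLab_flip_off hf (Finset.mem_sdiff.1 he).2]

/-- The exponents `a`, `b`, `c`, `d` of the four neighbours before the flip remain arbitrary, so
that comparing weights becomes an identity in a field. -/
theorem finprod_surfExp_flip (hg : IsSurface p g) (hf : IsFlip i j g g')
    (hc : IsCompl4 i j W W') (hW : IsConfig g W)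
    (hfin : (Function.support (surfExp g W)).Finite) :
    ∃ (P : K) (a b c d : ℤ), ∏ᶠ f, F (g f, f) ^ surfExp g W f
        = P * (F (g (i, j), i, j) ^ (1 - (occ W (false, i, j) + occ W (true, i, j)
            + occ W (false, i - 1, j) + occ W (true, i, j - 1)))
          * F (g (i, j) + 1, i + 1, j) ^ a * F (g (i, j) + 1, i, j + 1) ^ b
          * F (g (i, j) + 1, i - 1, j) ^ c * F (g (i, j) + 1, i, j - 1) ^ d) ∧
      ∏ᶠ f, F (g' f, f) ^ surfExp g' W' f
        = P * (F (g (i, j) + 2, i, j) ^ (1 - (occ W' (false, i, j) + occ W' (true, i, j)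
            + occ W' (false, i - 1, j) + occ W' (true, i, j - 1)))
          * F (g (i, j) + 1, i + 1, j) ^ (a + 1 - occ W' (false, i, j) - occ W (false, i, j)
            - occ W (true, i, j) - occ W (true, i, j - 1))
          * F (g (i, j) + 1, i, j + 1) ^ (b + 1 - occ W' (true, i, j) - occ W (true, i, j)
            - occ W (false, i, j) - occ W (false, i - 1, j))
          * F (g (i, j) + 1, i - 1, j) ^ (c + 1 - occ W' (false, i - 1, j)
            - occ W (false, i - 1, j) - occ W (true, i, j) - occ W (true, i, j - 1))
          * F (g (i, j) + 1, i, j - 1) ^ (d + 1 - occ W' (true, i, j - 1)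
            - occ W (true, i, j - 1) - occ W (false, i, j) - occ W (false, i - 1, j))) := by
  obtain ⟨P, h1, h2⟩ := finprod_eq_prod_mul_finprod_compl
    (u := fun f => F (g f, f) ^ surfExp g W f) (v := fun f => F (g' f, f) ^ surfExp g' W' f)
    (nbhd i j) (hfin.subset fun f hf' h0 => hf' (by simp [h0])) (by
      rintro ⟨k, l⟩ hkl
      simp only [nbhd, Finset.mem_insert, Finset.mem_singleton, Prod.mk.injEq, not_or] at hkl
      obtain ⟨h2, h3, h4, h5, h6⟩ := hkl
      rw [surfExp_flip_off hf hc h2 h3 h4 h5 h6, hf.off' h2])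
  have e1 := hf.off' (k := i + 1) (l := j) (by omega)
  have e2 := hf.off' (k := i) (l := j + 1) (by omega)
  have e3 := hf.off' (k := i - 1) (l := j) (by omega)
  have e4 := hf.off' (k := i) (l := j - 1) (by omega)
  refine ⟨P, surfExp g W (i + 1, j), surfExp g W (i, j + 1), surfExp g W (i - 1, j),
    surfExp g W (i, j - 1), ?_, ?_⟩
  · rw [h1, prod_nbhd, (surfExp_center hf W W').1, hf.east, hf.north, hf.west, hf.south]
  · rw [h2, prod_nbhd, (surfExp_center hf W W').2, e1, e2, e3, e4, hf.east, hf.north, hf.west,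
      hf.south, hf.center, surfExp_flip_east hg hf hc hW, surfExp_flip_north hg hf hc hW,
      surfExp_flip_west hg hf hc hW, surfExp_flip_south hg hf hc hW]

/-- The three cases are one occupied side (equal weights), none before, and none after. In the last
two the opposite pair is east-west or north-south, and the weights are in the ratio of the
corresponding term of the recurrence to its left-hand side. -/
theorem weight_flip (hg : IsSurface p g) (hf : IsFlip i j g g') (hc : IsCompl4 i j W W')
    (hW : IsConfig g W) (hfin : (Function.support (surfExp g W)).Finite) (hF : ∀ q, F q ≠ 0) :
    ((occ W (false, i, j) + occ W (true, i, j) + occ W (false, i - 1, j)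
        + occ W (true, i, j - 1) = 1) → weight y F g' W' = weight y F g W) ∧
    ((occ W (false, i, j) + occ W (true, i, j) + occ W (false, i - 1, j)
        + occ W (true, i, j - 1) = 0) →
      (occ W' (false, i, j) = 1 → weight y F g' W' * (F (g (i, j) + 2, i, j) * F (g (i, j), i, j))
        = weight y F g W * (y (.a, i + 1 + g (i, j), j) * y (.c, i - 1 - g (i, j), j)
          * F (g (i, j) + 1, i, j + 1) * F (g (i, j) + 1, i, j - 1))) ∧
      (occ W' (true, i, j) = 1 → weight y F g' W' * (F (g (i, j) + 2, i, j) * F (g (i, j), i, j))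
        = weight y F g W * (y (.b, i, j + 1 + g (i, j)) * y (.d, i, j - 1 - g (i, j))
          * F (g (i, j) + 1, i + 1, j) * F (g (i, j) + 1, i - 1, j)))) ∧
    ((occ W' (false, i, j) + occ W' (true, i, j) + occ W' (false, i - 1, j)
        + occ W' (true, i, j - 1) = 0) →
      (occ W (false, i, j) = 1 → weight y F g W * (F (g (i, j) + 2, i, j) * F (g (i, j), i, j))
        = weight y F g' W' * (y (.a, i + 1 + g (i, j), j) * y (.c, i - 1 - g (i, j), j)
          * F (g (i, j) + 1, i, j + 1) * F (g (i, j) + 1, i, j - 1))) ∧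
      (occ W (true, i, j) = 1 → weight y F g W * (F (g (i, j) + 2, i, j) * F (g (i, j), i, j))
        = weight y F g' W' * (y (.b, i, j + 1 + g (i, j)) * y (.d, i, j - 1 - g (i, j))
          * F (g (i, j) + 1, i + 1, j) * F (g (i, j) + 1, i - 1, j)))) := by
  obtain ⟨P, h1, h2⟩ := prod_edgeLab_flip y hf hc
  obtain ⟨Q, a, b, c, d, h3, h4⟩ := finprod_surfExp_flip (F := F) hg hf hc hW hfin
  obtain ⟨-, n1, n2, n3, n4⟩ := hc
  have nn := occ_nonneg W
  have nn' := occ_nonneg W'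
  have a1 := nn (false, i, j)
  have a2 := nn (true, i, j)
  have a3 := nn (false, i - 1, j)
  have a4 := nn (true, i, j - 1)
  have b1 := nn' (false, i, j)
  have b2 := nn' (true, i, j)
  have b3 := nn' (false, i - 1, j)
  have b4 := nn' (true, i, j - 1)
  unfold weight
  rw [h1, h2, h3, h4]
  clear h1 h2 h3 h4 hW hfin nn nn'
  have x0 := hF (g (i, j), i, j)
  have x1 := hF (g (i, j) + 1, i + 1, j)
  have x2 := hF (g (i, j) + 1, i, j + 1)
  have x3 := hF (g (i, j) + 1, i - 1, j)
  have x4 := hF (g (i, j) + 1, i, j - 1)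
  have x5 := hF (g (i, j) + 2, i, j)
  generalize occ W (false, i, j) = oe at *
  generalize occ W (true, i, j) = on at *
  generalize occ W (false, i - 1, j) = ow at *
  generalize occ W (true, i, j - 1) = os at *
  generalize occ W' (false, i, j) = oe' at *
  generalize occ W' (true, i, j) = on' at *
  generalize occ W' (false, i - 1, j) = ow' at *
  generalize occ W' (true, i, j - 1) = os' at *
  generalize F (g (i, j), i, j) = x at *
  generalize F (g (i, j) + 1, i + 1, j) = xe at *
  generalize F (g (i, j) + 1, i, j + 1) = xn at *
  generalize F (g (i, j) + 1, i - 1, j) = xw at *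
  generalize F (g (i, j) + 1, i, j - 1) = xs at *
  generalize F (g (i, j) + 2, i, j) = x' at *
  refine ⟨fun h => ?_, fun h => ⟨fun h' => ?_, fun h' => ?_⟩, fun h => ⟨fun h' => ?_, fun h' => ?_⟩⟩
  -- The four corner equations force the complement of a single side to be the opposite side alone.
  · have : oe = 1 ∨ on = 1 ∨ ow = 1 ∨ os = 1 := by omega
    rcases this with h' | h' | h' | h'
    · obtain ⟨rfl, rfl, rfl, rfl, rfl, rfl, rfl, rfl⟩ : oe = 1 ∧ on = 0 ∧ ow = 0 ∧ os = 0 ∧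
        oe' = 0 ∧ on' = 0 ∧ ow' = 1 ∧ os' = 0 := by
        refine ⟨?_, ?_, ?_, ?_, ?_, ?_, ?_, ?_⟩ <;> omega
      simp
    · obtain ⟨rfl, rfl, rfl, rfl, rfl, rfl, rfl, rfl⟩ : oe = 0 ∧ on = 1 ∧ ow = 0 ∧ os = 0 ∧
        oe' = 0 ∧ on' = 0 ∧ ow' = 0 ∧ os' = 1 := by
        refine ⟨?_, ?_, ?_, ?_, ?_, ?_, ?_, ?_⟩ <;> omega
      simp
    · obtain ⟨rfl, rfl, rfl, rfl, rfl, rfl, rfl, rfl⟩ : oe = 0 ∧ on = 0 ∧ ow = 1 ∧ os = 0 ∧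
        oe' = 1 ∧ on' = 0 ∧ ow' = 0 ∧ os' = 0 := by
        refine ⟨?_, ?_, ?_, ?_, ?_, ?_, ?_, ?_⟩ <;> omega
      simp
    · obtain ⟨rfl, rfl, rfl, rfl, rfl, rfl, rfl, rfl⟩ : oe = 0 ∧ on = 0 ∧ ow = 0 ∧ os = 1 ∧
        oe' = 0 ∧ on' = 1 ∧ ow' = 0 ∧ os' = 0 := by
        refine ⟨?_, ?_, ?_, ?_, ?_, ?_, ?_, ?_⟩ <;> omega
      simp
  · obtain ⟨rfl, rfl, rfl, rfl, rfl, rfl, rfl, rfl⟩ : oe = 0 ∧ on = 0 ∧ ow = 0 ∧ os = 0 ∧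
      oe' = 1 ∧ on' = 0 ∧ ow' = 1 ∧ os' = 0 := by
      refine ⟨?_, ?_, ?_, ?_, ?_, ?_, ?_, ?_⟩ <;> omega
    simp [zpow_add₀, x2, x4]
    field_simp
  · obtain ⟨rfl, rfl, rfl, rfl, rfl, rfl, rfl, rfl⟩ : oe = 0 ∧ on = 0 ∧ ow = 0 ∧ os = 0 ∧
      oe' = 0 ∧ on' = 1 ∧ ow' = 0 ∧ os' = 1 := by
      refine ⟨?_, ?_, ?_, ?_, ?_, ?_, ?_, ?_⟩ <;> omega
    simp [zpow_add₀, x1, x3]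
    field_simp
  · obtain ⟨rfl, rfl, rfl, rfl, rfl, rfl, rfl, rfl⟩ : oe = 1 ∧ on = 0 ∧ ow = 1 ∧ os = 0 ∧
      oe' = 0 ∧ on' = 0 ∧ ow' = 0 ∧ os' = 0 := by
      refine ⟨?_, ?_, ?_, ?_, ?_, ?_, ?_, ?_⟩ <;> omega
    simp [zpow_sub₀, x2, x4]
    field_simp
  · obtain ⟨rfl, rfl, rfl, rfl, rfl, rfl, rfl, rfl⟩ : oe = 0 ∧ on = 1 ∧ ow = 0 ∧ os = 1 ∧
      oe' = 0 ∧ on' = 0 ∧ ow' = 0 ∧ os' = 0 := by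
      refine ⟨?_, ?_, ?_, ?_, ?_, ?_, ?_, ?_⟩ <;> omega
    simp [zpow_sub₀, x1, x3]
    field_simp

end Flip

/-! ### From a surface to its cone. -/

section Cone

variable {p : ℤ × ℤ × ℤ} {g : Face → ℤ} {W : Finset LatticeEdge}

theorem coneHeight_succ_fst_of_le {i : ℤ} (h : p.2.1 ≤ i) (j : ℤ) :
    coneHeight p (i + 1, j) = coneHeight p (i, j) - 1 := by
  simp only [coneHeight]
  rw [abs_of_nonneg (by omega : 0 ≤ i + 1 - p.2.1), abs_of_nonneg (by omega : 0 ≤ i - p.2.1)]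
  ring

theorem coneHeight_succ_fst_of_lt {i : ℤ} (h : i < p.2.1) (j : ℤ) :
    coneHeight p (i + 1, j) = coneHeight p (i, j) + 1 := by
  simp only [coneHeight]
  rw [abs_of_nonpos (by omega : i + 1 - p.2.1 ≤ 0), abs_of_nonpos (by omega : i - p.2.1 ≤ 0)]
  ring

theorem coneHeight_succ_snd_of_le {j : ℤ} (h : p.2.2 ≤ j) (i : ℤ) :
    coneHeight p (i, j + 1) = coneHeight p (i, j) - 1 := by
  simp only [coneHeight]
  rw [abs_of_nonneg (by omega : 0 ≤ j + 1 - p.2.2), abs_of_nonneg (by omega : 0 ≤ j - p.2.2)]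
  ring

theorem coneHeight_succ_snd_of_lt {j : ℤ} (h : j < p.2.2) (i : ℤ) :
    coneHeight p (i, j + 1) = coneHeight p (i, j) + 1 := by
  simp only [coneHeight]
  rw [abs_of_nonpos (by omega : j + 1 - p.2.2 ≤ 0), abs_of_nonpos (by omega : j - p.2.2 ≤ 0)]
  ring

theorem coneHeight_horiz (p : ℤ × ℤ × ℤ) (i j : ℤ) :
    coneHeight p (i + 1, j) = coneHeight p (i, j) + 1 ∨
      coneHeight p (i + 1, j) = coneHeight p (i, j) - 1 := by
  rcases le_or_gt p.2.1 i with h | h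
  · exact Or.inr (coneHeight_succ_fst_of_le h j)
  · exact Or.inl (coneHeight_succ_fst_of_lt h j)

theorem coneHeight_vert (p : ℤ × ℤ × ℤ) (i j : ℤ) :
    coneHeight p (i, j + 1) = coneHeight p (i, j) + 1 ∨
      coneHeight p (i, j + 1) = coneHeight p (i, j) - 1 := by
  rcases le_or_gt p.2.2 j with h | h
  · exact Or.inr (coneHeight_succ_snd_of_le h i)
  · exact Or.inl (coneHeight_succ_snd_of_lt h i)

theorem coneHeight_parity (hp : p ∈ octLattice) (i j : ℤ) :
    (coneHeight p (i, j) - i - j) % 2 = 0 := by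
  simp only [octLattice, Set.mem_ofPred_eq, Int.ModEq] at hp
  simp only [coneHeight]
  rcases abs_cases (i - p.2.1) with h | h <;> rcases abs_cases (j - p.2.2) with h' | h' <;> omega

/-- By parity the gap to the cone is at least two, so the raised surface is still below it. -/
theorem IsSurface.flip (hp : p ∈ octLattice) (hg : IsSurface p g) {i j : ℤ}
    (hlt : g (i, j) < coneHeight p (i, j)) (he : g (i + 1, j) = g (i, j) + 1)
    (hn : g (i, j + 1) = g (i, j) + 1) (hw : g (i - 1, j) = g (i, j) + 1)
    (hs : g (i, j - 1) = g (i, j) + 1) :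
    IsSurface p (Function.update g (i, j) (g (i, j) + 2)) ∧
      IsFlip i j g (Function.update g (i, j) (g (i, j) + 2)) ∧
      g (i, j) + 2 ≤ coneHeight p (i, j) := by
  have hle : g (i, j) + 2 ≤ coneHeight p (i, j) := by
    have := hg.parity i j
    have := coneHeight_parity hp i j
    omega
  have hf : IsFlip i j g (Function.update g (i, j) (g (i, j) + 2)) :=
    ⟨by simp, fun f hf => by simp [hf], he, hn, hw, hs⟩
  refine ⟨⟨fun k l => ?_, fun k l => ?_, fun k l => ?_, fun f => ?_, ?_⟩, hf, hle⟩
  · have := hg.horiz k l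
    by_cases h1 : k = i ∧ l = j
    · obtain ⟨rfl, rfl⟩ := h1
      rw [hf.center, hf.off' (by omega)]
      omega
    by_cases h2 : k = i - 1 ∧ l = j
    · obtain ⟨rfl, rfl⟩ := h2
      rw [sub_add_cancel, hf.center, hf.off' (by omega)]
      omega
    rw [hf.off' h1, hf.off' (by omega)]
    exact this
  · have := hg.vert k l
    by_cases h1 : k = i ∧ l = j
    · obtain ⟨rfl, rfl⟩ := h1
      rw [hf.center, hf.off' (by omega)]
      omega
    by_cases h2 : k = i ∧ l = j - 1
    · obtain ⟨rfl, rfl⟩ := h2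
      rw [sub_add_cancel, hf.center, hf.off' (by omega)]
      omega
    rw [hf.off' h1, hf.off' (by omega)]
    exact this
  · have := hg.parity k l
    by_cases h1 : k = i ∧ l = j
    · obtain ⟨rfl, rfl⟩ := h1
      rw [hf.center]
      omega
    rw [hf.off' h1]
    exact this
  · by_cases h1 : f = (i, j)
    · rw [h1, hf.center]
      exact hle
    · rw [hf.off f h1]
      exact hg.le f
  · refine (hg.finite.insert (i, j)).subset fun f hf' => ?_
    by_cases h1 : f = (i, j)
    · exact Or.inl h1
    · refine Or.inr ?_
      rw [Set.mem_ofPred_eq, hf.off f h1] at hf'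
      exact hf'

/-- Take a lowest face among the finitely many off the cone. A lower neighbour would be off the cone
too: the gap at the chosen face is at least two, while the cone drops by at most one. -/
theorem IsSurface.exists_localMin (hp : p ∈ octLattice) (hg : IsSurface p g)
    (hne : g ≠ coneHeight p) : ∃ i j, g (i, j) < coneHeight p (i, j) ∧
      g (i + 1, j) = g (i, j) + 1 ∧ g (i, j + 1) = g (i, j) + 1 ∧
      g (i - 1, j) = g (i, j) + 1 ∧ g (i, j - 1) = g (i, j) + 1 := by
  obtain ⟨f, hf⟩ := Function.ne_iff.1 hne
  obtain ⟨⟨i, j⟩, h1, h2⟩ := Set.exists_min_image _ g hg.finite ⟨f, hf⟩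
  have h0 : g (i, j) < coneHeight p (i, j) := lt_of_le_of_ne (hg.le _) h1
  have h3 : g (i, j) + 2 ≤ coneHeight p (i, j) := by
    have := hg.parity i j
    have := coneHeight_parity hp i j
    omega
  have key : ∀ f, coneHeight p (i, j) - 1 ≤ coneHeight p f → g (i, j) - 1 = g f → False := by
    intro f hf1 hf2
    have h4 := h2 f (show g f ≠ coneHeight p f by omega)
    omega
  clear hf h2 h1 h0
  have h0 : g (i, j) < coneHeight p (i, j) := by omega
  clear h3
  refine ⟨i, j, h0, ?_, ?_, ?_, ?_⟩
  · have := coneHeight_horiz p i j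
    exact (hg.horiz i j).resolve_right fun h => key (i + 1, j) (by omega) h.symm
  · have := coneHeight_vert p i j
    exact (hg.vert i j).resolve_right fun h => key (i, j + 1) (by omega) h.symm
  · have h1 := coneHeight_horiz p (i - 1) j
    have h2 := hg.horiz (i - 1) j
    have h3 := key (i - 1, j)
    rw [sub_add_cancel] at h1 h2
    by_contra h
    exact h3 (by omega) (by omega)
  · have h1 := coneHeight_vert p i (j - 1)
    have h2 := hg.vert i (j - 1)
    have h3 := key (i, j - 1)
    rw [sub_add_cancel] at h1 h2
    by_contra h
    exact h3 (by omega) (by omega)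

/-- Every surface is obtained from the cone by lowering local maxima. -/
@[elab_as_elim]
theorem IsSurface.induction (hp : p ∈ octLattice) {P : (Face → ℤ) → Prop}
    (base : P (coneHeight p))
    (step : ∀ g g' i j, IsSurface p g → IsSurface p g' → IsFlip i j g g' →
      g (i, j) + 2 ≤ coneHeight p (i, j) → P g' → P g)
    (hg : IsSurface p g) : P g := by
  -- Induction on the total gap to the cone, over a fixed finite set `S` outside which surface and
  -- cone agree; a flip never leaves `S`.
  suffices h : ∀ (N : ℕ) (g : Face → ℤ) (S : Finset Face), IsSurface p g →
      (∀ f ∉ S, g f = coneHeight p f) → ∑ f ∈ S, (coneHeight p f - g f) ≤ N → P g by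
    refine h (∑ f ∈ hg.finite.toFinset, (coneHeight p f - g f)).toNat g hg.finite.toFinset hg
      (fun f hf => ?_) (Int.self_le_toNat _)
    simpa using hf
  intro N
  induction N with
  | zero =>
    intro g S hg hS h0
    have hnn : ∀ f ∈ S, 0 ≤ coneHeight p f - g f := fun f _ => sub_nonneg.2 (hg.le f)
    have h1 := (Finset.sum_eq_zero_iff_of_nonneg hnn).1
      (le_antisymm (by simpa using h0) (Finset.sum_nonneg hnn))
    have : g = coneHeight p := by
      funext f
      by_cases hf : f ∈ S
      · linarith [h1 f hf]
      · exact hS f hf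
    rwa [this]
  | succ N ih =>
    intro g S hg hS hN
    by_cases hne : g = coneHeight p
    · rwa [hne]
    obtain ⟨i, j, hlt, he, hn, hw, hs⟩ := hg.exists_localMin hp hne
    obtain ⟨hg', hf, hle⟩ := hg.flip hp hlt he hn hw hs
    set g' := Function.update g (i, j) (g (i, j) + 2)
    have hij : (i, j) ∈ S := by
      by_contra h
      exact hlt.ne (hS _ h)
    refine step g g' i j hg hg' hf hle (ih g' S hg' (fun f hf' => ?_) ?_)
    · rw [hf.off f (fun h => hf' (h ▸ hij)), hS f hf']
    · have : ∑ f ∈ S, (coneHeight p f - g' f) < ∑ f ∈ S, (coneHeight p f - g f) := by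
        refine Finset.sum_lt_sum (fun f _ => ?_) ⟨(i, j), hij, ?_⟩
        · by_cases h : f = (i, j)
          · rw [h, hf.center]
            omega
          · rw [hf.off f h]
        · rw [hf.center]
          omega
      push_cast at hN
      omega

theorem occ_empty (e : LatticeEdge) : occ ∅ e = 0 := by simp [occ]

/-- Every face of the cone other than the apex meets exactly two diagonals, which cancel the
constant `2` in `excess`; the apex meets none. -/
theorem surfExp_cone (p : ℤ × ℤ × ℤ) (f : Face) :
    surfExp (coneHeight p) ∅ f = if f = p.2 then 1 else 0 := by
  obtain ⟨i, j⟩ := f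
  obtain ⟨n, i₀, j₀⟩ := p
  have h1 := @coneHeight_succ_fst_of_le (n, i₀, j₀) i
  have h2 := @coneHeight_succ_fst_of_lt (n, i₀, j₀) i
  have h3 := @coneHeight_succ_fst_of_le (n, i₀, j₀) (i - 1)
  have h4 := @coneHeight_succ_fst_of_lt (n, i₀, j₀) (i - 1)
  have h5 := @coneHeight_succ_snd_of_le (n, i₀, j₀) j
  have h6 := @coneHeight_succ_snd_of_lt (n, i₀, j₀) j
  have h7 := @coneHeight_succ_snd_of_le (n, i₀, j₀) (j - 1)
  have h8 := @coneHeight_succ_snd_of_lt (n, i₀, j₀) (j - 1)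
  simp only [sub_add_cancel] at *
  simp only [surfExp, excess, mainDiag, antiDiag, occ_empty, sub_add_cancel, Prod.mk.injEq]
  have d1 : (coneHeight (n, i₀, j₀) (i + 1, j) = coneHeight (n, i₀, j₀) (i, j) - 1 ∧ i₀ ≤ i) ∨
    (coneHeight (n, i₀, j₀) (i + 1, j) = coneHeight (n, i₀, j₀) (i, j) + 1 ∧ i < i₀) := by
      rcases le_or_gt i₀ i with h | h
      · exact Or.inl ⟨h1 h j, h⟩
      · exact Or.inr ⟨h2 h j, h⟩
  have d2 : (coneHeight (n, i₀, j₀) (i, j) = coneHeight (n, i₀, j₀) (i - 1, j) - 1 ∧ i₀ < i) ∨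
    (coneHeight (n, i₀, j₀) (i, j) = coneHeight (n, i₀, j₀) (i - 1, j) + 1 ∧ i ≤ i₀) := by
      rcases lt_or_ge i₀ i with h | h
      · exact Or.inl ⟨h3 (by omega) j, h⟩
      · exact Or.inr ⟨h4 (by omega) j, h⟩
  have d3 : (coneHeight (n, i₀, j₀) (i, j + 1) = coneHeight (n, i₀, j₀) (i, j) - 1 ∧ j₀ ≤ j) ∨
    (coneHeight (n, i₀, j₀) (i, j + 1) = coneHeight (n, i₀, j₀) (i, j) + 1 ∧ j < j₀) := by
      rcases le_or_gt j₀ j with h | h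
      · exact Or.inl ⟨h5 h i, h⟩
      · exact Or.inr ⟨h6 h i, h⟩
  have d4 : (coneHeight (n, i₀, j₀) (i, j) = coneHeight (n, i₀, j₀) (i, j - 1) - 1 ∧ j₀ < j) ∨
    (coneHeight (n, i₀, j₀) (i, j) = coneHeight (n, i₀, j₀) (i, j - 1) + 1 ∧ j ≤ j₀) := by
      rcases lt_or_ge j₀ j with h | h
      · exact Or.inl ⟨h7 (by omega) i, h⟩
      · exact Or.inr ⟨h8 (by omega) i, h⟩
  clear h1 h2 h3 h4 h5 h6 h7 h8
  rcases d1 with ⟨d1, e1⟩ | ⟨d1, e1⟩ <;> rcases d2 with ⟨d2, e2⟩ | ⟨d2, e2⟩ <;>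
    rcases d3 with ⟨d3, e3⟩ | ⟨d3, e3⟩ <;> rcases d4 with ⟨d4, e4⟩ | ⟨d4, e4⟩ <;>
    split_ifs <;> omega

/-- The sum of the heights of the two faces next to an edge. -/
def edgeSum (g : Face → ℤ) : LatticeEdge → ℤ
  | (false, i, j) => g (i, j) + g (i + 1, j)
  | (true, i, j) => g (i, j) + g (i, j + 1)

/-- An occupied edge of least `edgeSum` borders an outward square. The diagonal of that square
separates a triangle containing the edge from a triangle whose two weighted edges have smaller sums,
hence are empty; this contradicts balance. -/
theorem isConfig_cone_iff (p : ℤ × ℤ × ℤ) : IsConfig (coneHeight p) W ↔ W = ∅ := by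
  constructor
  · intro hW
    by_contra hne
    obtain ⟨e, he, hmin⟩ := Finset.exists_min_image W (edgeSum (coneHeight p))
      (Finset.nonempty_iff_ne_empty.2 hne)
    have ho : ∀ e', edgeSum (coneHeight p) e' < edgeSum (coneHeight p) e → occ W e' = 0 := by
      intro e' h
      rw [occ, if_neg fun h' => (hmin e' h').not_gt h]
    have he1 := occ_eq_one_iff.2 he
    have nn := occ_nonneg W
    clear hmin he hne
    obtain ⟨⟨⟩ | ⟨⟩, i, j⟩ := e
    · have hi := coneHeight_horiz p i j
      rcases le_or_gt p.2.2 j with hj | hj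
      · have a1 := coneHeight_succ_snd_of_le hj i
        have a2 := coneHeight_succ_snd_of_le hj (i + 1)
        have h1 := ho (false, i, j + 1) (by simp only [edgeSum]; omega)
        rcases hi with hi | hi
        · have h2 := ho (true, i, j) (by simp only [edgeSum]; omega)
          have h3 := ((hW i j).1 (by omega)).1
          have := nn (true, i + 1, j)
          omega
        · have h2 := ho (true, i + 1, j) (by simp only [edgeSum]; omega)
          have h3 := ((hW i j).2.1 (by omega)).1
          have := nn (true, i, j)
          omega
      · have a1 := coneHeight_succ_snd_of_lt (show j - 1 < p.2.2 by omega) i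
        have a2 := coneHeight_succ_snd_of_lt (show j - 1 < p.2.2 by omega) (i + 1)
        have hq := hW i (j - 1)
        simp only [SquareBalanced, sub_add_cancel] at a1 a2 hq
        have h1 := ho (false, i, j - 1) (by simp only [edgeSum]; omega)
        rcases hi with hi | hi
        · have h2 := ho (true, i, j - 1) (by simp only [edgeSum, sub_add_cancel]; omega)
          have h3 := (hq.2.1 (by omega)).1
          have := nn (true, i + 1, j - 1)
          omega
        · have h2 := ho (true, i + 1, j - 1) (by simp only [edgeSum, sub_add_cancel]; omega)
          have h3 := (hq.1 (by omega)).1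
          have := nn (true, i, j - 1)
          omega
    · have hj := coneHeight_vert p i j
      rcases le_or_gt p.2.1 i with hi | hi
      · have a1 := coneHeight_succ_fst_of_le hi j
        have a2 := coneHeight_succ_fst_of_le hi (j + 1)
        have h1 := ho (true, i + 1, j) (by simp only [edgeSum]; omega)
        rcases hj with hj | hj
        · have h2 := ho (false, i, j) (by simp only [edgeSum]; omega)
          have h3 := ((hW i j).1 (by omega)).1
          have := nn (false, i, j + 1)
          omega
        · have h2 := ho (false, i, j + 1) (by simp only [edgeSum]; omega)
          have h3 := ((hW i j).2.1 (by omega)).1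
          have := nn (false, i, j)
          omega
      · have a1 := coneHeight_succ_fst_of_lt (show i - 1 < p.2.1 by omega) j
        have a2 := coneHeight_succ_fst_of_lt (show i - 1 < p.2.1 by omega) (j + 1)
        have hq := hW (i - 1) j
        simp only [SquareBalanced, sub_add_cancel] at a1 a2 hq
        have h1 := ho (true, i - 1, j) (by simp only [edgeSum]; omega)
        rcases hj with hj | hj
        · have h2 := ho (false, i - 1, j) (by simp only [edgeSum, sub_add_cancel]; omega)
          have h3 := (hq.2.1 (by omega)).1
          have := nn (false, i - 1, j + 1)
          omega
        · have h2 := ho (false, i - 1, j + 1) (by simp only [edgeSum, sub_add_cancel]; omega)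
          have h3 := (hq.1 (by omega)).1
          have := nn (false, i - 1, j)
          omega
  · rintro rfl i j
    simp only [SquareBalanced, occ_empty]
    -- Without occupied edges only a cross could be unbalanced, and a cone has no crosses.
    refine ⟨fun _ => by norm_num, fun _ => by norm_num, fun h h' => ?_⟩
    rcases le_or_gt p.2.1 i with hi | hi <;> rcases le_or_gt p.2.2 j with hj | hj
    · have := coneHeight_succ_fst_of_le hi j
      have := coneHeight_succ_snd_of_le hj (i + 1)
      omega
    · have := coneHeight_succ_fst_of_le hi j
      have := coneHeight_succ_snd_of_lt hj i
      omega
    · have := coneHeight_succ_fst_of_lt hi j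
      have := coneHeight_succ_snd_of_le hj i
      omega
    · have := coneHeight_succ_fst_of_lt hi j
      have := coneHeight_succ_snd_of_lt hj (i + 1)
      omega

end Cone

/-! ### Complementary patterns on the sides of a face. -/

/-- Which of the four sides (east, north, west, south) of a face lie in a set. -/
abbrev SideStatus : Type := Bool × Bool × Bool × Bool

/-- The sides of the face `(i, j)` lying in `W`. -/
def sideStatus (i j : ℤ) (W : Finset LatticeEdge) : SideStatus :=
  (decide ((false, i, j) ∈ W), decide ((true, i, j) ∈ W), decide ((false, i - 1, j) ∈ W),
    decide ((true, i, j - 1) ∈ W))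

/-- `W` with its sides of the face `(i, j)` replaced by those of `b`. -/
def withSides (i j : ℤ) (W : Finset LatticeEdge) (b : SideStatus) : Finset LatticeEdge :=
  W \ sides i j ∪ (sides i j).filter fun e =>
    e = (false, i, j) ∧ b.1 ∨ e = (true, i, j) ∧ b.2.1 ∨ e = (false, i - 1, j) ∧ b.2.2.1 ∨
      e = (true, i, j - 1) ∧ b.2.2.2

/-- No two sides at a corner of the face. -/
def SideStatus.Sparse (b : SideStatus) : Prop :=
  b.1.toNat + b.2.1.toNat ≤ 1 ∧ b.2.2.1.toNat + b.2.1.toNat ≤ 1 ∧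
    b.2.2.1.toNat + b.2.2.2.toNat ≤ 1 ∧ b.1.toNat + b.2.2.2.toNat ≤ 1

/-- Exactly one side at each corner, in `b` and `b'` together. -/
def SideStatus.Compl (b b' : SideStatus) : Prop :=
  b.1.toNat + b.2.1.toNat + (b'.1.toNat + b'.2.1.toNat) = 1 ∧
  b.2.2.1.toNat + b.2.1.toNat + (b'.2.2.1.toNat + b'.2.1.toNat) = 1 ∧
  b.2.2.1.toNat + b.2.2.2.toNat + (b'.2.2.1.toNat + b'.2.2.2.toNat) = 1 ∧
  b.1.toNat + b.2.2.2.toNat + (b'.1.toNat + b'.2.2.2.toNat) = 1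

instance : DecidablePred SideStatus.Sparse := fun _ => by
  unfold SideStatus.Sparse; infer_instance

instance (b : SideStatus) : DecidablePred b.Compl := fun _ => by
  unfold SideStatus.Compl; infer_instance

/-- A sparse pattern is empty, a single side, or a pair of opposite sides. Its complements are
respectively either pair of opposite sides, the opposite single side, and the empty pattern. -/
theorem SideStatus.Sparse.exists_compl : ∀ {b : SideStatus}, b.Sparse → ∃ b', b.Compl b' := by
  decide

section Sides

variable {p : ℤ × ℤ × ℤ} {i j : ℤ} {g g' : Face → ℤ} {W W' : Finset LatticeEdge}

theorem mem_withSides_of_notMem {b : SideStatus} {e : LatticeEdge} (he : e ∉ sides i j) :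
    e ∈ withSides i j W b ↔ e ∈ W := by
  simp [withSides, he]

theorem sideStatus_withSides (W : Finset LatticeEdge) (b : SideStatus) :
    sideStatus i j (withSides i j W b) = b := by
  obtain ⟨b1, b2, b3, b4⟩ := b
  have h1 : ¬(i = i - 1) := by omega
  have h2 : ¬(j = j - 1) := by omega
  simp [sideStatus, withSides, sides, h1, h2]

theorem mem_iff_of_sideStatus_eq (h : sideStatus i j W = sideStatus i j W') {e : LatticeEdge}
    (he : e ∈ sides i j) : e ∈ W ↔ e ∈ W' := by
  simp only [sideStatus, Prod.mk.injEq, decide_eq_decide] at h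
  simp only [sides, Finset.mem_insert, Finset.mem_singleton] at he
  rcases he with rfl | rfl | rfl | rfl <;> simp only [h]

theorem withSides_withSides (W : Finset LatticeEdge) (b : SideStatus) :
    withSides i j (withSides i j W b) (sideStatus i j W) = W := by
  ext e
  by_cases he : e ∈ sides i j
  · exact mem_iff_of_sideStatus_eq (sideStatus_withSides _ _) he
  · rw [mem_withSides_of_notMem he, mem_withSides_of_notMem he]

theorem occ_eq_toNat (W : Finset LatticeEdge) (e : LatticeEdge) :
    occ W e = ((decide (e ∈ W)).toNat : ℤ) := by
  unfold occ
  split_ifs with h <;> simp [h]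

theorem isCompl4_of_sideStatus (h : (sideStatus i j W).Compl (sideStatus i j W'))
    (hoff : ∀ e ∉ sides i j, (e ∈ W' ↔ e ∈ W)) : IsCompl4 i j W W' := by
  obtain ⟨h1, h2, h3, h4⟩ := h
  simp only [sideStatus] at h1 h2 h3 h4
  refine ⟨fun e n1 n2 n3 n4 => hoff e (by simp [sides, n1, n2, n3, n4]), ?_, ?_, ?_, ?_⟩ <;>
    simp only [occ_eq_toNat] <;> exact_mod_cast ‹_›

theorem isCompl4_withSides {b : SideStatus} (h : (sideStatus i j W).Compl b) :
    IsCompl4 i j W (withSides i j W b) :=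
  isCompl4_of_sideStatus (by rwa [sideStatus_withSides]) fun _ he => mem_withSides_of_notMem he

theorem SquareBalanced.le_of_main_eq (h : SquareBalanced g W i j)
    (hm : g (i + 1, j) = g (i, j + 1)) :
    occ W (false, i, j) + occ W (true, i, j) ≤ 1 ∧
      occ W (false, i, j + 1) + occ W (true, i + 1, j) ≤ 1 := by
  have n1 := occ_nonneg W (false, i, j)
  have n2 := occ_nonneg W (true, i, j)
  have n3 := occ_nonneg W (false, i, j + 1)
  have n4 := occ_nonneg W (true, i + 1, j)
  by_cases h' : g (i, j) = g (i + 1, j + 1)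
  · have := h.2.2 hm h'
    omega
  · have := h.2.1 h'
    omega

theorem SquareBalanced.le_of_anti_eq (h : SquareBalanced g W i j)
    (hm : g (i, j) = g (i + 1, j + 1)) :
    occ W (false, i, j) + occ W (true, i + 1, j) ≤ 1 ∧
      occ W (false, i, j + 1) + occ W (true, i, j) ≤ 1 := by
  have n1 := occ_nonneg W (false, i, j)
  have n2 := occ_nonneg W (true, i, j)
  have n3 := occ_nonneg W (false, i, j + 1)
  have n4 := occ_nonneg W (true, i + 1, j)
  by_cases h' : g (i + 1, j) = g (i, j + 1)
  · have := h.2.2 h' hm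
    omega
  · have := h.1 h'
    omega

/-- When the four neighbours have equal heights, the two sides at each corner of the face meet in
one vertex of the graph, so at most one of them is occupied. -/
theorem IsConfig.sparse (h : IsConfig g W) (h1 : g (i + 1, j) = g (i, j + 1))
    (h2 : g (i, j + 1) = g (i - 1, j)) (h3 : g (i - 1, j) = g (i, j - 1)) :
    (sideStatus i j W).Sparse := by
  have a1 := (h i j).le_of_main_eq h1
  have a2 := (h (i - 1) j).le_of_anti_eq
  have a3 := (h (i - 1) (j - 1)).le_of_main_eq
  have a4 := (h i (j - 1)).le_of_anti_eq
  simp only [sub_add_cancel] at a2 a3 a4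
  have b2 := (a2 h2.symm).1
  have b3 := (a3 h3.symm).2
  have b4 := (a4 (h3.symm.trans (h2.symm.trans h1.symm))).2
  have b1 := a1.1
  simp only [occ_eq_toNat] at b1 b2 b3 b4
  refine ⟨?_, ?_, ?_, ?_⟩ <;> simp only [sideStatus] <;> omega

theorem IsFlip.sparse (hf : IsFlip i j g g') (h : IsConfig g W) : (sideStatus i j W).Sparse :=
  h.sparse (by rw [hf.east, hf.north]) (by rw [hf.north, hf.west]) (by rw [hf.west, hf.south])

theorem IsFlip.sparse' (hf : IsFlip i j g g') (h : IsConfig g' W) :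
    (sideStatus i j W).Sparse := by
  have e1 := hf.off' (k := i + 1) (l := j) (by omega)
  have e2 := hf.off' (k := i) (l := j + 1) (by omega)
  have e3 := hf.off' (k := i - 1) (l := j) (by omega)
  have e4 := hf.off' (k := i) (l := j - 1) (by omega)
  refine h.sparse ?_ ?_ ?_
  · rw [e1, e2, hf.east, hf.north]
  · rw [e2, e3, hf.north, hf.west]
  · rw [e3, e4, hf.west, hf.south]

theorem exists_isCompl4 (hg : IsSurface p g) (hf : IsFlip i j g g') (hW : IsConfig g W) :
    ∃ W', IsCompl4 i j W W' ∧ IsConfig g' W' := by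
  obtain ⟨b, hb⟩ := (hf.sparse hW).exists_compl
  exact ⟨_, isCompl4_withSides hb, (isConfig_flip hg hf (isCompl4_withSides hb)).1 hW⟩

end Sides

theorem IsSurface.finite_isConfig {p : ℤ × ℤ × ℤ} (hp : p ∈ octLattice) {g : Face → ℤ}
    (hg : IsSurface p g) :
    {W | IsConfig g W}.Finite ∧ ∀ W, IsConfig g W → (Function.support (surfExp g W)).Finite := by
  refine IsSurface.induction hp (P := fun g => {W | IsConfig g W}.Finite ∧
    ∀ W, IsConfig g W → (Function.support (surfExp g W)).Finite) ?_ ?_ hg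
  · simp only [isConfig_cone_iff]
    refine ⟨by simp, ?_⟩
    rintro W rfl
    refine (Set.finite_singleton p.2).subset fun f hf => ?_
    by_contra h
    exact hf ((surfExp_cone p f).trans (if_neg h))
  · intro g g' i j hg hg' hf _ ih
    refine ⟨?_, fun W hW => ?_⟩
    -- A configuration is recovered from a complement and from its own four sides, so finiteness
    -- passes down through the flip.
    · refine (Set.Finite.image2 (withSides i j) ih.1 (Set.finite_univ (α := SideStatus))).subset ?_
      intro W hW
      obtain ⟨b, hb⟩ := (hf.sparse hW).exists_compl
      exact ⟨withSides i j W b, (isConfig_flip hg hf (isCompl4_withSides hb)).1 hW,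
        sideStatus i j W, trivial, withSides_withSides W b⟩
    · obtain ⟨W', hc, hW'⟩ := exists_isCompl4 hg hf hW
      exact support_surfExp_flip hf hc (ih.2 W' hW')

/-! ### Invariance of the sum of weights. -/

section Sum

variable {p : ℤ × ℤ × ℤ} {i j : ℤ} {g g' : Face → ℤ}
  {K : Type*} [Field K] {y : EdgeKind × ℤ × ℤ → K} {F : ℤ × ℤ × ℤ → K}

/-- For a fixed pair of complementary patterns, overwriting the four sides is a bijection with
inverse of the same kind; balance is kept by `isConfig_flip`. -/
theorem sum_withSides (hg : IsSurface p g) (hf : IsFlip i j g g')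
    {V V' : Finset (Finset LatticeEdge)} (hV : ∀ W, W ∈ V ↔ IsConfig g W)
    (hV' : ∀ W, W ∈ V' ↔ IsConfig g' W) {b b' : SideStatus} (hb : b.Compl b')
    {M : Type*} [AddCommMonoid M] (u : Finset LatticeEdge → M) :
    ∑ W ∈ V' with sideStatus i j W = b', u W
      = ∑ W ∈ V with sideStatus i j W = b, u (withSides i j W b') := by
  symm
  refine Finset.sum_bij' (fun W _ => withSides i j W b') (fun W _ => withSides i j W b)
    (fun W hW => ?_) (fun W hW => ?_) (fun W hW => ?_) (fun W hW => ?_) (fun _ _ => rfl)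
  · rw [Finset.mem_filter] at hW ⊢
    obtain ⟨hW, rfl⟩ := hW
    rw [hV', sideStatus_withSides, ← isConfig_flip hg hf (isCompl4_withSides hb), ← hV]
    exact ⟨hW, rfl⟩
  · rw [Finset.mem_filter] at hW ⊢
    obtain ⟨hW, rfl⟩ := hW
    refine ⟨?_, sideStatus_withSides _ _⟩
    rw [hV, isConfig_flip hg hf (isCompl4_of_sideStatus (W' := W) ?_ fun e he => ?_), ← hV']
    · exact hW
    · rwa [sideStatus_withSides]
    · rw [mem_withSides_of_notMem he]
  · obtain ⟨hW, rfl⟩ := Finset.mem_filter.1 hW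
    exact withSides_withSides _ _
  · obtain ⟨hW, rfl⟩ := Finset.mem_filter.1 hW
    exact withSides_withSides _ _

theorem sum_sparse {V : Finset (Finset LatticeEdge)} (hV : ∀ W ∈ V, (sideStatus i j W).Sparse)
    (u : Finset LatticeEdge → K) :
    ∑ W ∈ V, u W = ∑ W ∈ V with sideStatus i j W = (false, false, false, false), u W
      + (∑ W ∈ V with sideStatus i j W = (true, false, false, false), u W
        + ∑ W ∈ V with sideStatus i j W = (false, true, false, false), u W
        + ∑ W ∈ V with sideStatus i j W = (false, false, true, false), u W
        + ∑ W ∈ V with sideStatus i j W = (false, false, false, true), u W)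
      + (∑ W ∈ V with sideStatus i j W = (true, false, true, false), u W
        + ∑ W ∈ V with sideStatus i j W = (false, true, false, true), u W) := by
  have h0 : ∀ b : SideStatus, ¬b.Sparse → ∑ W ∈ V with sideStatus i j W = b, u W = 0 := by
    intro b hb
    rw [Finset.sum_eq_zero]
    intro W hW
    obtain ⟨hW', rfl⟩ := Finset.mem_filter.1 hW
    exact absurd (hV W hW') hb
  rw [← Finset.sum_fiberwise V (sideStatus i j) u]
  simp only [Fintype.sum_prod_type, Fintype.sum_bool]
  rw [h0 (true, true, true, true) (by decide), h0 (true, true, true, false) (by decide),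
    h0 (true, true, false, true) (by decide), h0 (true, true, false, false) (by decide),
    h0 (true, false, true, true) (by decide), h0 (true, false, false, true) (by decide),
    h0 (false, true, true, true) (by decide), h0 (false, true, true, false) (by decide),
    h0 (false, false, true, true) (by decide)]
  ring

theorem occ_of_sideStatus {W : Finset LatticeEdge} {b : SideStatus} (h : sideStatus i j W = b) :
    occ W (false, i, j) = b.1.toNat ∧ occ W (true, i, j) = b.2.1.toNat ∧
      occ W (false, i - 1, j) = b.2.2.1.toNat ∧ occ W (true, i, j - 1) = b.2.2.2.toNat := by
  subst h
  simp only [occ_eq_toNat, sideStatus, and_self]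

theorem sum_weight_flip (hg : IsSurface p g) (hf : IsFlip i j g g')
    {V V' : Finset (Finset LatticeEdge)} (hV : ∀ W, W ∈ V ↔ IsConfig g W)
    (hV' : ∀ W, W ∈ V' ↔ IsConfig g' W)
    (hfin : ∀ W, IsConfig g W → (Function.support (surfExp g W)).Finite) (hF : ∀ q, F q ≠ 0)
    (hrec : F (g (i, j) + 2, i, j) * F (g (i, j), i, j)
      = y (.a, i + 1 + g (i, j), j) * y (.c, i - 1 - g (i, j), j)
          * F (g (i, j) + 1, i, j + 1) * F (g (i, j) + 1, i, j - 1)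
        + y (.b, i, j + 1 + g (i, j)) * y (.d, i, j - 1 - g (i, j))
          * F (g (i, j) + 1, i + 1, j) * F (g (i, j) + 1, i - 1, j)) :
    ∑ W ∈ V, weight y F g W = ∑ W ∈ V', weight y F g' W := by
  have hW : ∀ {b : SideStatus} {W}, W ∈ V.filter (sideStatus i j · = b) → IsConfig g W :=
    fun h => (hV _).1 (Finset.mem_filter.1 h).1
  have hc : ∀ {b b' : SideStatus} {W}, b.Compl b' → W ∈ V.filter (sideStatus i j · = b) →
      IsCompl4 i j W (withSides i j W b') := fun hb h =>
    isCompl4_withSides (by rwa [(Finset.mem_filter.1 h).2])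
  have ho : ∀ {b : SideStatus} {W}, W ∈ V.filter (sideStatus i j · = b) → _ :=
    fun h => occ_of_sideStatus (Finset.mem_filter.1 h).2
  have ho' := fun W b => occ_of_sideStatus (sideStatus_withSides (i := i) (j := j) W b)
  have one : ∀ b b' : SideStatus, b.Compl b' →
      b.1.toNat + b.2.1.toNat + b.2.2.1.toNat + b.2.2.2.toNat = 1 →
      ∑ W ∈ V' with sideStatus i j W = b', weight y F g' W
        = ∑ W ∈ V with sideStatus i j W = b, weight y F g W := by
    intro b b' hb h1
    rw [sum_withSides hg hf hV hV' hb]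
    refine Finset.sum_congr rfl fun W h => ?_
    refine (weight_flip y hg hf (hc hb h) (hW h) (hfin _ (hW h)) hF).1 ?_
    obtain ⟨h3, h4, h5, h6⟩ := ho h
    rw [h3, h4, h5, h6]
    exact_mod_cast h1
  set X := F (g (i, j) + 2, i, j) * F (g (i, j), i, j) with hX
  set A := y (.a, i + 1 + g (i, j), j) * y (.c, i - 1 - g (i, j), j)
    * F (g (i, j) + 1, i, j + 1) * F (g (i, j) + 1, i, j - 1) with hA
  set B := y (.b, i, j + 1 + g (i, j)) * y (.d, i, j - 1 - g (i, j))
    * F (g (i, j) + 1, i + 1, j) * F (g (i, j) + 1, i - 1, j) with hB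
  have upA : (∑ W ∈ V' with sideStatus i j W = (true, false, true, false), weight y F g' W) * X
      = (∑ W ∈ V with sideStatus i j W = (false, false, false, false), weight y F g W) * A := by
    have hb : SideStatus.Compl (false, false, false, false) (true, false, true, false) := by decide
    rw [sum_withSides hg hf hV hV' hb, Finset.sum_mul, Finset.sum_mul]
    refine Finset.sum_congr rfl fun W h => ?_
    obtain ⟨h3, h4, h5, h6⟩ := ho h
    refine ((weight_flip y hg hf (hc hb h) (hW h) (hfin _ (hW h)) hF).2.1 ?_).1 (ho' _ _).1
    rw [h3, h4, h5, h6]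
    rfl
  have upB : (∑ W ∈ V' with sideStatus i j W = (false, true, false, true), weight y F g' W) * X
      = (∑ W ∈ V with sideStatus i j W = (false, false, false, false), weight y F g W) * B := by
    have hb : SideStatus.Compl (false, false, false, false) (false, true, false, true) := by decide
    rw [sum_withSides hg hf hV hV' hb, Finset.sum_mul, Finset.sum_mul]
    refine Finset.sum_congr rfl fun W h => ?_
    obtain ⟨h3, h4, h5, h6⟩ := ho h
    refine ((weight_flip y hg hf (hc hb h) (hW h) (hfin _ (hW h)) hF).2.1 ?_).2 (ho' _ _).2.1
    rw [h3, h4, h5, h6]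
    rfl
  have downA : (∑ W ∈ V with sideStatus i j W = (true, false, true, false), weight y F g W) * X
      = (∑ W ∈ V' with sideStatus i j W = (false, false, false, false), weight y F g' W) * A := by
    have hb : SideStatus.Compl (true, false, true, false) (false, false, false, false) := by decide
    rw [sum_withSides hg hf hV hV' hb, Finset.sum_mul, Finset.sum_mul]
    refine Finset.sum_congr rfl fun W h => ?_
    obtain ⟨h3, h4, h5, h6⟩ := ho' W (false, false, false, false)
    refine ((weight_flip y hg hf (hc hb h) (hW h) (hfin _ (hW h)) hF).2.2 ?_).1 (ho h).1
    rw [h3, h4, h5, h6]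
    rfl
  have downB : (∑ W ∈ V with sideStatus i j W = (false, true, false, true), weight y F g W) * X
      = (∑ W ∈ V' with sideStatus i j W = (false, false, false, false), weight y F g' W) * B := by
    have hb : SideStatus.Compl (false, true, false, true) (false, false, false, false) := by decide
    rw [sum_withSides hg hf hV hV' hb, Finset.sum_mul, Finset.sum_mul]
    refine Finset.sum_congr rfl fun W h => ?_
    obtain ⟨h3, h4, h5, h6⟩ := ho' W (false, false, false, false)
    refine ((weight_flip y hg hf (hc hb h) (hW h) (hfin _ (hW h)) hF).2.2 ?_).2 (ho h).2.1
    rw [h3, h4, h5, h6]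
    rfl
  rw [sum_sparse (i := i) (j := j) (V := V) fun W h => hf.sparse ((hV W).1 h),
    sum_sparse (i := i) (j := j) (V := V') fun W h => hf.sparse' ((hV' W).1 h),
    one (true, false, false, false) (false, false, true, false) (by decide) (by decide),
    one (false, false, true, false) (true, false, false, false) (by decide) (by decide),
    one (false, true, false, false) (false, false, false, true) (by decide) (by decide),
    one (false, false, false, true) (false, true, false, false) (by decide) (by decide)]
  -- The single-side classes now agree. After multiplication by `X`, the pairs on one surface give
  -- the empty class of the other times `A + B`, and `hrec` says `A + B = X`.
  have hX0 : X ≠ 0 := mul_ne_zero (hF _) (hF _)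
  refine mul_right_cancel₀ hX0 ?_
  linear_combination downA + downB - upA - upB
    + (∑ W ∈ V' with sideStatus i j W = (false, false, false, false), weight y F g' W) * -hrec
    + (∑ W ∈ V with sideStatus i j W = (false, false, false, false), weight y F g W) * hrec

theorem weight_cone (y : EdgeKind × ℤ × ℤ → K) (F : ℤ × ℤ × ℤ → K) (p : ℤ × ℤ × ℤ) :
    weight y F (coneHeight p) ∅ = F p := by
  simp only [weight, Finset.prod_empty, one_mul, surfExp_cone]
  rw [finprod_eq_single _ p.2 fun f hf => by simp [hf]]
  simp [coneHeight]

/-- The value of a solution of the octahedron recurrence at the apex of a cone is the sum of the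
weights of the configurations of any surface below the cone. -/
theorem IsSurface.sum_weight (hp : p ∈ octLattice) (hg : IsSurface p g) (hF : ∀ q, F q ≠ 0)
    (hrec : ∀ m i j, (m - i - j) % 2 = 0 → g (i, j) ≤ m → m + 2 ≤ coneHeight p (i, j) →
      F (m + 2, i, j) * F (m, i, j)
        = y (.a, i + 1 + m, j) * y (.c, i - 1 - m, j) * F (m + 1, i, j + 1) * F (m + 1, i, j - 1)
        + y (.b, i, j + 1 + m) * y (.d, i, j - 1 - m) * F (m + 1, i + 1, j)
          * F (m + 1, i - 1, j)) :
    ∑ W ∈ (hg.finite_isConfig hp).1.toFinset, weight y F g W = F p := by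
  -- The recurrence becomes part of the induction statement because the range of heights where it is
  -- needed shrinks as the surface rises.
  suffices h : (∀ m i j, (m - i - j) % 2 = 0 → g (i, j) ≤ m → m + 2 ≤ coneHeight p (i, j) →
      F (m + 2, i, j) * F (m, i, j)
        = y (.a, i + 1 + m, j) * y (.c, i - 1 - m, j) * F (m + 1, i, j + 1) * F (m + 1, i, j - 1)
        + y (.b, i, j + 1 + m) * y (.d, i, j - 1 - m) * F (m + 1, i + 1, j)
          * F (m + 1, i - 1, j)) →
      ∀ V : Finset (Finset LatticeEdge), (∀ W, W ∈ V ↔ IsConfig g W) →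
        ∑ W ∈ V, weight y F g W = F p from h hrec _ (by simp)
  clear hrec
  refine IsSurface.induction hp ?_ ?_ hg
  · intro _ V hV
    have : V = {∅} := by
      ext W
      rw [hV, isConfig_cone_iff, Finset.mem_singleton]
    rw [this, Finset.sum_singleton, weight_cone]
  · intro g g' i j hg hg' hf hle ih hrec V hV
    have hfin := hg.finite_isConfig hp
    have hfin' := hg'.finite_isConfig hp
    rw [sum_weight_flip hg hf hV (V' := hfin'.1.toFinset) (by simp) hfin.2 hF
      (hrec _ _ _ (hg.parity i j) le_rfl hle)]
    refine ih (fun m k l h1 h2 h3 => hrec m k l h1 (le_trans ?_ h2) h3) _ (by simp)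
    by_cases h : (k, l) = (i, j)
    · rw [h, hf.center]
      omega
    · rw [hf.off _ h]

/-- If both terms of the octahedron recurrence have the same value as its left-hand side, then all
configurations have the same weight. -/
theorem IsSurface.weight_eq (hp : p ∈ octLattice) (hg : IsSurface p g) (hF : ∀ q, F q ≠ 0)
    (hrec : ∀ m i j, (m - i - j) % 2 = 0 → g (i, j) ≤ m → m + 2 ≤ coneHeight p (i, j) →
      F (m + 2, i, j) * F (m, i, j)
        = y (.a, i + 1 + m, j) * y (.c, i - 1 - m, j) * F (m + 1, i, j + 1) * F (m + 1, i, j - 1) ∧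
      F (m + 2, i, j) * F (m, i, j)
        = y (.b, i, j + 1 + m) * y (.d, i, j - 1 - m) * F (m + 1, i + 1, j)
          * F (m + 1, i - 1, j)) :
    ∀ W, IsConfig g W → weight y F g W = F p := by
  revert hrec
  refine IsSurface.induction hp ?_ ?_ hg
  · intro _ W hW
    rw [(isConfig_cone_iff p).1 hW, weight_cone]
  · intro g g' i j hg hg' hf hle ih hrec W hW
    obtain ⟨W', hc, hW'⟩ := exists_isCompl4 hg hf hW
    have h' : weight y F g' W' = F p := by
      refine ih (fun m k l h1 h2 h3 => hrec m k l h1 (le_trans ?_ h2) h3) _ hW'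
      by_cases h : (k, l) = (i, j)
      · rw [h, hf.center]
        omega
      · rw [hf.off _ h]
    rw [← h']
    have key := weight_flip y hg hf hc hW ((hg.finite_isConfig hp).2 W hW) hF
    obtain ⟨r1, r2⟩ := hrec _ _ _ (hg.parity i j) le_rfl hle
    -- With both terms equal to the left-hand side, every case of `weight_flip` says that the two
    -- weights coincide.
    rw [← r1, ← r2] at key
    have hX0 : F (g (i, j) + 2, i, j) * F (g (i, j), i, j) ≠ 0 := mul_ne_zero (hF _) (hF _)
    obtain ⟨-, n1, n2, n3, n4⟩ := hc
    have a1 := occ_nonneg W (false, i, j)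
    have a2 := occ_nonneg W (true, i, j)
    have a3 := occ_nonneg W (false, i - 1, j)
    have a4 := occ_nonneg W (true, i, j - 1)
    have b1 := occ_nonneg W' (false, i, j)
    have b2 := occ_nonneg W' (true, i, j)
    have b3 := occ_nonneg W' (false, i - 1, j)
    have b4 := occ_nonneg W' (true, i, j - 1)
    by_cases c1 : occ W (false, i, j) + occ W (true, i, j) + occ W (false, i - 1, j)
        + occ W (true, i, j - 1) = 1
    · exact (key.1 c1).symm
    by_cases c0 : occ W (false, i, j) + occ W (true, i, j) + occ W (false, i - 1, j)
        + occ W (true, i, j - 1) = 0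
    · obtain ⟨k1, k2⟩ := key.2.1 c0
      by_cases c2 : occ W' (false, i, j) = 1
      · exact (mul_right_cancel₀ hX0 (k1 c2)).symm
      · exact (mul_right_cancel₀ hX0 (k2 (by omega))).symm
    · obtain ⟨k1, k2⟩ := key.2.2 (by omega)
      by_cases c2 : occ W (false, i, j) = 1
      · exact mul_right_cancel₀ hX0 (k1 c2)
      · exact mul_right_cancel₀ hX0 (k2 (by omega))

end Sum

/-! ### Truncating a height function by a cone. -/

theorem IsHeightFunction.horiz {h : Face → ℤ} (hh : IsHeightFunction h) (i j : ℤ) :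
    h (i + 1, j) = h (i, j) + 1 ∨ h (i + 1, j) = h (i, j) - 1 := by
  have := hh.adj (i + 1, j) (i, j) (by simp [LatticeAdjacent])
  rcases abs_eq (by norm_num) |>.1 this with h | h <;> omega

theorem IsHeightFunction.vert {h : Face → ℤ} (hh : IsHeightFunction h) (i j : ℤ) :
    h (i, j + 1) = h (i, j) + 1 ∨ h (i, j + 1) = h (i, j) - 1 := by
  have := hh.adj (i, j + 1) (i, j) (by simp [LatticeAdjacent])
  rcases abs_eq (by norm_num) |>.1 this with h | h <;> omega

theorem IsHeightFunction.parity {h : Face → ℤ} (hh : IsHeightFunction h) (i j : ℤ) :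
    (h (i, j) - i - j) % 2 = 0 := by
  have := hh.mem_lattice (i, j)
  simp only [octLattice, Set.mem_ofPred_eq, Int.ModEq] at this
  omega

/-- The part of the surface of `h` below the cone of `p`, completed by the cone. -/
def truncate (h : Face → ℤ) (p : ℤ × ℤ × ℤ) (f : Face) : ℤ := min (h f) (coneHeight p f)

theorem IsHeightFunction.finite_lt_cone {h : Face → ℤ} (hh : IsHeightFunction h)
    {p : ℤ × ℤ × ℤ} (hp : p ∈ octLattice) : {f | h f < coneHeight p f}.Finite := by
  refine ((hh.finite p).image Prod.snd).subset ?_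
  rintro ⟨i, j⟩ hf
  have hl : (coneHeight p (i, j), i, j) ∈ octLattice := by
    have := coneHeight_parity hp i j
    simp only [octLattice, Set.mem_ofPred_eq, Int.ModEq]
    omega
  exact ⟨(coneHeight p (i, j), i, j), ⟨⟨hl, hf⟩, hl, le_rfl⟩, rfl⟩

/-- The minimum of two functions of equal parity with steps `±1` again has steps `±1`: they can
exchange order only through a face where they are equal. -/
theorem IsHeightFunction.isSurface_truncate {h : Face → ℤ} (hh : IsHeightFunction h)
    {p : ℤ × ℤ × ℤ} (hp : p ∈ octLattice) : IsSurface p (truncate h p) where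
  horiz i j := by
    have := hh.horiz i j
    have := coneHeight_horiz p i j
    have := hh.parity i j
    have := coneHeight_parity hp i j
    simp only [truncate]
    omega
  vert i j := by
    have := hh.vert i j
    have := coneHeight_vert p i j
    have := hh.parity i j
    have := coneHeight_parity hp i j
    simp only [truncate]
    omega
  parity i j := by
    have := hh.parity i j
    have := coneHeight_parity hp i j
    simp only [truncate]
    omega
  le f := min_le_right _ _
  finite := (hh.finite_lt_cone hp).subset fun f hf => by
    simp only [truncate, Set.mem_ofPred_eq] at hf ⊢
    omega

/-! ### Gradings of the recurrence. -/

section Homogeneity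

variable {p : ℤ × ℤ × ℤ} {g : Face → ℤ} {W : Finset LatticeEdge}

theorem prod_two_zpow {α : Type*} (s : Finset α) (u : α → ℤ) :
    ∏ a ∈ s, (2 : ℚ) ^ u a = 2 ^ ∑ a ∈ s, u a := by
  classical
  induction s using Finset.induction_on with
  | empty => simp
  | insert a s ha ih => rw [Finset.prod_insert ha, Finset.sum_insert ha, ih, zpow_add₀ two_ne_zero]

theorem finprod_two_zpow {α : Type*} (u : α → ℤ) (hu : (Function.support u).Finite) :
    ∏ᶠ a, (2 : ℚ) ^ u a = 2 ^ ∑ᶠ a, u a := by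
  rw [finsum_eq_sum_of_support_subset (s := hu.toFinset) u (by simp),
    finprod_eq_prod_of_mulSupport_subset (s := hu.toFinset), prod_two_zpow]
  intro a ha
  rw [Set.Finite.coe_toFinset, Function.mem_support]
  rintro h0
  exact ha (by simp [h0])

/-- If the octahedron recurrence is homogeneous for a grading, then so is every configuration. -/
theorem IsSurface.degree_eq (hp : p ∈ octLattice) (hg : IsSurface p g) (deg : ℤ × ℤ × ℤ → ℤ)
    (edeg : EdgeKind × ℤ × ℤ → ℤ)
    (hrec : ∀ m i j, (m - i - j) % 2 = 0 → g (i, j) ≤ m → m + 2 ≤ coneHeight p (i, j) →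
      deg (m + 2, i, j) + deg (m, i, j)
        = edeg (.a, i + 1 + m, j) + edeg (.c, i - 1 - m, j) + deg (m + 1, i, j + 1)
          + deg (m + 1, i, j - 1) ∧
      deg (m + 2, i, j) + deg (m, i, j)
        = edeg (.b, i, j + 1 + m) + edeg (.d, i, j - 1 - m) + deg (m + 1, i + 1, j)
          + deg (m + 1, i - 1, j)) (hW : IsConfig g W) :
    ∑ e ∈ W, edeg (edgeLab g e) + ∑ᶠ f, deg (g f, f) * surfExp g W f = deg p := by
  -- Evaluating every variable at `2` to its degree turns the weight into `2` to the total degree.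
  have key := hg.weight_eq (K := ℚ) hp (F := fun q => 2 ^ deg q) (y := fun q => 2 ^ edeg q)
    (fun q => zpow_ne_zero _ two_ne_zero) (fun m i j h1 h2 h3 => ?_) W hW
  · simp only [weight, prod_two_zpow, ← zpow_mul] at key
    rw [finprod_two_zpow, ← zpow_add₀ two_ne_zero] at key
    · exact zpow_right_injective₀ two_pos (by norm_num) key
    · exact ((hg.finite_isConfig hp).2 W hW).subset fun f hf h0 => hf (by simp [h0])
  · obtain ⟨r1, r2⟩ := hrec m i j h1 h2 h3
    simp only [← zpow_add₀ (two_ne_zero (α := ℚ))]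
    rw [← r1, ← r2]
    exact ⟨rfl, rfl⟩

/-- The points of degree one for the grading in which the given edge variable has degree one. -/
def region : EdgeKind × ℤ × ℤ → ℤ × ℤ × ℤ → Prop
  | (.a, i₀, j₀), (n, i, j) => n + i + j < i₀ + j₀ + 1 ∧ n + i - j < i₀ - j₀ + 1
  | (.b, i₀, j₀), (n, i, j) => n + j + i < j₀ + i₀ + 1 ∧ n + j - i < j₀ - i₀ + 1
  | (.c, i₀, j₀), (n, i, j) => n - i + j < -i₀ + j₀ + 1 ∧ n - i - j < -i₀ - j₀ + 1
  | (.d, i₀, j₀), (n, i, j) => n - j + i < -j₀ + i₀ + 1 ∧ n - j - i < -j₀ - i₀ + 1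

instance (l : EdgeKind × ℤ × ℤ) : DecidablePred (region l) := fun q => by
  obtain ⟨⟨⟩, i₀, j₀⟩ := l <;> obtain ⟨n, i, j⟩ := q <;> unfold region <;> infer_instance

instance : DecidableEq EdgeKind := fun k l => by
  cases k <;> cases l <;> first | exact isTrue rfl | exact isFalse (by rintro ⟨⟩)

/-- For `l = a(i₀, j₀)` put `s = n + i + j` and `t = n + i - j`; the region is a product of two
half-lines in `(s, t)`. The pair of points in the `b`, `d` term has the same coordinates as the pair
on the left. In the `a`, `c` term the pair is `(s + 2, t)`, `(s, t + 2)`, and the defect is a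
product of the two jumps of the indicators. By parity it is one exactly when `l = a(i + 1 + m, j)`.
The other kinds follow by symmetry. -/
theorem region_recurrence (l : EdgeKind × ℤ × ℤ) (hl : (l.2.1 + l.2.2) % 2 = 1) {m i j : ℤ}
    (hm : (m - i - j) % 2 = 0) :
    ((if region l (m + 2, i, j) then 1 else 0) + (if region l (m, i, j) then 1 else 0) : ℤ)
      = (if (EdgeKind.a, i + 1 + m, j) = l then 1 else 0)
        + (if (EdgeKind.c, i - 1 - m, j) = l then 1 else 0)
        + (if region l (m + 1, i, j + 1) then 1 else 0)
        + (if region l (m + 1, i, j - 1) then 1 else 0) ∧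
    ((if region l (m + 2, i, j) then 1 else 0) + (if region l (m, i, j) then 1 else 0) : ℤ)
      = (if (EdgeKind.b, i, j + 1 + m) = l then 1 else 0)
        + (if (EdgeKind.d, i, j - 1 - m) = l then 1 else 0)
        + (if region l (m + 1, i + 1, j) then 1 else 0)
        + (if region l (m + 1, i - 1, j) then 1 else 0) := by
  obtain ⟨⟨⟩, i₀, j₀⟩ := l <;> simp only [region, Prod.mk.injEq, reduceCtorEq, false_and,
    true_and, if_false] at hl ⊢ <;> constructor <;> split_ifs <;> omega

end Homogeneity

/-! ### Occupation numbers from face exponents. -/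

section Labels

variable {p : ℤ × ℤ × ℤ} {g : Face → ℤ}

theorem IsSurface.monotone (hg : IsSurface p g) :
    (∀ j, Monotone fun i => i + g (i, j)) ∧ (∀ j, Monotone fun i => i - g (i, j)) ∧
    (∀ i, Monotone fun j => j + g (i, j)) ∧ ∀ i, Monotone fun j => j - g (i, j) := by
  refine ⟨fun j => ?_, fun j => ?_, fun i => ?_, fun i => ?_⟩ <;>
    refine monotone_int_of_le_succ fun k => ?_
  · have := hg.horiz k j
    omega
  · have := hg.horiz k j
    omega
  · have := hg.vert i k
    omega
  · have := hg.vert i k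
    omega

/-- Along a row `i + g (i, j)` never decreases and jumps by two across each edge labelled `a`; the
label is the midpoint of the jump, so it occurs once. The other three kinds use the other three
monotone functions. -/
theorem IsSurface.injective_edgeLab (hg : IsSurface p g) : Function.Injective (edgeLab g) := by
  obtain ⟨ha, hc, hb, hd⟩ := hg.monotone
  have key : ∀ {u : ℤ → ℤ} (_ : Monotone u) {k l : ℤ}, u (k + 1) = u k + 2 → u (l + 1) = u l + 2 →
      u k = u l → k = l := by
    intro u hu k l h1 h2 h3
    rcases lt_trichotomy k l with h | h | h
    · have := hu (show k + 1 ≤ l by omega)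
      omega
    · exact h
    · have := hu (show l + 1 ≤ k by omega)
      omega
  rintro ⟨⟨⟩ | ⟨⟩, i, j⟩ ⟨⟨⟩ | ⟨⟩, k, l⟩ h <;> simp only [edgeLab] at h
  · have h1 := hg.horiz i j
    have h2 := hg.horiz k l
    split_ifs at h with c1 c2 c2 <;> simp only [Prod.mk.injEq, reduceCtorEq, false_and,
      true_and] at h
    · obtain ⟨h, rfl⟩ := h
      have := key (ha j) (k := i) (l := k) (by omega) (by omega)
        (by omega)
      rw [this]
    · obtain ⟨h, rfl⟩ := h
      have := key (hc j) (k := i) (l := k) (by omega) (by omega)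
        (by omega)
      rw [this]
  · split_ifs at h <;> simp at h
  · split_ifs at h <;> simp at h
  · have h1 := hg.vert i j
    have h2 := hg.vert k l
    split_ifs at h with c1 c2 c2 <;> simp only [Prod.mk.injEq, reduceCtorEq, false_and,
      true_and] at h
    · obtain ⟨rfl, h⟩ := h
      have := key (hb i) (k := j) (l := l) (by omega) (by omega)
        (by omega)
      rw [this]
    · obtain ⟨rfl, h⟩ := h
      have := key (hd i) (k := j) (l := l) (by omega) (by omega)
        (by omega)
      rw [this]

theorem IsSurface.odd_edgeLab (hg : IsSurface p g) (e : LatticeEdge) :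
    ((edgeLab g e).2.1 + (edgeLab g e).2.2) % 2 = 1 := by
  obtain ⟨⟨⟩ | ⟨⟩, i, j⟩ := e <;> have := hg.parity i j <;> simp only [edgeLab] <;> split_ifs <;>
    simp only <;> omega

end Labels

section Height

variable {h : Face → ℤ} {p : ℤ × ℤ × ℤ} {W W' : Finset LatticeEdge}

/-- The occupation of an edge in terms of the face exponents. -/
theorem IsHeightFunction.occ_add_finsum (hh : IsHeightFunction h) (hp : p ∈ octLattice)
    (hle : h p.2 ≤ p.1) (hW : IsConfig (truncate h p) W) (e : LatticeEdge) :
    occ W e + ∑ᶠ f, (if region (edgeLab (truncate h p) e) (h f, f) then 1 else 0)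
        * surfExp (truncate h p) W f
      = if region (edgeLab (truncate h p) e) p then 1 else 0 := by
  have hg := hh.isSurface_truncate hp
  -- The maximum with `h` makes a truncated face count at its true height on `h`. The recurrence is
  -- used only at `m ≥ h (i, j)`, where the maxima have no effect.
  have key := hg.degree_eq hp
    (fun q => if region (edgeLab (truncate h p) e) (max q.1 (h q.2), q.2) then 1 else 0)
    (fun l => if l = edgeLab (truncate h p) e then 1 else 0) (fun m i j h1 h2 h3 => ?_) hW
  · simp only [hg.injective_edgeLab.eq_iff, Finset.sum_ite_eq'] at key
    rw [max_eq_left hle] at key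
    rw [← key]
    congr 1
    refine finsum_congr fun f => ?_
    rw [max_eq_right (show truncate h p f ≤ h f from min_le_left _ _)]
  · have a0 : h (i, j) ≤ m := by
      simp only [truncate] at h2
      omega
    have a1 := hh.horiz i j
    have a2 := hh.vert i j
    have a3 := hh.horiz (i - 1) j
    have a4 := hh.vert i (j - 1)
    rw [sub_add_cancel] at a3 a4
    simp only
    rw [max_eq_left (by omega : h (i, j) ≤ m + 2), max_eq_left a0,
      max_eq_left (by omega : h (i, j + 1) ≤ m + 1), max_eq_left (by omega : h (i + 1, j) ≤ m + 1),
      max_eq_left (by omega : h (i, j - 1) ≤ m + 1), max_eq_left (by omega : h (i - 1, j) ≤ m + 1)]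
    exact region_recurrence _ (hg.odd_edgeLab e) h1

theorem IsHeightFunction.config_ext (hh : IsHeightFunction h) (hp : p ∈ octLattice)
    (hle : h p.2 ≤ p.1) (hW : IsConfig (truncate h p) W) (hW' : IsConfig (truncate h p) W')
    (he : ∀ f, surfExp (truncate h p) W f = surfExp (truncate h p) W' f) : W = W' := by
  ext e
  have h1 := hh.occ_add_finsum hp hle hW e
  have h2 := hh.occ_add_finsum hp hle hW' e
  simp only [he] at h1
  rw [← occ_eq_one_iff, ← occ_eq_one_iff, add_right_cancel (h1.trans h2.symm)]

end Height

/-! ### Nonvanishing of the solution of the recurrence. -/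

/-- The substitution of `1` for all variables. -/
noncomputable def augmentation : LaurentRing →ₐ[ℤ] ℤ := AddMonoidAlgebra.lift ℤ ℤ _ 1

theorem augmentation_single (m : (Face →₀ ℤ) × (EdgeVar →₀ ℕ)) :
    augmentation (AddMonoidAlgebra.single m 1) = 1 := by
  simp [augmentation]

/-- The rational functions which are positive at the point all of whose coordinates are `1`. -/
def IsPositive (z : RatFunField) : Prop :=
  ∃ A B : LaurentRing, 0 < augmentation A ∧ 0 < augmentation B ∧
    z = algebraMap LaurentRing RatFunField A / algebraMap LaurentRing RatFunField B

theorem algebraMap_ne_zero_of_pos {A : LaurentRing} (h : 0 < augmentation A) :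
    algebraMap LaurentRing RatFunField A ≠ 0 := by
  rw [Ne, IsFractionRing.to_map_eq_zero_iff]
  rintro rfl
  simp at h

theorem IsPositive.ne_zero {z : RatFunField} (h : IsPositive z) : z ≠ 0 := by
  obtain ⟨A, B, hA, hB, rfl⟩ := h
  exact div_ne_zero (algebraMap_ne_zero_of_pos hA) (algebraMap_ne_zero_of_pos hB)

theorem isPositive_single (m : (Face →₀ ℤ) × (EdgeVar →₀ ℕ)) :
    IsPositive (algebraMap LaurentRing RatFunField (AddMonoidAlgebra.single m 1)) :=
  ⟨AddMonoidAlgebra.single m 1, 1, by simp [augmentation_single], by simp, by simp⟩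

theorem IsPositive.mul {z w : RatFunField} (hz : IsPositive z) (hw : IsPositive w) :
    IsPositive (z * w) := by
  obtain ⟨A, B, hA, hB, rfl⟩ := hz
  obtain ⟨C, D, hC, hD, rfl⟩ := hw
  refine ⟨A * C, B * D, ?_, ?_, ?_⟩
  · rw [map_mul]; positivity
  · rw [map_mul]; positivity
  · rw [map_mul, map_mul, div_mul_div_comm]

theorem IsPositive.add {z w : RatFunField} (hz : IsPositive z) (hw : IsPositive w) :
    IsPositive (z + w) := by
  obtain ⟨A, B, hA, hB, rfl⟩ := hz
  obtain ⟨C, D, hC, hD, rfl⟩ := hw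
  refine ⟨A * D + B * C, B * D, ?_, ?_, ?_⟩
  · rw [map_add, map_mul, map_mul]; positivity
  · rw [map_mul]; positivity
  · rw [map_add, map_mul, map_mul, map_mul,
      div_add_div _ _ (algebraMap_ne_zero_of_pos hB) (algebraMap_ne_zero_of_pos hD)]

theorem IsPositive.div {z w : RatFunField} (hz : IsPositive z) (hw : IsPositive w) :
    IsPositive (z / w) := by
  obtain ⟨A, B, hA, hB, rfl⟩ := hz
  obtain ⟨C, D, hC, hD, rfl⟩ := hw
  refine ⟨A * D, B * C, ?_, ?_, ?_⟩
  · rw [map_mul]; positivity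
  · rw [map_mul]; positivity
  · rw [map_mul, map_mul, div_div_div_eq]

/-- The recurrence is free of subtractions, so positivity at the point with all coordinates `1`
propagates. This justifies every division. -/
theorem isPositive_octF {h : Face → ℤ} (hh : IsHeightFunction h) (n i j : ℤ)
    (hp : (n, i, j) ∈ initialSet h ∪ upperSet h) : IsPositive (octF hh n i j hp) := by
  induction n, i, j, hp using octF.induct hh with
  | case1 n i j hp hU h1 h2 h3 h4 h5 =>
    rw [octF, dif_pos hU]
    exact (((((isPositive_single _).mul (isPositive_single _)).mul h1).mul h2).add
      ((((isPositive_single _).mul (isPositive_single _)).mul h3).mul h4)).div h5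
  | case2 n i j hp hU =>
    rw [octF, dif_neg hU]
    exact isPositive_single _

open Classical in
/-- The solution of the octahedron recurrence, extended below the initial surface. -/
noncomputable def octTotal {h : Face → ℤ} (hh : IsHeightFunction h) (q : ℤ × ℤ × ℤ) :
    RatFunField :=
  if hq : (q.1, q.2.1, q.2.2) ∈ initialSet h ∪ upperSet h then octF hh q.1 q.2.1 q.2.2 hq
  else xVar q.2

open Classical in
/-- The edge variables, extended to all indices. -/
noncomputable def edgeVal (l : EdgeKind × ℤ × ℤ) : RatFunField :=
  if hl : l.2.1 + l.2.2 ≡ 1 [ZMOD 2] then eVar l.1 l.2.1 l.2.2 hl else 1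

section

variable {h : Face → ℤ} (hh : IsHeightFunction h)

theorem octF_eq_octTotal {n i j : ℤ} (hp : (n, i, j) ∈ initialSet h ∪ upperSet h) :
    octF hh n i j hp = octTotal hh (n, i, j) := by
  rw [octTotal, dif_pos hp]

theorem eVar_eq_edgeVal (k : EdgeKind) {i j : ℤ} (hij : i + j ≡ 1 [ZMOD 2]) :
    eVar k i j hij = edgeVal (k, i, j) := by
  rw [edgeVal, dif_pos hij]

theorem octTotal_ne_zero (q : ℤ × ℤ × ℤ) : octTotal hh q ≠ 0 := by
  unfold octTotal
  split_ifs with hq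
  · exact (isPositive_octF hh _ _ _ hq).ne_zero
  · exact (isPositive_single _).ne_zero

/-- The extension below the surface does not depend on the height, so lowering `h` to the truncated
surface leaves the face variables in place. -/
theorem octTotal_of_le {n i j : ℤ} (hn : n ≤ h (i, j)) : octTotal hh (n, i, j) = xVar (i, j) := by
  unfold octTotal
  split_ifs with hq
  · rw [octF, dif_neg fun hU => hn.not_gt hU.2]
  · rfl

theorem octTotal_recurrence {m i j : ℤ} (hm : (m - i - j) % 2 = 0) (hle : h (i, j) ≤ m) :
    octTotal hh (m + 2, i, j) * octTotal hh (m, i, j)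
      = edgeVal (.a, i + 1 + m, j) * edgeVal (.c, i - 1 - m, j)
          * octTotal hh (m + 1, i, j + 1) * octTotal hh (m + 1, i, j - 1)
        + edgeVal (.b, i, j + 1 + m) * edgeVal (.d, i, j - 1 - m)
          * octTotal hh (m + 1, i + 1, j) * octTotal hh (m + 1, i - 1, j) := by
  have hU : (m + 2, i, j) ∈ upperSet h := by
    refine ⟨?_, by simp only; omega⟩
    simp only [octLattice, Set.mem_ofPred_eq, Int.ModEq]
    omega
  have key := octF.eq_1 hh (m + 2) i j (Or.inr hU)
  rw [dif_pos hU] at key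
  simp only [octF_eq_octTotal, eVar_eq_edgeVal] at key
  rw [show m + 2 - 2 = m by ring, show m + 2 - 1 = m + 1 by ring,
    show i + (m + 2) - 1 = i + 1 + m by ring, show i - (m + 2) + 1 = i - 1 - m by ring,
    show j + (m + 2) - 1 = j + 1 + m by ring, show j - (m + 2) + 1 = j - 1 - m by ring] at key
  rw [← octF_eq_octTotal hh (Or.inr hU), key, div_mul_cancel₀ _ (octTotal_ne_zero hh _)]

end

/-! ### The Laurent polynomial of a lattice point. -/

/-- Monomials as rational functions. -/
noncomputable def monomialVal (m : (Face →₀ ℤ) × (EdgeVar →₀ ℕ)) : RatFunField :=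
  algebraMap LaurentRing RatFunField (AddMonoidAlgebra.single m 1)

theorem monomialVal_zero : monomialVal 0 = 1 := by
  rw [monomialVal, ← AddMonoidAlgebra.one_def, map_one]

theorem monomialVal_add (m m' : (Face →₀ ℤ) × (EdgeVar →₀ ℕ)) :
    monomialVal (m + m') = monomialVal m * monomialVal m' := by
  rw [monomialVal, monomialVal, monomialVal, ← map_mul, AddMonoidAlgebra.single_mul_single, mul_one]

theorem monomialVal_sum {ι : Type*} (s : Finset ι) (u : ι → (Face →₀ ℤ) × (EdgeVar →₀ ℕ)) :
    monomialVal (∑ a ∈ s, u a) = ∏ a ∈ s, monomialVal (u a) := by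
  classical
  induction s using Finset.induction_on with
  | empty => simp [monomialVal_zero]
  | insert a s ha ih => rw [Finset.sum_insert ha, Finset.prod_insert ha, monomialVal_add, ih]

theorem monomialVal_single_face (f : Face) (z : ℤ) :
    monomialVal (Finsupp.single f z, 0) = xVar f ^ z := by
  let φ : Multiplicative ℤ →* RatFunField :=
    { toFun := fun z => monomialVal (Finsupp.single f z.toAdd, 0)
      map_one' := by rw [toAdd_one, Finsupp.single_zero]; exact monomialVal_zero
      map_mul' := fun a b => by rw [← monomialVal_add]; simp }
  have h1 := map_zpow φ.toHomUnits (Multiplicative.ofAdd 1) z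
  have h2 := congrArg (Units.val) h1
  rw [Units.val_zpow_eq_zpow_val] at h2
  rw [show xVar f = monomialVal (Finsupp.single f 1, 0) from rfl]
  simpa [φ, ← ofAdd_zsmul] using h2

theorem monomialVal_faces (u : Face →₀ ℤ) : monomialVal (u, 0) = ∏ᶠ f, xVar f ^ u f := by
  rw [finprod_eq_prod_of_mulSupport_subset (s := u.support)]
  · simp only [← monomialVal_single_face]
    rw [← monomialVal_sum]
    congr 1
    ext1
    · rw [Prod.fst_sum]
      exact u.sum_single.symm
    · rw [Prod.snd_sum]
      simp
  · intro f hf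
    rw [Finset.mem_coe, Finsupp.mem_support_iff]
    intro h0
    exact hf (by simp [h0])

section Polynomial

variable {h : Face → ℤ} {p : ℤ × ℤ × ℤ}

theorem IsSurface.edgeLab_odd' {g : Face → ℤ} (hg : IsSurface p g) (e : LatticeEdge) :
    (edgeLab g e).2.1 + (edgeLab g e).2.2 ≡ 1 [ZMOD 2] := hg.odd_edgeLab e

/-- The edge part of the monomial of a configuration. -/
noncomputable def edgeMonomial {g : Face → ℤ} (hg : IsSurface p g) (W : Finset LatticeEdge) :
    EdgeVar →₀ ℕ :=
  ∑ e ∈ W, Finsupp.single ((edgeLab g e).1, ⟨(edgeLab g e).2, hg.edgeLab_odd' e⟩) 1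

theorem weight_octTotal (hh : IsHeightFunction h) (hp : p ∈ octLattice) {W : Finset LatticeEdge}
    {u : Face →₀ ℤ} (hu : ∀ f, u f = surfExp (truncate h p) W f) :
    weight edgeVal (octTotal hh) (truncate h p) W
      = monomialVal (u, edgeMonomial (hh.isSurface_truncate hp) W) := by
  have h1 : (u, edgeMonomial (hh.isSurface_truncate hp) W)
      = ∑ e ∈ W, (0, Finsupp.single ((edgeLab (truncate h p) e).1, ⟨(edgeLab (truncate h p) e).2,
        (hh.isSurface_truncate hp).edgeLab_odd' e⟩) 1) + (u, 0) := by
    ext1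
    · simp [Prod.fst_sum]
    · simp [Prod.snd_sum, edgeMonomial]
  rw [h1, monomialVal_add, monomialVal_sum, monomialVal_faces, weight]
  congr 1
  · refine Finset.prod_congr rfl fun e _ => ?_
    rw [edgeVal, dif_pos ((hh.isSurface_truncate hp).edgeLab_odd' e)]
    rfl
  · refine finprod_congr fun ⟨k, l⟩ => ?_
    rw [hu, octTotal_of_le hh (show truncate h p (k, l) ≤ h (k, l) from min_le_left _ _)]

theorem coeff_sum_single_eq_zero_or_one {ι M : Type*} (s : Finset ι) {u : ι → M}
    (hu : Set.InjOn u s) (m : M) :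
    (∑ a ∈ s, AddMonoidAlgebra.single (u a) (1 : ℤ)).coeff m = 0 ∨
      (∑ a ∈ s, AddMonoidAlgebra.single (u a) (1 : ℤ)).coeff m = 1 := by
  classical
  rw [AddMonoidAlgebra.coeff_sum, Finsupp.finsetSum_apply]
  simp only [AddMonoidAlgebra.coeff_single, Finsupp.single_apply]
  rw [Finset.sum_boole]
  have : (s.filter fun a => u a = m).card ≤ 1 := by
    rw [Finset.card_le_one]
    intro a ha b hb
    rw [Finset.mem_filter] at ha hb
    exact hu ha.1 hb.1 (ha.2.trans hb.2.symm)
  interval_cases (s.filter fun a => u a = m).card <;> simp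

theorem exists_polynomial (hh : IsHeightFunction h) {n i j : ℤ}
    (hp : (n, i, j) ∈ initialSet h ∪ upperSet h) :
    ∃ F : LaurentRing, algebraMap LaurentRing RatFunField F = octF hh n i j hp ∧
      (∀ m, F.coeff m = 0 ∨ F.coeff m = 1) ∧
      (∀ m, (edgesToOne F).coeff m = 0 ∨ (edgesToOne F).coeff m = 1) := by
  have hl : (n, i, j) ∈ octLattice := hp.elim And.left And.left
  have hle : h (i, j) ≤ n := hp.elim (fun h => h.2.ge) fun h => h.2.le
  have hg := hh.isSurface_truncate hl
  obtain ⟨hfin, hsupp⟩ := hg.finite_isConfig hl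
  have hu : ∃ u : Finset LatticeEdge → Face →₀ ℤ, ∀ W ∈ hfin.toFinset, ∀ f,
      u W f = surfExp (truncate h (n, i, j)) W f := by
    classical
    refine ⟨fun W => if hW : IsConfig (truncate h (n, i, j)) W then
      Finsupp.ofSupportFinite _ (hsupp W hW) else 0, fun W hW f => ?_⟩
    have hW' : IsConfig (truncate h (n, i, j)) W := by simpa using hW
    simp only
    rw [dif_pos hW']
    rfl
  obtain ⟨u, hu⟩ := hu
  -- Face exponents alone separate configurations, which settles the coefficients both with and
  -- without the edge variables.
  have hinj : Set.InjOn u hfin.toFinset := by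
    intro W hW W' hW' he
    refine hh.config_ext hl hle (by simpa using hW) (by simpa using hW') fun f => ?_
    rw [← hu W hW, he, hu W' hW']
  refine ⟨∑ W ∈ hfin.toFinset, AddMonoidAlgebra.single (u W, edgeMonomial hg W) 1, ?_, ?_, ?_⟩
  · rw [map_sum, octF_eq_octTotal hh, ← hg.sum_weight (y := edgeVal) hl (octTotal_ne_zero hh)]
    · refine Finset.sum_congr rfl fun W hW => ?_
      rw [weight_octTotal hh hl (hu W hW)]
      rfl
    · intro m k l h1 h2 h3
      refine octTotal_recurrence hh h1 ?_
      simp only [truncate] at h2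
      omega
  · exact coeff_sum_single_eq_zero_or_one _ fun W hW W' hW' he =>
      hinj hW hW' (congrArg Prod.fst he)
  · have : edgesToOne (∑ W ∈ hfin.toFinset, AddMonoidAlgebra.single (u W, edgeMonomial hg W) 1)
        = ∑ W ∈ hfin.toFinset, AddMonoidAlgebra.single (u W) 1 := by
      rw [map_sum]
      refine Finset.sum_congr rfl fun W _ => ?_
      rw [edgesToOne, AddMonoidAlgebra.mapDomainRingHom_apply, AddMonoidAlgebra.mapDomain_single]
      rfl
    rw [this]
    exact coeff_sum_single_eq_zero_or_one _ hinj

end Polynomial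

/-! ### Vertex conditions of a matching. -/

section Matchings

variable {h : Face → ℤ} {p : ℤ × ℤ × ℤ} {M : Set (Sym2 Face)}

theorem edgeExponent_eq_zero_or_one (M : Set (Sym2 Face)) (e : Sym2 Face) :
    edgeExponent M e = 0 ∨ edgeExponent M e = 1 := by
  unfold edgeExponent
  split_ifs <;> simp

theorem edgeExponent_eq_one_iff {M : Set (Sym2 Face)} {e : Sym2 Face} :
    edgeExponent M e = 1 ↔ e ∈ M := by
  unfold edgeExponent
  split_ifs <;> simp_all

theorem IsHeightFunction.mem_closedFaces (hh : IsHeightFunction h) {f : Face} :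
    f ∈ closedFaces h p ↔ h f < coneHeight p f :=
  ⟨fun hf => hf.2, fun hf => ⟨hh.mem_lattice f, hf⟩⟩

theorem FacesBorder.symm {f g : Face} (hfg : FacesBorder h f g) : FacesBorder h g f := by
  unfold FacesBorder LatticeAdjacent at *
  rw [abs_sub_comm g.1, abs_sub_comm g.2]
  exact hfg.imp_right fun ⟨h1, h2, h3⟩ => ⟨h1, h2, h3.symm⟩

theorem facesBorder_irrefl (f : Face) : ¬FacesBorder h f f := by
  simp [FacesBorder, LatticeAdjacent]

theorem facesBorder_diag {i j k l : ℤ} (hi : |i - k| = 1) (hj : |j - l| = 1) :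
    FacesBorder h (i, j) (k, l) ↔ h (i, l) ≠ h (k, j) := by
  simp [FacesBorder, LatticeAdjacent, hi, hj]

theorem IsHeightFunction.mem_edges_iff (hh : IsHeightFunction h) {f g : Face} :
    s(f, g) ∈ edges h p ↔
      FacesBorder h f g ∧ (h f < coneHeight p f ∨ h g < coneHeight p g) := by
  unfold edges infEdges
  simp only [Set.mem_ofPred_eq, Sym2.mem_iff, hh.mem_closedFaces]
  constructor
  · rintro ⟨⟨x, y, hxy, he⟩, z, rfl | rfl, hz⟩
    · rw [Sym2.eq_iff] at he
      rcases he with ⟨rfl, rfl⟩ | ⟨rfl, rfl⟩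
      · exact ⟨hxy, Or.inl hz⟩
      · exact ⟨hxy.symm, Or.inl hz⟩
    · rw [Sym2.eq_iff] at he
      rcases he with ⟨rfl, rfl⟩ | ⟨rfl, rfl⟩
      · exact ⟨hxy, Or.inr hz⟩
      · exact ⟨hxy.symm, Or.inr hz⟩
  · rintro ⟨hfg, hz | hz⟩
    · exact ⟨⟨f, g, hfg, rfl⟩, f, Or.inl rfl, hz⟩
    · exact ⟨⟨f, g, hfg, rfl⟩, g, Or.inr rfl, hz⟩

/-- `T` may contain pairs that are not edges of `G_p`: their exponent is zero. -/
theorem sum_edgeExponent_eq_one (hM : IsMatching h p M) {v : Finset Face} (hv : v ∈ infVertices h)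
    {e₀ : Sym2 Face} (he₀ : e₀ ∈ edges h p) (hve₀ : IsEndpoint v e₀) (T : Finset (Sym2 Face))
    (hT : ∀ e ∈ T, IsEndpoint v e)
    (hT' : ∀ f ∈ v, ∀ g ∈ v, FacesBorder h f g → s(f, g) ∈ T) :
    ∑ e ∈ T, edgeExponent M e = 1 := by
  obtain ⟨e, ⟨heM, hev⟩, huniq⟩ := hM.2 v ⟨hv, e₀, he₀, hve₀⟩
  rw [Finset.sum_eq_single e, edgeExponent_eq_one_iff.2 heM]
  · intro e' he' hne
    refine (edgeExponent_eq_zero_or_one M e').resolve_right fun h1 => hne ?_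
    exact huniq e' ⟨edgeExponent_eq_one_iff.1 h1, hT e' he'⟩
  · intro he
    obtain ⟨⟨f, g, hfg, rfl⟩, -⟩ := hM.1 heM
    exact absurd (hT' f (hev f (by simp)) g (hev g (by simp)) hfg) he

/-- One closed face among the three puts the vertex into `G_p`, where the matching condition
applies. -/
theorem triangle_sum (hh : IsHeightFunction h) (hM : IsMatching h p M) {x y z : Face}
    (hxy : x ≠ y) (hxz : x ≠ z) (hyz : y ≠ z) (hv : {x, y, z} ∈ infVertices h)
    (bxy : FacesBorder h x y) (bxz : FacesBorder h x z) (byz : FacesBorder h y z)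
    (hc : h x < coneHeight p x ∨ h y < coneHeight p y ∨ h z < coneHeight p z) :
    edgeExponent M s(x, y) + edgeExponent M s(x, z) + edgeExponent M s(y, z) = 1 := by
  have key : ∀ e₀ ∈ edges h p, IsEndpoint {x, y, z} e₀ →
      edgeExponent M s(x, y) + edgeExponent M s(x, z) + edgeExponent M s(y, z) = 1 := by
    intro e₀ he₀ hve₀
    have := sum_edgeExponent_eq_one hM hv he₀ hve₀ {s(x, y), s(x, z), s(y, z)} ?_ ?_
    · rwa [Finset.sum_insert, Finset.sum_insert, Finset.sum_singleton, ← add_assoc] at this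
      · simp [hxy, hxz]
      · simp [hxy, hxz, hyz]
    · intro e he
      simp only [Finset.mem_insert, Finset.mem_singleton] at he
      rcases he with rfl | rfl | rfl <;> simp [IsEndpoint]
    · intro f hf g hg hfg
      simp only [Finset.mem_insert, Finset.mem_singleton] at hf hg ⊢
      rcases hf with rfl | rfl | rfl <;> rcases hg with rfl | rfl | rfl <;>
        first | exact absurd hfg (facesBorder_irrefl _) | simp [Sym2.eq_swap]
  rcases hc with hc | hc | hc
  · exact key _ (hh.mem_edges_iff.2 ⟨bxy, Or.inl hc⟩) (by simp [IsEndpoint])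
  · exact key _ (hh.mem_edges_iff.2 ⟨bxy, Or.inr hc⟩) (by simp [IsEndpoint])
  · exact key _ (hh.mem_edges_iff.2 ⟨bxz, Or.inr hc⟩) (by simp [IsEndpoint])

theorem facesBorder_horiz (i j : ℤ) : FacesBorder h (i + 1, j) (i, j) :=
  Or.inl (by simp [LatticeAdjacent])

theorem facesBorder_vert (i j : ℤ) : FacesBorder h (i, j + 1) (i, j) :=
  Or.inl (by simp [LatticeAdjacent])

theorem facesBorder_main {i j : ℤ} :
    FacesBorder h (i, j) (i + 1, j + 1) ↔ h (i + 1, j) ≠ h (i, j + 1) := by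
  rw [facesBorder_diag (by simp) (by simp), ne_comm]

theorem facesBorder_anti {i j : ℤ} :
    FacesBorder h (i + 1, j) (i, j + 1) ↔ h (i, j) ≠ h (i + 1, j + 1) := by
  rw [facesBorder_diag (by simp) (by simp), ne_comm]

theorem four_sum (hh : IsHeightFunction h) (hM : IsMatching h p M) {x y z w : Face}
    (hxy : x ≠ y) (hxz : x ≠ z) (hxw : x ≠ w) (hyz : y ≠ z) (hyw : y ≠ w) (hzw : z ≠ w)
    (hv : {x, y, z, w} ∈ infVertices h) (byx : FacesBorder h y x) (bzx : FacesBorder h z x)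
    (bwz : FacesBorder h w z) (nxw : ¬FacesBorder h x w) (nyz : ¬FacesBorder h y z)
    (hc : h x < coneHeight p x ∨ h y < coneHeight p y ∨ h z < coneHeight p z ∨
      h w < coneHeight p w) :
    edgeExponent M s(y, x) + edgeExponent M s(z, x) + edgeExponent M s(w, z)
      + edgeExponent M s(w, y) = 1 := by
  have key : ∀ e₀ ∈ edges h p, IsEndpoint {x, y, z, w} e₀ →
      edgeExponent M s(y, x) + edgeExponent M s(z, x) + edgeExponent M s(w, z)
        + edgeExponent M s(w, y) = 1 := by
    intro e₀ he₀ hve₀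
    have := sum_edgeExponent_eq_one hM hv he₀ hve₀ {s(y, x), s(z, x), s(w, z), s(w, y)} ?_ ?_
    · rw [Finset.sum_insert, Finset.sum_insert, Finset.sum_insert, Finset.sum_singleton] at this
      · linarith
      · simp [hyz.symm, hzw]
      · simp [hzw, hxw]
      · simp [hxw, hxy, hxz, hyw, hyz]
    · intro e he
      simp only [Finset.mem_insert, Finset.mem_singleton] at he
      rcases he with rfl | rfl | rfl | rfl <;> simp [IsEndpoint]
    · have m1 : s(y, x) ∈ ({s(y, x), s(z, x), s(w, z), s(w, y)} : Finset (Sym2 Face)) := by simp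
      have m2 : s(z, x) ∈ ({s(y, x), s(z, x), s(w, z), s(w, y)} : Finset (Sym2 Face)) := by simp
      have m3 : s(w, z) ∈ ({s(y, x), s(z, x), s(w, z), s(w, y)} : Finset (Sym2 Face)) := by simp
      have m4 : s(w, y) ∈ ({s(y, x), s(z, x), s(w, z), s(w, y)} : Finset (Sym2 Face)) := by simp
      generalize ({s(y, x), s(z, x), s(w, z), s(w, y)} : Finset (Sym2 Face)) = T at m1 m2 m3 m4 ⊢
      intro f hf g hg hfg
      have ir := facesBorder_irrefl (h := h)
      have n1 : ¬FacesBorder h w x := fun h => nxw h.symm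
      have n2 : ¬FacesBorder h z y := fun h => nyz h.symm
      have m1' : s(x, y) ∈ T := Sym2.eq_swap ▸ m1
      have m2' : s(x, z) ∈ T := Sym2.eq_swap ▸ m2
      have m3' : s(z, w) ∈ T := Sym2.eq_swap ▸ m3
      have m4' : s(y, w) ∈ T := Sym2.eq_swap ▸ m4
      simp only [Finset.mem_insert, Finset.mem_singleton] at hf hg
      rcases hf with hf | hf | hf | hf <;> rcases hg with hg | hg | hg | hg <;>
        rw [hf, hg] at hfg ⊢ <;>
        first
        | with_reducible assumption
        | exact absurd hfg (ir _)
        | exact absurd hfg (by with_reducible assumption)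
  rcases hc with hc | hc | hc | hc
  · exact key _ (hh.mem_edges_iff.2 ⟨byx, Or.inr hc⟩) (by simp [IsEndpoint])
  · exact key _ (hh.mem_edges_iff.2 ⟨byx, Or.inl hc⟩) (by simp [IsEndpoint])
  · exact key _ (hh.mem_edges_iff.2 ⟨bzx, Or.inl hc⟩) (by simp [IsEndpoint])
  · exact key _ (hh.mem_edges_iff.2 ⟨bwz, Or.inl hc⟩) (by simp [IsEndpoint])

theorem cross_sum (hh : IsHeightFunction h) (hM : IsMatching h p M) {i j : ℤ}
    (h1 : h (i + 1, j) = h (i, j + 1)) (h2 : h (i, j) = h (i + 1, j + 1))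
    (hc : h (i, j) < coneHeight p (i, j) ∨ h (i + 1, j) < coneHeight p (i + 1, j) ∨
      h (i, j + 1) < coneHeight p (i, j + 1) ∨ h (i + 1, j + 1) < coneHeight p (i + 1, j + 1)) :
    edgeExponent M s((i + 1, j), (i, j)) + edgeExponent M s((i, j + 1), (i, j))
      + edgeExponent M s((i + 1, j + 1), (i, j + 1))
      + edgeExponent M s((i + 1, j + 1), (i + 1, j)) = 1 := by
  have n1 : ¬FacesBorder h (i, j) (i + 1, j + 1) := fun h => facesBorder_main.1 h h1
  have n2 : ¬FacesBorder h (i + 1, j) (i, j + 1) := fun h => facesBorder_anti.1 h h2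
  exact four_sum hh hM (by simp) (by simp) (by simp) (by simp) (by simp) (by simp)
    ⟨i, j, Or.inl ⟨n1, n2, rfl⟩⟩ (facesBorder_horiz i j) (facesBorder_vert i j)
    (facesBorder_horiz i (j + 1)) n1 n2 hc

theorem main_sum_right (hh : IsHeightFunction h) (hM : IsMatching h p M) {i j : ℤ}
    (h1 : h (i + 1, j) ≠ h (i, j + 1))
    (hc : h (i, j) < coneHeight p (i, j) ∨ h (i + 1, j + 1) < coneHeight p (i + 1, j + 1) ∨
      h (i + 1, j) < coneHeight p (i + 1, j)) :
    edgeExponent M s((i, j), (i + 1, j + 1)) + edgeExponent M s((i + 1, j), (i, j))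
      + edgeExponent M s((i + 1, j + 1), (i + 1, j)) = 1 := by
  have hb := facesBorder_main.2 h1
  have := triangle_sum hh hM (by simp) (by simp) (by simp) ⟨i, j, Or.inr (Or.inl ⟨hb, Or.inl rfl⟩)⟩
    hb (facesBorder_horiz i j).symm (facesBorder_vert (i + 1) j) hc
  rwa [Sym2.eq_swap (a := (i, j)) (b := (i + 1, j))] at this

theorem main_sum_left (hh : IsHeightFunction h) (hM : IsMatching h p M) {i j : ℤ}
    (h1 : h (i + 1, j) ≠ h (i, j + 1))
    (hc : h (i, j) < coneHeight p (i, j) ∨ h (i + 1, j + 1) < coneHeight p (i + 1, j + 1) ∨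
      h (i, j + 1) < coneHeight p (i, j + 1)) :
    edgeExponent M s((i, j), (i + 1, j + 1)) + edgeExponent M s((i, j + 1), (i, j))
      + edgeExponent M s((i + 1, j + 1), (i, j + 1)) = 1 := by
  have hb := facesBorder_main.2 h1
  have := triangle_sum hh hM (by simp) (by simp) (by simp) ⟨i, j, Or.inr (Or.inl ⟨hb, Or.inr rfl⟩)⟩
    hb (facesBorder_vert i j).symm (facesBorder_horiz i (j + 1)) hc
  rwa [Sym2.eq_swap (a := (i, j)) (b := (i, j + 1))] at this

theorem anti_sum_left (hh : IsHeightFunction h) (hM : IsMatching h p M) {i j : ℤ}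
    (h1 : h (i, j) ≠ h (i + 1, j + 1))
    (hc : h (i + 1, j) < coneHeight p (i + 1, j) ∨ h (i, j + 1) < coneHeight p (i, j + 1) ∨
      h (i, j) < coneHeight p (i, j)) :
    edgeExponent M s((i + 1, j), (i, j + 1)) + edgeExponent M s((i + 1, j), (i, j))
      + edgeExponent M s((i, j + 1), (i, j)) = 1 := by
  have hb := facesBorder_anti.2 h1
  exact triangle_sum hh hM (by simp) (by simp) (by simp)
    ⟨i, j, Or.inr (Or.inr ⟨hb, Or.inl rfl⟩)⟩ hb (facesBorder_horiz i j) (facesBorder_vert i j) hc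

theorem anti_sum_right (hh : IsHeightFunction h) (hM : IsMatching h p M) {i j : ℤ}
    (h1 : h (i, j) ≠ h (i + 1, j + 1))
    (hc : h (i + 1, j) < coneHeight p (i + 1, j) ∨ h (i, j + 1) < coneHeight p (i, j + 1) ∨
      h (i + 1, j + 1) < coneHeight p (i + 1, j + 1)) :
    edgeExponent M s((i + 1, j), (i, j + 1)) + edgeExponent M s((i + 1, j + 1), (i + 1, j))
      + edgeExponent M s((i + 1, j + 1), (i, j + 1)) = 1 := by
  have hb := facesBorder_anti.2 h1
  have := triangle_sum hh hM (by simp) (by simp) (by simp)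
    ⟨i, j, Or.inr (Or.inr ⟨hb, Or.inr rfl⟩)⟩ hb (facesBorder_vert (i + 1) j).symm
      (facesBorder_horiz i (j + 1)).symm hc
  rwa [Sym2.eq_swap (a := (i + 1, j)) (b := (i + 1, j + 1)),
    Sym2.eq_swap (a := (i, j + 1)) (b := (i + 1, j + 1))] at this

theorem edgeExponent_eq_zero (hh : IsHeightFunction h) (hM : IsMatching h p M) {f g : Face}
    (hf : ¬h f < coneHeight p f) (hg : ¬h g < coneHeight p g) : edgeExponent M s(f, g) = 0 := by
  refine (edgeExponent_eq_zero_or_one M _).resolve_right fun h1 => ?_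
  exact (hh.mem_edges_iff.1 (hM.1 (edgeExponent_eq_one_iff.1 h1))).2.elim hf hg

/-- The pair of faces of a lattice edge. -/
def toSym : LatticeEdge → Sym2 Face
  | (false, i, j) => s((i + 1, j), (i, j))
  | (true, i, j) => s((i, j + 1), (i, j))

theorem finite_latticeEdges (hh : IsHeightFunction h) (hp : p ∈ octLattice)
    (hM : IsMatching h p M) : {e | toSym e ∈ M}.Finite := by
  have hc := hh.finite_lt_cone hp
  have h1 := hc.union ((hc.image fun f => ((f.1 - 1, f.2) : Face)).union
    (hc.image fun f => ((f.1, f.2 - 1) : Face)))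
  refine ((Set.finite_univ (α := Bool)).prod h1).subset ?_
  rintro ⟨⟨⟩ | ⟨⟩, i, j⟩ he
  · refine ⟨trivial, ?_⟩
    rcases (hh.mem_edges_iff.1 (hM.1 he)).2 with h | h
    · exact Or.inr (Or.inl ⟨_, h, by simp⟩)
    · exact Or.inl h
  · refine ⟨trivial, ?_⟩
    rcases (hh.mem_edges_iff.1 (hM.1 he)).2 with h | h
    · exact Or.inr (Or.inr ⟨_, h, by simp⟩)
    · exact Or.inl h

theorem occ_eq_edgeExponent {W : Finset LatticeEdge} (hW : ∀ e, e ∈ W ↔ toSym e ∈ M)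
    (e : LatticeEdge) : occ W e = edgeExponent M (toSym e) := by
  by_cases he : e ∈ W
  · rw [occ, if_pos he, edgeExponent, if_pos ((hW e).1 he)]
  · rw [occ, if_neg he, edgeExponent, if_neg fun h => he ((hW e).2 h)]

/-- The matching condition in a square one of whose corners is a closed face. -/
theorem balanced_of_closed {hz hx hy hw cz cx cy cw zx zy wx wy d d' : ℤ}
    (a1 : hx = hz + 1 ∨ hx = hz - 1) (a2 : hy = hz + 1 ∨ hy = hz - 1)
    (a3 : hw = hx + 1 ∨ hw = hx - 1) (a4 : hw = hy + 1 ∨ hw = hy - 1)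
    (b1 : cx = cz + 1 ∨ cx = cz - 1) (b2 : cy = cz + 1 ∨ cy = cz - 1)
    (b3 : cw = cx + 1 ∨ cw = cx - 1) (b4 : cw = cy + 1 ∨ cw = cy - 1)
    (hcone : ¬(cx = cy ∧ cz = cw)) (hpar : (hz - cz) % 2 = 0)
    (hclosed : hz < cz)
    (hcross : hx = hy → hz = hw → zx + zy + wx + wy = 1)
    (hmx : hx ≠ hy → d + zx + wx = 1) (hmy : hx ≠ hy → d + zy + wy = 1)
    (haz : hz ≠ hw → d' + zx + zy = 1)
    (haw : hz ≠ hw → (hx < cx ∨ hy < cy ∨ hw < cw) → d' + wx + wy = 1)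
    (hd : 0 ≤ d) (hd' : 0 ≤ d') (hd0 : ¬hx < cx → ¬hy < cy → d' = 0)
    (hwx : ¬hw < cw → ¬hx < cx → wx = 0) (hwy : ¬hw < cw → ¬hy < cy → wy = 0) :
    (min hx cx ≠ min hy cy → zx + wx = zy + wy ∧ zx + wx ≤ 1) ∧
    (min hz cz ≠ min hw cw → zx + zy = wx + wy ∧ zx + zy ≤ 1) ∧
    (min hx cx = min hy cy → min hz cz = min hw cw → zx + zy + wx + wy = 1) := by
  have hxc : hx ≤ cx := by clear * - a1 b1 hclosed hpar; omega
  have hyc : hy ≤ cy := by clear * - a2 b2 hclosed hpar; omega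
  rw [min_eq_left hxc, min_eq_left hyc, min_eq_left hclosed.le]
  by_cases hwc : hw ≤ cw
  · rw [min_eq_left hwc]
    refine ⟨fun h => ?_, fun h => ?_, hcross⟩
    · have h1 := hmx h
      have h2 := hmy h
      clear * - h1 h2 hd
      omega
    · have h1 := haz h
      have h2 := haw h (by clear * - a1 a2 a3 a4 b1 b2 b3 b4 hclosed hpar hcone h hwc hxc hyc; omega)
      clear * - h1 h2 hd'
      omega
  -- The only case where truncation changes the type of the square: the wrench with diagonal `xy`
  -- becomes a cross. That diagonal and the edges at `w` separate faces that are not closed, so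
  -- their exponents vanish and the triangle at `z` gives the cross condition.
  · have e1 : cw = hz ∧ hx = hz + 1 ∧ hy = hz + 1 ∧ hw ≠ hz ∧ cx = hx ∧ cy = hy := by
      clear * - a1 a2 a3 a4 b1 b2 b3 b4 hclosed hpar hwc hxc hyc
      omega
    obtain ⟨e1, e2, e3, e4, e5, e6⟩ := e1
    have h1 := haz e4.symm
    have h2 := hd0 e5.not_gt e6.not_gt
    have hwc' : ¬hw < cw := fun h => hwc h.le
    have h3 := hwx hwc' e5.not_gt
    have h4 := hwy hwc' e6.not_gt
    rw [min_eq_right (not_le.1 hwc).le]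
    clear * - h1 h2 h3 h4 e1 e2 e3
    refine ⟨fun h => ?_, fun h => ?_, fun _ _ => ?_⟩ <;> omega

end Matchings

/-! ### From matchings of `G_p` to configurations. -/

section Matchings

variable {h : Face → ℤ} {p : ℤ × ℤ × ℤ} {M : Set (Sym2 Face)} {W : Finset LatticeEdge}

theorem coneHeight_not_cross (p : ℤ × ℤ × ℤ) (i j : ℤ) :
    ¬(coneHeight p (i + 1, j) = coneHeight p (i, j + 1) ∧
      coneHeight p (i, j) = coneHeight p (i + 1, j + 1)) := by
  intro ⟨h1, h2⟩
  have := ((isConfig_cone_iff p).2 (rfl : (∅ : Finset LatticeEdge) = ∅) i j).2.2 h1 h2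
  simp [occ_empty] at this

/-- The weighted edges of a matching form a configuration. -/
theorem isConfig_of_isMatching (hh : IsHeightFunction h) (hp : p ∈ octLattice)
    (hM : IsMatching h p M) (hW : ∀ e, e ∈ W ↔ toSym e ∈ M) : IsConfig (truncate h p) W := by
  intro i j
  have a1 := hh.horiz i j
  have a2 := hh.vert i j
  have a3 := hh.vert (i + 1) j
  have a4 := hh.horiz i (j + 1)
  have b1 := coneHeight_horiz p i j
  have b2 := coneHeight_vert p i j
  have b3 := coneHeight_vert p (i + 1) j
  have b4 := coneHeight_horiz p i (j + 1)
  have par : ∀ k l, (h (k, l) - coneHeight p (k, l)) % 2 = 0 := fun k l => by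
    have := hh.parity k l
    have := coneHeight_parity hp k l
    omega
  have hcone := coneHeight_not_cross p i j
  have zero := fun f g => edgeExponent_eq_zero (f := f) (g := g) hh hM
  have nn : ∀ e, 0 ≤ edgeExponent M e := fun e => by
    rcases edgeExponent_eq_zero_or_one M e with h | h <;> omega
  unfold SquareBalanced
  simp only [occ_eq_edgeExponent hW, toSym]
  have cr := @cross_sum h p M hh hM i j
  have mr := @main_sum_right h p M hh hM i j
  have ml := @main_sum_left h p M hh hM i j
  have al := @anti_sum_left h p M hh hM i j
  have ar := @anti_sum_right h p M hh hM i j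
  have zB := zero (i + 1, j) (i, j)
  have zL := zero (i, j + 1) (i, j)
  have zT := zero (i + 1, j + 1) (i, j + 1)
  have zR := zero (i + 1, j + 1) (i + 1, j)
  have zD := zero (i, j) (i + 1, j + 1)
  have zA := zero (i + 1, j) (i, j + 1)
  have nD := nn s((i, j), (i + 1, j + 1))
  have nA := nn s((i + 1, j), (i, j + 1))
  have pa := par i j
  have pb := par (i + 1) j
  have pc := par i (j + 1)
  have pd := par (i + 1) (j + 1)
  clear zero nn par hW hM
  unfold truncate
  generalize edgeExponent M s((i + 1, j), (i, j)) = B at *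
  generalize edgeExponent M s((i, j + 1), (i, j)) = L at *
  generalize edgeExponent M s((i + 1, j + 1), (i, j + 1)) = T at *
  generalize edgeExponent M s((i + 1, j + 1), (i + 1, j)) = R at *
  generalize edgeExponent M s((i, j), (i + 1, j + 1)) = D at *
  generalize edgeExponent M s((i + 1, j), (i, j + 1)) = A at *
  generalize h (i, j) = ha at *
  generalize h (i + 1, j) = hb at *
  generalize h (i, j + 1) = hc at *
  generalize h (i + 1, j + 1) = hd at *
  generalize coneHeight p (i, j) = ca at *
  generalize coneHeight p (i + 1, j) = cb at *
  generalize coneHeight p (i, j + 1) = cc at *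
  generalize coneHeight p (i + 1, j + 1) = cd at *
  have flip : ∀ {u v : ℤ}, u = v + 1 ∨ u = v - 1 → v = u + 1 ∨ v = u - 1 := by
    intro u v h
    omega
  -- `balanced_of_closed` is applied with `z` a closed corner, in whichever of the four positions
  -- there is one.
  by_cases ka : ha < ca
  · have := balanced_of_closed (zx := B) (zy := L) (wx := R) (wy := T) (d := D) (d' := A)
      a1 a2 a3 a4 b1 b2 b3 b4 hcone pa ka
      (fun h1 h2 => by linarith [cr h1 h2 (Or.inl ka)])
      (fun h1 => by linarith [mr h1 (Or.inl ka)]) (fun h1 => by linarith [ml h1 (Or.inl ka)])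
      (fun h1 => by linarith [al h1 (Or.inr (Or.inr ka))])
      (fun h1 h2 => by linarith [ar h1 h2]) nD nA zA zR zT
    clear * - this
    obtain ⟨t1, t2, t3⟩ := this
    exact ⟨fun h => by have := t1 h; omega, fun h => by have := t2 h; omega,
      fun h h' => by have := t3 h h'; omega⟩
  by_cases kd : hd < cd
  · have := balanced_of_closed (zx := R) (zy := T) (wx := B) (wy := L) (d := D) (d' := A)
      (flip a3) (flip a4) (flip a1) (flip a2) (flip b3) (flip b4) (flip b1) (flip b2)
      (fun hx => hcone ⟨hx.1, hx.2.symm⟩) pd kd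
      (fun h1 h2 => by linarith [cr h1 h2.symm (Or.inr (Or.inr (Or.inr kd)))])
      (fun h1 => by linarith [mr h1 (Or.inr (Or.inl kd))])
      (fun h1 => by linarith [ml h1 (Or.inr (Or.inl kd))])
      (fun h1 => by linarith [ar h1.symm (Or.inr (Or.inr kd))])
      (fun h1 h2 => by linarith [al h1.symm h2]) nD nA zA (fun h1 h2 => zB h2 h1)
      (fun h1 h2 => zL h2 h1)
    clear * - this
    obtain ⟨t1, t2, t3⟩ := this
    exact ⟨fun h => by have := t1 h; omega, fun h => by have := t2 h.symm; omega,
      fun h h' => by have := t3 h h'.symm; omega⟩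
  by_cases kb : hb < cb
  · have := balanced_of_closed (zx := B) (zy := R) (wx := L) (wy := T) (d := A) (d' := D)
      (flip a1) a3 a2 (flip a4) (flip b1) b3 b2 (flip b4)
      (fun hx => hcone ⟨hx.2, hx.1⟩) pb kb
      (fun h1 h2 => by linarith [cr h2 h1 (Or.inr (Or.inl kb))])
      (fun h1 => by linarith [al h1 (Or.inl kb)])
      (fun h1 => by linarith [ar h1 (Or.inl kb)])
      (fun h1 => by linarith [mr h1 (Or.inr (Or.inr kb))])
      (fun h1 h2 => by linarith [ml h1 h2]) nA nD zD zL (fun h1 h2 => zT h2 h1)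
    clear * - this
    obtain ⟨t1, t2, t3⟩ := this
    exact ⟨fun h => by have := t2 h; omega, fun h => by have := t1 h; omega,
      fun h h' => by have := t3 h' h; omega⟩
  by_cases kc : hc < cc
  · have := balanced_of_closed (zx := L) (zy := T) (wx := B) (wy := R) (d := A) (d' := D)
      (flip a2) a4 a1 (flip a3) (flip b2) b4 b1 (flip b3)
      (fun hx => hcone ⟨hx.2.symm, hx.1⟩) pc kc
      (fun h1 h2 => by linarith [cr h2.symm h1 (Or.inr (Or.inr (Or.inl kc)))])
      (fun h1 => by linarith [al h1 (Or.inr (Or.inl kc))])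
      (fun h1 => by linarith [ar h1 (Or.inr (Or.inl kc))])
      (fun h1 => by linarith [ml h1.symm (Or.inr (Or.inr kc))])
      (fun h1 h2 => by linarith [mr h1.symm h2]) nA nD zD zB (fun h1 h2 => zR h2 h1)
    clear * - this
    obtain ⟨t1, t2, t3⟩ := this
    exact ⟨fun h => by have := t2 h.symm; omega, fun h => by have := t1 h; omega,
      fun h h' => by have := t3 h' h.symm; omega⟩
  -- With no closed corner the square carries no edges of `G_p` and the truncated surface is the
  -- cone there.
  rw [zB kb ka, zL kc ka, zT kd kc, zR kd kb, min_eq_right (not_lt.1 ka),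
    min_eq_right (not_lt.1 kb), min_eq_right (not_lt.1 kc), min_eq_right (not_lt.1 kd)]
  exact ⟨by norm_num, by norm_num, fun h1 h2 => absurd ⟨h1, h2⟩ hcone⟩

theorem ceil_intCast_div_two (z : ℤ) : ⌈(z : ℚ) / 2⌉ = (z + 1) / 2 := by
  rw [Int.ceil_eq_iff]
  have h1 : 2 * ((z + 1) / 2) ≤ z + 1 := by omega
  have h2 : z ≤ 2 * ((z + 1) / 2) := by omega
  have h1' : (2 * ((z + 1) / 2 : ℤ) : ℚ) ≤ z + 1 := by exact_mod_cast h1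
  have h2' : (z : ℚ) ≤ 2 * ((z + 1) / 2 : ℤ) := by exact_mod_cast h2
  constructor <;> linarith

open Classical in
/-- The contribution to the exponent of `f` of the edge between `f` and `g`. -/
noncomputable def edgeContrib (h : Face → ℤ) (p : ℤ × ℤ × ℤ) (M : Set (Sym2 Face)) (f g : Face) :
    ℤ :=
  if s(f, g) ∈ edges h p then 1 - 2 * edgeExponent M s(f, g) else 0

/-- The eight faces around a square lattice face. -/
def ring8 (i j : ℤ) : Finset Face :=
  {(i + 1, j), (i, j + 1), (i - 1, j), (i, j - 1), (i + 1, j + 1), (i - 1, j - 1), (i - 1, j + 1),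
    (i + 1, j - 1)}

theorem sum_ring8 (i j : ℤ) (u : Face → ℤ) :
    ∑ g ∈ ring8 i j, u g = u (i + 1, j) + u (i, j + 1) + u (i - 1, j) + u (i, j - 1)
      + u (i + 1, j + 1) + u (i - 1, j - 1) + u (i - 1, j + 1) + u (i + 1, j - 1) := by
  unfold ring8
  repeat rw [Finset.sum_insert (by
    simp only [Finset.mem_insert, Finset.mem_singleton, Prod.mk.injEq, not_or, not_and]; omega)]
  rw [Finset.sum_singleton]
  ring

theorem FacesBorder.mem_ring8 {i j : ℤ} {g : Face} (hfg : FacesBorder h (i, j) g) :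
    g ∈ ring8 i j := by
  obtain ⟨k, l⟩ := g
  have key : k - i = 0 ∧ l - j = 1 ∨ k - i = 0 ∧ l - j = -1 ∨ k - i = 1 ∧ l - j = 0 ∨
      k - i = -1 ∧ l - j = 0 ∨ k - i = 1 ∧ l - j = 1 ∨ k - i = 1 ∧ l - j = -1 ∨
      k - i = -1 ∧ l - j = 1 ∨ k - i = -1 ∧ l - j = -1 := by
    rcases hfg with h | ⟨h1, h2, -⟩
    · simp only [LatticeAdjacent] at h
      rcases abs_cases (i - k) with h1 | h1 <;> rcases abs_cases (j - l) with h2 | h2 <;> omega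
    · simp only at h1 h2
      rcases abs_cases (i - k) with h3 | h3 <;> rcases abs_cases (j - l) with h4 | h4 <;> omega
  simp only [ring8, Finset.mem_insert, Finset.mem_singleton, Prod.mk.injEq]
  omega

theorem ncard_edges_eq (h : Face → ℤ) (p : ℤ × ℤ × ℤ) (i j : ℤ) (P : Sym2 Face → Prop)
    [DecidablePred fun g : Face => s((i, j), g) ∈ edges h p ∧ P s((i, j), g)] :
    {e | e ∈ edges h p ∧ (i, j) ∈ e ∧ P e}.ncard
      = ((ring8 i j).filter fun g => s((i, j), g) ∈ edges h p ∧ P s((i, j), g)).card := by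
  rw [← Set.ncard_coe_finset, ← Set.ncard_image_of_injective (f := fun g => s((i, j), g)) _
    fun _ _ => Sym2.congr_right.1]
  congr 1
  ext e
  simp only [Set.mem_ofPred_eq, Finset.coe_filter, Set.mem_image]
  constructor
  · rintro ⟨he, hf, hP⟩
    obtain ⟨g, rfl⟩ := Sym2.mem_iff_exists.1 hf
    refine ⟨g, ⟨?_, he, hP⟩, rfl⟩
    obtain ⟨⟨x, y, hxy, hs⟩, -⟩ := he
    rw [Sym2.eq_iff] at hs
    rcases hs with ⟨rfl, rfl⟩ | ⟨rfl, rfl⟩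
    · exact hxy.mem_ring8
    · exact hxy.symm.mem_ring8
  · rintro ⟨g, ⟨-, he, hP⟩, rfl⟩
    exact ⟨he, by simp, hP⟩

theorem halfExcess_eq (h : Face → ℤ) (p : ℤ × ℤ × ℤ) (M : Set (Sym2 Face)) (i j : ℤ) :
    halfExcess h p M (i, j) = (∑ g ∈ ring8 i j, edgeContrib h p M (i, j) g + 1) / 2 := by
  classical
  rw [halfExcess, ncard_edges_eq h p i j (fun e => e ∉ M), ncard_edges_eq h p i j (fun e => e ∈ M),
    ← ceil_intCast_div_two]
  congr 2
  have : ∑ g ∈ ring8 i j, edgeContrib h p M (i, j) g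
      = ((ring8 i j).filter fun g => s((i, j), g) ∈ edges h p ∧ s((i, j), g) ∉ M).card
        - ((ring8 i j).filter fun g => s((i, j), g) ∈ edges h p ∧ s((i, j), g) ∈ M).card := by
    rw [Finset.card_filter, Finset.card_filter]
    push_cast
    rw [← Finset.sum_sub_distrib]
    refine Finset.sum_congr rfl fun g _ => ?_
    unfold edgeContrib edgeExponent
    split_ifs <;> simp_all
  rw [this]
  push_cast
  rfl

end Matchings

/-! ### Comparing diagonals of `G_p` and of the truncated surface. -/

section Corners

variable {h : Face → ℤ} {p : ℤ × ℤ × ℤ} {M : Set (Sym2 Face)} {W : Finset LatticeEdge}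

/-- How the contribution `k'` of a corner of `f`, between the neighbours `x` and `y`, to the excess
of a configuration is related to the contribution `k` of its diagonal in the finite graph. -/
def CornerRel (h : Face → ℤ) (p : ℤ × ℤ × ℤ) (f x y : Face) (k' k : ℤ) : Prop :=
  (h f < coneHeight p f → k' = k) ∧
  (¬h f < coneHeight p f →
    (coneHeight p x = coneHeight p f - 1 → coneHeight p y = coneHeight p f - 1 →
      k = 0 ∧ k' = 0) ∧
    (coneHeight p x = coneHeight p f + 1 → coneHeight p y = coneHeight p f - 1 →
      k = 0 ∧ k' = if h x < coneHeight p x then 0 else -1) ∧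
    (coneHeight p x = coneHeight p f - 1 → coneHeight p y = coneHeight p f + 1 →
      k = 0 ∧ k' = if h y < coneHeight p y then 0 else -1) ∧
    (coneHeight p x = coneHeight p f + 1 → coneHeight p y = coneHeight p f + 1 → k' = k))

/-- Here `z` is the corner opposite to `f`, `D` the exponent of the diagonal `fz`, and `w` the
occupation of the sides `fx` and `xz` of one triangle it bounds. -/
theorem cornerRel_of {f x y z : Face} {w D k : ℤ}
    (a1 : h x = h f + 1 ∨ h x = h f - 1) (a2 : h y = h f + 1 ∨ h y = h f - 1)
    (a3 : h z = h x + 1 ∨ h z = h x - 1) (a4 : h z = h y + 1 ∨ h z = h y - 1)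
    (b1 : coneHeight p x = coneHeight p f + 1 ∨ coneHeight p x = coneHeight p f - 1)
    (b2 : coneHeight p y = coneHeight p f + 1 ∨ coneHeight p y = coneHeight p f - 1)
    (b3 : coneHeight p z = coneHeight p x + 1 ∨ coneHeight p z = coneHeight p x - 1)
    (b4 : coneHeight p z = coneHeight p y + 1 ∨ coneHeight p z = coneHeight p y - 1)
    (hcone : ¬(coneHeight p x = coneHeight p y ∧ coneHeight p f = coneHeight p z))
    (hpar : (h f - coneHeight p f) % 2 = 0)
    (hk : k = if h x ≠ h y ∧ (h f < coneHeight p f ∨ h z < coneHeight p z) then 1 - 2 * D else 0)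
    (hD : h x ≠ h y → (h f < coneHeight p f ∨ h z < coneHeight p z) → D + w = 1)
    (hw : ¬h f < coneHeight p f → ¬h x < coneHeight p x → ¬h y < coneHeight p y →
      ¬h z < coneHeight p z → w = 0) :
    CornerRel h p f x y (if truncate h p x = truncate h p y then 0 else 2 * w - 1) k := by
  unfold CornerRel truncate
  generalize h f = hf at *
  generalize h x = hx at *
  generalize h y = hy at *
  generalize h z = hz at *
  generalize coneHeight p f = cf at *
  generalize coneHeight p x = cx at *
  generalize coneHeight p y = cy at *
  generalize coneHeight p z = cz at *
  refine ⟨fun hc => ?_, fun hc => ⟨fun hx1 hy1 => ?_, fun hx1 hy1 => ?_, fun hx1 hy1 => ?_,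
    fun hx1 hy1 => ?_⟩⟩
  · rw [min_eq_left (by clear * - a1 b1 hpar hc; omega),
      min_eq_left (by clear * - a2 b2 hpar hc; omega), hk]
    by_cases hxy : hx = hy
    · rw [if_pos hxy, if_neg fun h => h.1 hxy]
    · rw [if_neg hxy, if_pos ⟨hxy, Or.inl hc⟩]
      linarith [hD hxy (Or.inl hc)]
  · rw [min_eq_right (by clear * - a1 hx1 hc; omega), min_eq_right (by clear * - a2 hy1 hc; omega),
      if_pos (hx1.trans hy1.symm), hk, if_neg]
    · simp
    · clear * - a1 a2 a3 a4 b3 b4 hx1 hy1 hc hcone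
      omega
  -- Here `x` is nearer to the apex and `y` farther. If `x` is closed, it lies two below the cone,
  -- level with the truncated `y`, and the diagonal disappears. Otherwise no face of the square is
  -- closed and the diagonal is matched, contributing `-1`.
  · have h0 : ¬(hx ≠ hy ∧ (hf < cf ∨ hz < cz)) := by
      clear * - a1 a2 a3 a4 b3 b4 hx1 hy1 hc
      omega
    rw [hk, if_neg h0]
    refine ⟨rfl, ?_⟩
    rw [min_eq_right (by clear * - a2 hy1 hc; omega : cy ≤ hy)]
    split_ifs with h1 h2 h2
    · rfl
    · clear * - h1 h2 hx1 hy1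
      omega
    · clear * - h1 h2 hx1 hy1 a1 b1 hpar hc
      omega
    · rw [hw hc h2 (by clear * - a2 hy1 hc; omega)
        (by clear * - a1 a2 a3 a4 b3 b4 hx1 hy1 hc h2; omega)]
      rfl
  · have h0 : ¬(hx ≠ hy ∧ (hf < cf ∨ hz < cz)) := by
      clear * - a1 a2 a3 a4 b3 b4 hx1 hy1 hc
      omega
    rw [hk, if_neg h0]
    refine ⟨rfl, ?_⟩
    rw [min_eq_right (by clear * - a1 hx1 hc; omega : cx ≤ hx)]
    split_ifs with h1 h2 h2
    · rfl
    · clear * - h1 h2 hx1 hy1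
      omega
    · clear * - h1 h2 hx1 hy1 a2 b2 hpar hc
      omega
    · rw [hw hc (by clear * - a1 hx1 hc; omega) h2
        (by clear * - a1 a2 a3 a4 b3 b4 hx1 hy1 hc h2; omega)]
      rfl
  · have h1 : (hx ≠ hy ∧ (hf < cf ∨ hz < cz)) ↔ min hx cx ≠ min hy cy := by
      clear * - a1 a2 a3 a4 b3 b4 hx1 hy1 hc hpar hcone
      omega
    rw [hk]
    by_cases h2 : min hx cx = min hy cy
    · rw [if_pos h2, if_neg (by rw [h1]; exact fun h => h h2)]
    · rw [if_neg h2, if_pos (h1.2 h2)]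
      linarith [hD (h1.2 h2).1 (h1.2 h2).2]

theorem edgeContrib_eq (hh : IsHeightFunction h) (M : Set (Sym2 Face)) {f g : Face} {P : Prop}
    [Decidable P] (hP : FacesBorder h f g ↔ P) :
    edgeContrib h p M f g = if P ∧ (h f < coneHeight p f ∨ h g < coneHeight p g) then
      1 - 2 * edgeExponent M s(f, g) else 0 := by
  simp only [edgeContrib, hh.mem_edges_iff, hP]

theorem cornerRels (hh : IsHeightFunction h) (hp : p ∈ octLattice) (hM : IsMatching h p M)
    (hW : ∀ e, e ∈ W ↔ toSym e ∈ M) (i j : ℤ) :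
    CornerRel h p (i, j) (i + 1, j) (i, j + 1) (mainDiag (truncate h p) W i j)
      (edgeContrib h p M (i, j) (i + 1, j + 1)) ∧
    CornerRel h p (i + 1, j + 1) (i + 1, j) (i, j + 1) (mainDiag (truncate h p) W i j)
      (edgeContrib h p M (i + 1, j + 1) (i, j)) ∧
    CornerRel h p (i + 1, j) (i, j) (i + 1, j + 1) (antiDiag (truncate h p) W i j)
      (edgeContrib h p M (i + 1, j) (i, j + 1)) ∧
    CornerRel h p (i, j + 1) (i, j) (i + 1, j + 1) (antiDiag (truncate h p) W i j)
      (edgeContrib h p M (i, j + 1) (i + 1, j)) := by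
  have a1 := hh.horiz i j
  have a2 := hh.vert i j
  have a3 := hh.vert (i + 1) j
  have a4 := hh.horiz i (j + 1)
  have b1 := coneHeight_horiz p i j
  have b2 := coneHeight_vert p i j
  have b3 := coneHeight_vert p (i + 1) j
  have b4 := coneHeight_horiz p i (j + 1)
  have par : ∀ k l, (h (k, l) - coneHeight p (k, l)) % 2 = 0 := fun k l => by
    have := hh.parity k l
    have := coneHeight_parity hp k l
    omega
  have flip : ∀ {u v : ℤ}, u = v + 1 ∨ u = v - 1 → v = u + 1 ∨ v = u - 1 := by
    intro u v h
    omega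
  have hcone := coneHeight_not_cross p i j
  have zero := fun f g => edgeExponent_eq_zero (f := f) (g := g) hh hM
  have mr := @main_sum_right h p M hh hM i j
  have al := @anti_sum_left h p M hh hM i j
  have bm := facesBorder_main (h := h) (i := i) (j := j)
  have ba := facesBorder_anti (h := h) (i := i) (j := j)
  have oB := occ_eq_edgeExponent hW (false, i, j)
  have oL := occ_eq_edgeExponent hW (true, i, j)
  have oR := occ_eq_edgeExponent hW (true, i + 1, j)
  simp only [toSym] at oB oL oR
  unfold mainDiag antiDiag
  rw [oB, oL, oR]
  refine ⟨?_, ?_, ?_, ?_⟩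
  · refine cornerRel_of (D := edgeExponent M s((i, j), (i + 1, j + 1))) a1 a2 a3 a4 b1 b2 b3 b4
      hcone (par _ _) (edgeContrib_eq hh M bm) (fun h1 h2 => ?_) fun hf hx hy hz => ?_
    · linarith [mr h1 (h2.imp_right Or.inl)]
    · rw [zero _ _ hx hf, zero _ _ hz hx, add_zero]
  · refine cornerRel_of (D := edgeExponent M s((i, j), (i + 1, j + 1))) (flip a3) (flip a4)
      (flip a1) (flip a2) (flip b3) (flip b4) (flip b1) (flip b2)
      (fun hx => hcone ⟨hx.1, hx.2.symm⟩) (par _ _) ?_ (fun h1 h2 => ?_) fun hf hx hy hz => ?_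
    · rw [edgeContrib_eq hh M (Iff.trans ⟨FacesBorder.symm, FacesBorder.symm⟩ bm), Sym2.eq_swap]
    · linarith [mr h1 (h2.symm.imp_right Or.inl)]
    · rw [zero _ _ hx hz, zero _ _ hf hx, add_zero]
  · refine cornerRel_of (D := edgeExponent M s((i + 1, j), (i, j + 1))) (flip a1) a3
      a2 (flip a4) (flip b1) b3 b2 (flip b4)
      (fun hx => hcone ⟨hx.2, hx.1⟩) (par _ _) (edgeContrib_eq hh M ba) (fun h1 h2 => ?_)
      fun hf hx hy hz => ?_
    · linarith [al h1 (h2.imp_right Or.inl)]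
    · rw [zero _ _ hf hx, zero _ _ hz hx, add_zero]
  · refine cornerRel_of (D := edgeExponent M s((i + 1, j), (i, j + 1))) (flip a2) a4
      a1 (flip a3) (flip b2) b4 b1 (flip b3)
      (fun hx => hcone ⟨hx.2.symm, hx.1⟩) (par _ _) ?_ (fun h1 h2 => ?_)
      fun hf hx hy hz => ?_
    · rw [edgeContrib_eq hh M (Iff.trans ⟨FacesBorder.symm, FacesBorder.symm⟩ ba), Sym2.eq_swap]
    · linarith [al h1 (h2.symm.imp_right Or.inl)]
    · rw [zero _ _ hz hx, zero _ _ hf hx, add_zero]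

theorem edgeContrib_side (hh : IsHeightFunction h) {f g : Face} (M : Set (Sym2 Face))
    (hb : FacesBorder h f g) :
    edgeContrib h p M f g = if h f < coneHeight p f ∨ h g < coneHeight p g then
      1 - 2 * edgeExponent M s(f, g) else 0 := by
  rw [edgeContrib_eq (P := True) hh M (by simp [hb])]
  simp only [true_and]

end Corners

/-! ### Face exponents, uniqueness and the formula for `a` edges. -/

section Exponents

variable {h : Face → ℤ} {p : ℤ × ℤ × ℤ} {M : Set (Sym2 Face)} {W : Finset LatticeEdge}

theorem coneHeight_east_west (p : ℤ × ℤ × ℤ) (i j : ℤ) :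
    (i = p.2.1 ∧ coneHeight p (i + 1, j) = coneHeight p (i, j) - 1 ∧
      coneHeight p (i - 1, j) = coneHeight p (i, j) - 1) ∨
    (coneHeight p (i + 1, j) = coneHeight p (i, j) - 1 ∧
      coneHeight p (i - 1, j) = coneHeight p (i, j) + 1) ∨
    (coneHeight p (i + 1, j) = coneHeight p (i, j) + 1 ∧
      coneHeight p (i - 1, j) = coneHeight p (i, j) - 1) := by
  rcases lt_trichotomy i p.2.1 with hi | hi | hi
  · have h1 := coneHeight_succ_fst_of_lt hi j
    have h2 := coneHeight_succ_fst_of_lt (show i - 1 < p.2.1 by omega) j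
    rw [sub_add_cancel] at h2
    omega
  · have h1 := coneHeight_succ_fst_of_le hi.ge j
    have h2 := coneHeight_succ_fst_of_lt (show i - 1 < p.2.1 by omega) j
    rw [sub_add_cancel] at h2
    omega
  · have h1 := coneHeight_succ_fst_of_le hi.le j
    have h2 := coneHeight_succ_fst_of_le (show p.2.1 ≤ i - 1 by omega) j
    rw [sub_add_cancel] at h2
    omega

theorem coneHeight_north_south (p : ℤ × ℤ × ℤ) (i j : ℤ) :
    (j = p.2.2 ∧ coneHeight p (i, j + 1) = coneHeight p (i, j) - 1 ∧
      coneHeight p (i, j - 1) = coneHeight p (i, j) - 1) ∨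
    (coneHeight p (i, j + 1) = coneHeight p (i, j) - 1 ∧
      coneHeight p (i, j - 1) = coneHeight p (i, j) + 1) ∨
    (coneHeight p (i, j + 1) = coneHeight p (i, j) + 1 ∧
      coneHeight p (i, j - 1) = coneHeight p (i, j) - 1) := by
  rcases lt_trichotomy j p.2.2 with hj | hj | hj
  · have h1 := coneHeight_succ_snd_of_lt hj i
    have h2 := coneHeight_succ_snd_of_lt (show j - 1 < p.2.2 by omega) i
    rw [sub_add_cancel] at h2
    omega
  · have h1 := coneHeight_succ_snd_of_le hj.ge i
    have h2 := coneHeight_succ_snd_of_lt (show j - 1 < p.2.2 by omega) i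
    rw [sub_add_cancel] at h2
    omega
  · have h1 := coneHeight_succ_snd_of_le hj.le i
    have h2 := coneHeight_succ_snd_of_le (show p.2.2 ≤ j - 1 by omega) i
    rw [sub_add_cancel] at h2
    omega

/-- `o` indicates whether `x` is farther away from the apex than its neighbour `f`; if not, then
`n` indicates whether `x` is not closed. -/
def IsOutward (h : Face → ℤ) (p : ℤ × ℤ × ℤ) (f x : Face) (o n : ℤ) : Prop :=
  (coneHeight p x = coneHeight p f - 1 ∧ o = 1 ∧ n = 0) ∨
    (coneHeight p x = coneHeight p f + 1 ∧ o = 0 ∧ n = if h x < coneHeight p x then 0 else 1)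

/-- The correction is `-1` exactly when one neighbour is outward and the other is inward and not
closed. -/
theorem CornerRel.sub_eq {f x y : Face} {k' k ox nx oy ny : ℤ} (hr : CornerRel h p f x y k' k)
    (hc : ¬h f < coneHeight p f) (hx : IsOutward h p f x ox nx) (hy : IsOutward h p f y oy ny) :
    k' - k = -(nx * oy + ny * ox) ∧ (ox = 1 ∨ oy = 1 → k = 0) := by
  obtain ⟨q1, q2, q3, q4⟩ := hr.2 hc
  rcases hx with ⟨hx, rfl, rfl⟩ | ⟨hx, rfl, rfl⟩ <;>
    rcases hy with ⟨hy, rfl, rfl⟩ | ⟨hy, rfl, rfl⟩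
  · obtain ⟨rfl, rfl⟩ := q1 hx hy
    simp
  · obtain ⟨rfl, rfl⟩ := q3 hx hy
    split_ifs <;> simp
  · obtain ⟨rfl, rfl⟩ := q2 hx hy
    split_ifs <;> simp
  · rw [q4 hx hy]
    simp

/-- On the truncated surface a side contributes `1 - 2 * m`; in `G_p` it is missing when the
neighbour is outward or not closed, and `o + n` accounts for this. -/
theorem exists_isOutward {f x : Face}
    (hx : coneHeight p x = coneHeight p f + 1 ∨ coneHeight p x = coneHeight p f - 1)
    (hd : h x = h f + 1 ∨ h x = h f - 1) (hc : ¬h f < coneHeight p f) {m k : ℤ}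
    (hm : ¬h x < coneHeight p x → m = 0)
    (hk : k = if h x < coneHeight p x then 1 - 2 * m else 0) :
    ∃ o n, IsOutward h p f x o n ∧ k = 1 - 2 * m - n - o := by
  rcases hx with hx | hx
  · refine ⟨0, if h x < coneHeight p x then 0 else 1, Or.inr ⟨hx, rfl, rfl⟩, ?_⟩
    rw [hk]
    split_ifs with h1
    · ring
    · rw [hm h1]
      ring
  · have h1 : ¬h x < coneHeight p x := by omega
    refine ⟨1, 0, Or.inl ⟨hx, rfl, rfl⟩, ?_⟩
    rw [hk, if_neg h1, hm h1]
    ring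

theorem IsOutward.of_sub {f x : Face} {o n : ℤ} (ho : IsOutward h p f x o n)
    (hx : coneHeight p x = coneHeight p f - 1) : o = 1 ∧ n = 0 :=
  ho.elim (fun h => h.2) fun h => by omega

theorem IsOutward.of_add {f x : Face} {o n : ℤ} (ho : IsOutward h p f x o n)
    (hx : coneHeight p x = coneHeight p f + 1) : o = 0 ∧ (n = 0 ∨ n = 1) := by
  rcases ho with h | ⟨-, rfl, rfl⟩
  · omega
  · split_ifs <;> simp

theorem sum_edgeContrib_eq (hh : IsHeightFunction h) (hp : p ∈ upperSet h)
    (hM : IsMatching h p M) (hW : ∀ e, e ∈ W ↔ toSym e ∈ M) (i j : ℤ) :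
    surfExp (truncate h p) W (i, j)
      = if h (i, j) < coneHeight p (i, j) then
          (∑ g ∈ ring8 i j, edgeContrib h p M (i, j) g + 1) / 2 - 1
        else (∑ g ∈ ring8 i j, edgeContrib h p M (i, j) g + 1) / 2 := by
  have rne := (cornerRels hh hp.1 hM hW i j).1
  have rsw := (cornerRels hh hp.1 hM hW (i - 1) (j - 1)).2.1
  have rnw := (cornerRels hh hp.1 hM hW (i - 1) j).2.2.1
  have rse := (cornerRels hh hp.1 hM hW i (j - 1)).2.2.2
  have oe := occ_eq_edgeExponent hW (false, i, j)
  have on := occ_eq_edgeExponent hW (true, i, j)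
  have ow := occ_eq_edgeExponent hW (false, i - 1, j)
  have os := occ_eq_edgeExponent hW (true, i, j - 1)
  have be := (facesBorder_horiz (h := h) i j).symm
  have bn := (facesBorder_vert (h := h) i j).symm
  have bw := facesBorder_horiz (h := h) (i - 1) j
  have bs := facesBorder_vert (h := h) i (j - 1)
  simp only [toSym, sub_add_cancel] at rsw rnw rse oe on ow os bw bs
  have ke := edgeContrib_side (p := p) hh M be
  have kn := edgeContrib_side (p := p) hh M bn
  have kw := edgeContrib_side (p := p) hh M bw
  have ks := edgeContrib_side (p := p) hh M bs
  rw [Sym2.eq_swap, ← oe] at ke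
  rw [Sym2.eq_swap, ← on] at kn
  rw [← ow] at kw
  rw [← os] at ks
  rw [sum_ring8]
  simp only [surfExp, excess]
  by_cases hc : h (i, j) < coneHeight p (i, j)
  · rw [if_pos (Or.inl hc)] at ke kn kw ks
    rw [if_pos hc, ke, kn, kw, ks, rne.1 hc, rsw.1 hc, rnw.1 hc, rse.1 hc]
    omega
  · simp only [hc, false_or] at ke kn kw ks
    rw [if_neg hc]
    have zero := fun f g => edgeExponent_eq_zero (f := f) (g := g) hh hM
    have zE := zero (i + 1, j) (i, j)
    have zN := zero (i, j + 1) (i, j)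
    have zW := zero (i, j) (i - 1, j)
    have zS := zero (i, j) (i, j - 1)
    rw [← oe] at zE
    rw [← on] at zN
    rw [← ow] at zW
    rw [← os] at zS
    have ae := hh.horiz i j
    have an := hh.vert i j
    have aw := hh.horiz (i - 1) j
    have as := hh.vert i (j - 1)
    rw [sub_add_cancel] at aw as
    have flip : ∀ {u v : ℤ}, u = v + 1 ∨ u = v - 1 → v = u + 1 ∨ v = u - 1 := by
      intro u v h
      omega
    have cw := coneHeight_horiz p (i - 1) j
    have cs := coneHeight_vert p i (j - 1)
    rw [sub_add_cancel] at cw cs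
    obtain ⟨oE, nE, hE, kE⟩ := exists_isOutward (coneHeight_horiz p i j) ae hc (zE · hc) ke
    obtain ⟨oN, nN, hN, kN⟩ := exists_isOutward (coneHeight_vert p i j) an hc (zN · hc) kn
    obtain ⟨oW, nW, hW, kW⟩ := exists_isOutward (flip cw) (flip aw) hc (zW hc) kw
    obtain ⟨oS, nS, hS, kS⟩ := exists_isOutward (flip cs) (flip as) hc (zS hc) ks
    obtain ⟨q1, q2⟩ := rne.sub_eq hc hE hN
    obtain ⟨r1, r2⟩ := rsw.sub_eq hc hS hW
    obtain ⟨s1, s2⟩ := rnw.sub_eq hc hW hN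
    obtain ⟨t1, t2⟩ := rse.sub_eq hc hS hE
    rw [kE, kN, kW, kS]
    -- Since `p` lies above the surface, its own face is closed.
    have hcen : ¬(i = p.2.1 ∧ j = p.2.2) := by
      rintro ⟨rfl, rfl⟩
      exact hc (by simpa [coneHeight] using hp.2)
    clear ke kn kw ks rne rsw rnw rse zero zE zN zW zS ae an aw as cw cs be bn bw bs oe on ow os
      kE kN kW kS
    have EW : (i = p.2.1 ∧ oE = 1 ∧ nE = 0 ∧ oW = 1 ∧ nW = 0) ∨
        (oE = 1 ∧ nE = 0 ∧ oW = 0 ∧ (nW = 0 ∨ nW = 1)) ∨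
        (oE = 0 ∧ (nE = 0 ∨ nE = 1) ∧ oW = 1 ∧ nW = 0) := by
      rcases coneHeight_east_west p i j with ⟨x0, x1, x2⟩ | ⟨x1, x2⟩ | ⟨x1, x2⟩
      · exact Or.inl ⟨x0, (hE.of_sub x1).1, (hE.of_sub x1).2, hW.of_sub x2⟩
      · exact Or.inr (Or.inl ⟨(hE.of_sub x1).1, (hE.of_sub x1).2, hW.of_add x2⟩)
      · exact Or.inr (Or.inr ⟨(hE.of_add x1).1, (hE.of_add x1).2, hW.of_sub x2⟩)
    have NS : (j = p.2.2 ∧ oN = 1 ∧ nN = 0 ∧ oS = 1 ∧ nS = 0) ∨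
        (oN = 1 ∧ nN = 0 ∧ oS = 0 ∧ (nS = 0 ∨ nS = 1)) ∨
        (oN = 0 ∧ (nN = 0 ∨ nN = 1) ∧ oS = 1 ∧ nS = 0) := by
      rcases coneHeight_north_south p i j with ⟨x0, x1, x2⟩ | ⟨x1, x2⟩ | ⟨x1, x2⟩
      · exact Or.inl ⟨x0, (hN.of_sub x1).1, (hN.of_sub x1).2, hS.of_sub x2⟩
      · exact Or.inr (Or.inl ⟨(hN.of_sub x1).1, (hN.of_sub x1).2, hS.of_add x2⟩)
      · exact Or.inr (Or.inr ⟨(hN.of_add x1).1, (hN.of_add x1).2, hS.of_sub x2⟩)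
    clear hE hN hW hS
    generalize mainDiag (truncate h p) W i j = A1 at *
    generalize mainDiag (truncate h p) W (i - 1) (j - 1) = A2 at *
    generalize antiDiag (truncate h p) W (i - 1) j = A3 at *
    generalize antiDiag (truncate h p) W i (j - 1) = A4 at *
    generalize edgeContrib h p M (i, j) (i + 1, j + 1) = k1 at *
    generalize edgeContrib h p M (i, j) (i - 1, j - 1) = k2 at *
    generalize edgeContrib h p M (i, j) (i - 1, j + 1) = k3 at *
    generalize edgeContrib h p M (i, j) (i + 1, j - 1) = k4 at *
    -- Off the axes through the apex the corrections cancel. On an axis, if the inward neighbour is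
    -- closed, the excess is one more than the sum over `G_p`; that sum is then odd, so halving with
    -- rounding up gives the same exponent.
    rcases EW with ⟨x0, rfl, rfl, rfl, rfl⟩ | ⟨rfl, rfl, rfl, hn⟩ | ⟨rfl, hn, rfl, rfl⟩ <;>
      rcases NS with ⟨y0, rfl, rfl, rfl, rfl⟩ | ⟨rfl, rfl, rfl, hn'⟩ | ⟨rfl, hn', rfl, rfl⟩ <;>
      simp only [true_or, or_true, true_imp_iff, mul_zero, mul_one, add_zero,
        zero_add] at q1 q2 r1 r2 s1 s2 t1 t2
    · exact absurd ⟨x0, y0⟩ hcen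
    all_goals omega

/-- One horizontal neighbour lies farther from the apex and is not closed either. Thus a non-closed
face having some edge in `G_p` is open. -/
theorem exists_notMem_edges (hh : IsHeightFunction h) {i j : ℤ}
    (hc : ¬h (i, j) < coneHeight p (i, j)) :
    ∃ e ∈ infEdges h, (i, j) ∈ e ∧ e ∉ edges h p := by
  have ae := hh.horiz i j
  have aw := hh.horiz (i - 1) j
  rw [sub_add_cancel] at aw
  rcases coneHeight_east_west p i j with ⟨-, x1, -⟩ | ⟨x1, -⟩ | ⟨-, x2⟩
  · refine ⟨_, ⟨_, _, facesBorder_horiz i j, rfl⟩, by simp, fun he => ?_⟩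
    rcases (hh.mem_edges_iff.1 he).2 with h1 | h1 <;> omega
  · refine ⟨_, ⟨_, _, facesBorder_horiz i j, rfl⟩, by simp, fun he => ?_⟩
    rcases (hh.mem_edges_iff.1 he).2 with h1 | h1 <;> omega
  · refine ⟨_, ⟨_, _, facesBorder_horiz (i - 1) j, rfl⟩, by simp, fun he => ?_⟩
    rcases (hh.mem_edges_iff.1 he).2 with h1 | h1
    · rw [sub_add_cancel] at h1
      exact hc h1
    · omega

theorem faceExponent_eq_surfExp (hh : IsHeightFunction h) (hp : p ∈ upperSet h)
    (hM : IsMatching h p M) (hW : ∀ e, e ∈ W ↔ toSym e ∈ M) (f : Face) :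
    faceExponent h p M f = surfExp (truncate h p) W f := by
  obtain ⟨i, j⟩ := f
  rw [sum_edgeContrib_eq hh hp hM hW, faceExponent, halfExcess_eq]
  by_cases hc : h (i, j) < coneHeight p (i, j)
  · rw [if_pos (hh.mem_closedFaces.2 hc), if_pos hc]
  · rw [if_neg (fun h => hc (hh.mem_closedFaces.1 h)), if_neg hc]
    split_ifs with ho
    · rfl
    · have : ∑ g ∈ ring8 i j, edgeContrib h p M (i, j) g = 0 := by
        refine Finset.sum_eq_zero fun g _ => if_neg fun he => ho ⟨?_, exists_notMem_edges hh hc⟩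
        exact ⟨_, he.1, by simp, he⟩
      rw [this]
      rfl

theorem exists_config (hh : IsHeightFunction h) (hp : p ∈ upperSet h) (hM : IsMatching h p M) :
    ∃ W : Finset LatticeEdge, (∀ e, e ∈ W ↔ toSym e ∈ M) ∧ IsConfig (truncate h p) W ∧
      ∀ f, faceExponent h p M f = surfExp (truncate h p) W f := by
  have hW : ∀ e, e ∈ (finite_latticeEdges hh hp.1 hM).toFinset ↔ toSym e ∈ M := by simp
  exact ⟨_, hW, isConfig_of_isMatching hh hp.1 hM hW, faceExponent_eq_surfExp hh hp hM hW⟩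

/-- A diagonal of `G_p` bounds a triangle whose other two edges are weighted, and the exponents
around a triangle add up to one. -/
theorem edgeExponent_diag_eq (hh : IsHeightFunction h) {M' : Set (Sym2 Face)}
    (hM : IsMatching h p M) (hM' : IsMatching h p M')
    (hside : ∀ e, edgeExponent M (toSym e) = edgeExponent M' (toSym e)) (i j : ℤ) :
    edgeExponent M s((i, j), (i + 1, j + 1)) = edgeExponent M' s((i, j), (i + 1, j + 1)) ∧
    edgeExponent M s((i + 1, j), (i, j + 1)) = edgeExponent M' s((i + 1, j), (i, j + 1)) := by
  have hB := hside (false, i, j)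
  have hL := hside (true, i, j)
  have hR := hside (true, i + 1, j)
  simp only [toSym] at hB hL hR
  have zero : ∀ {N e}, IsMatching h p N → e ∉ edges h p → edgeExponent N e = 0 :=
    fun hN he => if_neg fun h => he (hN.1 h)
  constructor
  · by_cases he : s((i, j), (i + 1, j + 1)) ∈ edges h p
    · obtain ⟨h1, h2⟩ := hh.mem_edges_iff.1 he
      have h3 := main_sum_right hh hM (facesBorder_main.1 h1) (h2.imp_right Or.inl)
      have h4 := main_sum_right hh hM' (facesBorder_main.1 h1) (h2.imp_right Or.inl)
      omega
    · rw [zero hM he, zero hM' he]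
  · by_cases he : s((i + 1, j), (i, j + 1)) ∈ edges h p
    · obtain ⟨h1, h2⟩ := hh.mem_edges_iff.1 he
      have h3 := anti_sum_left hh hM (facesBorder_anti.1 h1) (h2.imp_right Or.inl)
      have h4 := anti_sum_left hh hM' (facesBorder_anti.1 h1) (h2.imp_right Or.inl)
      omega
    · rw [zero hM he, zero hM' he]

/-- A matching is determined by its weighted edges. -/
theorem matching_ext (hh : IsHeightFunction h) {M' : Set (Sym2 Face)} (hM : IsMatching h p M)
    (hM' : IsMatching h p M')
    (hside : ∀ e, edgeExponent M (toSym e) = edgeExponent M' (toSym e)) : M = M' := by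
  have key : ∀ e ∈ infEdges h, edgeExponent M e = edgeExponent M' e := by
    rintro e ⟨⟨i, j⟩, g, hfg, rfl⟩
    have diag := edgeExponent_diag_eq hh hM hM' hside
    have hg := hfg.mem_ring8
    simp only [ring8, Finset.mem_insert, Finset.mem_singleton] at hg
    rcases hg with rfl | rfl | rfl | rfl | rfl | rfl | rfl | rfl
    · rw [Sym2.eq_swap]
      exact hside (false, i, j)
    · rw [Sym2.eq_swap]
      exact hside (true, i, j)
    · simpa [toSym] using hside (false, i - 1, j)
    · simpa [toSym] using hside (true, i, j - 1)
    · exact (diag i j).1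
    · rw [Sym2.eq_swap]
      simpa using (diag (i - 1) (j - 1)).1
    · simpa using (diag (i - 1) j).2
    · rw [Sym2.eq_swap]
      simpa using (diag i (j - 1)).2
  ext e
  by_cases he : e ∈ infEdges h
  · rw [← edgeExponent_eq_one_iff, key e he, edgeExponent_eq_one_iff]
  · exact ⟨fun h => absurd (hM.1 h).1 he, fun h => absurd (hM'.1 h).1 he⟩

theorem edgeExponent_eq_neg_finsum (hh : IsHeightFunction h) (hp : p ∈ upperSet h)
    (hM : IsMatching h p M) {i₀ j₀ : ℤ} {e : Sym2 Face} (he : e ∈ edges h p)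
    (hl : EdgeLabel h e .a i₀ j₀) :
    edgeExponent M e = -∑ᶠ f ∈ quadrant h i₀ j₀, faceExponent h p M f := by
  obtain ⟨W, hW, hc, hf⟩ := exists_config hh hp hM
  obtain ⟨i, j, hlt, rfl, rfl, rfl⟩ : ∃ i j, h (i, j) < h (i + 1, j) ∧
      e = s((i + 1, j), (i, j)) ∧ i₀ = i + 1 + h (i, j) ∧ j = j₀ := by
    cases hl
    exact ⟨_, _, ‹_›, rfl, rfl, rfl⟩
  have hcl := (hh.mem_edges_iff.1 he).2
  have ah := hh.horiz i j
  have ac := coneHeight_horiz p i j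
  have key := hh.occ_add_finsum hp.1 hp.2.le hc (false, i, j)
  -- One face of the edge is closed; steps and parity put the other on or below the cone, so
  -- truncation does not alter the label.
  have hlab : edgeLab (truncate h p) (false, i, j) = (.a, i + 1 + h (i, j), j) := by
    have t1 : truncate h p (i, j) = h (i, j) := min_eq_left (by omega)
    have t2 : truncate h p (i + 1, j) = h (i + 1, j) := by
      have := hh.parity (i + 1) j
      have := coneHeight_parity hp.1 (i + 1) j
      exact min_eq_left (by omega)
    simp only [edgeLab, t1, t2]
    rw [if_pos hlt]
  -- The apex has degree zero because a face of the edge lies strictly below its cone.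
  have hreg : ¬region (.a, i + 1 + h (i, j), j) p := by
    obtain ⟨n, k, l⟩ := p
    simp only [region, not_and]
    intro h1 h2
    have p1 := hh.parity i j
    have p2 := coneHeight_parity hp.1 i j
    have p3 := hh.parity (i + 1) j
    have p4 := coneHeight_parity hp.1 (i + 1) j
    simp only [coneHeight] at hcl p2 p4
    have q1 := le_abs_self (i - k)
    have q2 := neg_abs_le (j - l)
    have q3 := le_abs_self (j - l)
    have q4 := le_abs_self (i + 1 - k)
    rcases hcl with h3 | h3 <;> omega
  rw [hlab, if_neg hreg, occ_eq_edgeExponent hW] at key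
  rw [eq_neg_iff_add_eq_zero, ← key]
  congr 1
  refine finsum_congr fun f => ?_
  classical
  have hq : f ∈ quadrant h (i + 1 + h (i, j)) j ↔ region (.a, i + 1 + h (i, j), j) (h f, f) :=
    Iff.rfl
  by_cases hfq : f ∈ quadrant h (i + 1 + h (i, j)) j
  · rw [finsum_eq_if, if_pos hfq, if_pos (hq.1 hfq), one_mul, hf]
  · rw [finsum_eq_if, if_neg hfq, if_neg (fun h => hfq (hq.2 h)), zero_mul]

end Exponents

theorem mainTheorem5 (h : Face → ℤ) (hh : IsHeightFunction h) :
    (∀ (n i j : ℤ) (hp : (n, i, j) ∈ initialSet h ∪ upperSet h),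
      ∃ F : LaurentRing, algebraMap LaurentRing RatFunField F = octF hh n i j hp ∧
        (∀ m, F.coeff m = 0 ∨ F.coeff m = 1) ∧
        (∀ m, (edgesToOne F).coeff m = 0 ∨ (edgesToOne F).coeff m = 1)) ∧
    (∀ p ∈ upperSet h,
      (∀ M M' : Set (Sym2 Face), IsMatching h p M → IsMatching h p M' →
        (∀ f : Face, faceExponent h p M f = faceExponent h p M' f) → M = M') ∧
      (∀ M : Set (Sym2 Face), IsMatching h p M →
        (Function.support (faceExponent h p M)).Finite ∧
        ∀ (i₀ j₀ : ℤ), ∀ e ∈ edges h p, EdgeLabel h e .a i₀ j₀ →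
          edgeExponent M e = -∑ᶠ f ∈ quadrant h i₀ j₀, faceExponent h p M f)) := by
  refine ⟨fun n i j hp => exists_polynomial hh hp, fun p hp => ⟨fun M M' hM hM' he => ?_,
    fun M hM => ⟨?_, fun i₀ j₀ e he hl => edgeExponent_eq_neg_finsum hh hp hM he hl⟩⟩⟩
  · obtain ⟨W, hW, hc, hf⟩ := exists_config hh hp hM
    obtain ⟨W', hW', hc', hf'⟩ := exists_config hh hp hM'
    have hWW : W = W' := hh.config_ext hp.1 hp.2.le hc hc' fun f => by rw [← hf, he, hf']
    refine matching_ext hh hM hM' fun e => ?_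
    rw [← occ_eq_edgeExponent hW, hWW, occ_eq_edgeExponent hW']
  · obtain ⟨W, hW, hc, hf⟩ := exists_config hh hp hM
    rw [funext hf]
    exact ((hh.isSurface_truncate hp.1).finite_isConfig hp.1).2 W hc
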